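/- Let $d\ge 2$ (in applications $d=2,3$) and $k\ge 1$. Let $\Omega\subset\mathbb R^d$ be a polytopal domain and $\mathcal T_h$ a finite partition of $\Omega$ into convex polytopes with nonempty, pairwise disjoint interiors, such that every $(d-1)$-dimensional face (called an edge) of an element $T$ either lies on $\partial\Omega$ or is also an edge of another element. Let $n_T$ be the number of edges of $T$, $h_T$ and $h_e$ the diameters of $T$ and $e$, $\mathcal E_h$ the set of all edges, and $\mathbf n$ the outward unit normal on $\partial T$. Let $a$ be a measurable symmetric $d\times d$ matrix function on $\Omega$ with $\lambda_1\xi^t\xi\le\xi^ta\xi\le\lambda_2\xi^t\xi$ for all $\xi\in\mathbb R^d$, where $\lambda_1,\lambda_2>0$. Put $$V_h=\{v=\{v_0,v_b\}: v_0|_T\in P_k(T)\ (T\in\mathcal T_h),\ v_b|_e\in P_{k-1}(e)\ (e\in\mathcal E_h)\},\qquad V_h^0=\{v\in V_h: v_b=0\text{ on }\partial\Omega\},$$ with a single value of $v_b$ on each edge. Let $Q_b$ be the edgewise $L^2$ projection onto $P_{k-1}(e)$. For each $T$ let $j_T\ge n_T+k-1$ be an integer (for instance $j_T=n_T+k-1$),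 and for $v\in V_h$ let $\nabla_wv|_T\in[P_{j_T}(T)]^d$ be defined by $$(\nabla_wv,\mathbf q)_T=(\nabla v_0,\mathbf q)_T+\langle Q_b(v_b-v_0),\mathbf q\cdot\mathbf n\rangle_{\partial T}\qquad\forall\,\mathbf q\in[P_{j_T}(T)]^d .$$ Define $$|||v|||^2=\sum_{T\in\mathcal T_h}(a\nabla_wv,\nabla_wv)_T,\qquad \|v\|_{1,h}^2=\sum_{T\in\mathcal T_h}\left(\|\nabla v_0\|_T^2+h_T^{-1}\|Q_b(v_0-v_b)\|_{\partial T}^2\right).$$ (i) There are constants $C_1,C_2>0$ such that $C_1\|v\|_{1,h}\le|||v|||\le C_2\|v\|_{1,h}$ for all $v\in V_h$. (ii) The constants in (i) can be chosen to depend only on $d$, $k$, $\lambda_1$, $\lambda_2$, an upper bound $J$ for the $j_T$, and shape-regularity constants $\rho_v,\rho_e,\kappa,\theta>0$ such that, for every $T\in\mathcal T_h$ and every edge $e$ of $T$, $\rho_vh_T^d\le|T|$, $\rho_eh_e^{d-1}\le|e|$ and $\kappa h_T\le h_e$, and the outward unit normals of any two different edges of $T$ make an angle of at least $\theta$; in particular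 they do not depend on $h$, on the partition or on $\Omega$. (iii) For all $f\in L^2(\Omega)$ and $g\in L^2(\partial\Omega)$ there is exactly one $u_h=\{u_0,u_b\}\in V_h$ with $u_b=Q_bg$ on $\partial\Omega$ and $$\sum_{T\in\mathcal T_h}(a\nabla_wu_h,\nabla_wv)_T=(f,v_0)\qquad\forall\,v=\{v_0,v_b\}\in V_h^0 .$$ -/

import Mathlib

open MeasureTheory Matrix

noncomputable section

namespace WG

/-- Points of `ℝ^d` with the Euclidean norm. -/
abbrev Pt (d : ℕ) : Type := EuclideanSpace ℝ (Fin d)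

/-- Real polynomials in `d` variables. -/
abbrev Poly (d : ℕ) : Type := MvPolynomial (Fin d) ℝ

variable {d : ℕ}

/-! ### Polynomials as functions -/

/-- The polynomial function of `p`. -/
def polyFun (p : Poly d) (x : Pt d) : ℝ :=
  MvPolynomial.eval (fun l => x l) p

/-- The vector field whose components are the polynomials `G l`. -/
def vecFun (G : Fin d → Poly d) (x : Pt d) : Fin d → ℝ :=
  fun l => polyFun (G l) x

/-- The gradient of a polynomial. -/
def grad (p : Poly d) : Fin d → Poly d :=
  fun l => MvPolynomial.pderiv l p

/-- The space `P_r` of polynomials of total degree at most `r` on `ℝ^d`. On a cell `T`, which has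
interior points, a polynomial is determined by its values on `T`, so this is also `P_r(T)`. -/
abbrev polySpace (d r : ℕ) : Submodule ℝ (Poly d) :=
  MvPolynomial.restrictTotalDegree (Fin d) ℝ r

/-- Restriction of a polynomial to the set `e`, as a function extended by zero off `e`. -/
def restrictTo (e : Set (Pt d)) : Poly d →ₗ[ℝ] (Pt d → ℝ) where
  toFun p := e.indicator (polyFun p)
  map_add' p q := by
    classical
    ext x
    by_cases hx : x ∈ e <;> simp [hx, polyFun]
  map_smul' c p := by
    classical
    ext x
    by_cases hx : x ∈ e <;> simp [hx, polyFun, MvPolynomial.smul_eval]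

/-- The space `P_r(e)`: the restrictions to `e` of polynomials of total degree at most `r`. An
element of `P_r(e)` is stored as a function on `ℝ^d` that vanishes off `e`. -/
def polyOn (e : Set (Pt d)) (r : ℕ) : Submodule ℝ (Pt d → ℝ) :=
  (polySpace d r).map (restrictTo e)

/-! ### Convex polytopes -/

/-- The intersection of the half-spaces `⟪ν, x⟫ ≤ c ν`, `ν ∈ N`. -/
def halfSpaceInter (N : Finset (Pt d)) (c : Pt d → ℝ) : Set (Pt d) :=
  {x | ∀ ν ∈ N, inner ℝ ν x ≤ c ν}

/-- A convex polytope in `ℝ^d` with nonempty interior, given by the finite set of its outward unit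
normals and the positions of the supporting hyperplanes. The last field says that the description
is irredundant: each of the hyperplanes cuts out a `(d-1)`-dimensional face. Hence the facets of
the polytope (edges for `d = 2`, faces for `d = 3`) correspond one-to-one to the normals, and the
number `n` of facets is `normals.card`. -/
structure ConvexPolytope (d : ℕ) where
  normals : Finset (Pt d)
  offset : Pt d → ℝ
  norm_eq_one : ∀ ν ∈ normals, ‖ν‖ = 1
  isBounded : Bornology.IsBounded (halfSpaceInter normals offset)
  interior_nonempty : (interior (halfSpaceInter normals offset)).Nonempty
  facet_dim : ∀ ν ∈ normals, Module.finrank ℝ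
    (vectorSpan ℝ {x ∈ halfSpaceInter normals offset | inner ℝ ν x = offset ν}) + 1 = d

/-- The polytope as a (closed) subset of `ℝ^d`. -/
def ConvexPolytope.carrier (T : ConvexPolytope d) : Set (Pt d) :=
  halfSpaceInter T.normals T.offset

/-- The facet of `T` with outward unit normal `ν ∈ T.normals`. -/
def ConvexPolytope.facet (T : ConvexPolytope d) (ν : Pt d) : Set (Pt d) :=
  {x ∈ T.carrier | inner ℝ ν x = T.offset ν}

/-- The diameter `h_T`. -/
def ConvexPolytope.size (T : ConvexPolytope d) : ℝ :=
  Metric.diam T.carrier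

/-! ### Partitions of a polytopal domain -/

/-- A partition of the polytopal domain `Ω` into finitely many convex polytopes with pairwise
disjoint interiors, such that every facet of a cell either lies on `∂Ω` or is also a facet of
another cell. -/
structure PolytopalMesh (d : ℕ) (Ω : Set (Pt d)) where
  numCells : ℕ
  cell : Fin numCells → ConvexPolytope d
  domain_eq : Ω = interior (⋃ i, (cell i).carrier)
  disjoint_interior :
    Pairwise fun i i' => Disjoint (interior (cell i).carrier) (interior (cell i').carrier)
  conforming : ∀ i, ∀ ν ∈ (cell i).normals,
    (cell i).facet ν ⊆ frontier Ω ∨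
      ∃ i', i' ≠ i ∧ ∃ ν' ∈ (cell i').normals, (cell i').facet ν' = (cell i).facet ν

variable {Ω : Set (Pt d)}

/-- The set `E_h` of all edges/faces of the partition. -/
def PolytopalMesh.edges (M : PolytopalMesh d Ω) : Set (Set (Pt d)) :=
  {e | ∃ i, ∃ ν ∈ (M.cell i).normals, e = (M.cell i).facet ν}

/-- Shape regularity of the partition: the cells and their facets are not degenerate
(`ρv h_T^d ≤ |T|`, `ρe h_e^(d-1) ≤ |e|`), facets are not small compared with the cell
(`κ h_T ≤ h_e`), and outward unit normals of different facets of a cell make an angle of at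
least `θ` (so that interior dihedral angles are at most `π - θ`). The surface measure `ds` is the
Hausdorff measure `μHE[d - 1]`, normalised to agree with the Euclidean surface measure. -/
structure PolytopalMesh.ShapeRegular (M : PolytopalMesh d Ω) (ρv ρe κ θ : ℝ) : Prop where
  cell_volume : ∀ i, ρv * (M.cell i).size ^ d ≤ volume.real (M.cell i).carrier
  facet_area : ∀ i, ∀ ν ∈ (M.cell i).normals,
    ρe * Metric.diam ((M.cell i).facet ν) ^ (d - 1) ≤ μHE[d - 1].real ((M.cell i).facet ν)
  facet_diam : ∀ i, ∀ ν ∈ (M.cell i).normals,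
    κ * (M.cell i).size ≤ Metric.diam ((M.cell i).facet ν)
  facet_angle : ∀ i, ∀ ν ∈ (M.cell i).normals, ∀ ν' ∈ (M.cell i).normals,
    ν ≠ ν' → θ ≤ InnerProductGeometry.angle ν ν'

/-! ### The weak Galerkin space -/

/-- Carrier type of weak functions `v = {v_0, v_b}`: `v.1 i` is `v_0` on the cell `i`, and `v.2 e`
is `v_b` on the edge/face `e` (extended by zero off `e`). -/
abbrev PolytopalMesh.WeakFunction (M : PolytopalMesh d Ω) : Type :=
  (Fin M.numCells → Poly d) × (Set (Pt d) → Pt d → ℝ)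

/-- The weak Galerkin space `V_h`: `v_0|_T ∈ P_k(T)` on each cell and `v_b|_e ∈ P_{k-1}(e)` on each
edge/face, with a single value of `v_b` on each `e`. There is no data attached to sets that are
not edges/faces of the partition. -/
def PolytopalMesh.Vh (M : PolytopalMesh d Ω) (k : ℕ) : Submodule ℝ M.WeakFunction where
  carrier := {v | (∀ i, v.1 i ∈ polySpace d k) ∧
    (∀ e ∈ M.edges, v.2 e ∈ polyOn e (k - 1)) ∧ (∀ e, e ∉ M.edges → v.2 e = 0)}
  add_mem' := by
    rintro v w ⟨hv₁, hv₂, hv₃⟩ ⟨hw₁, hw₂, hw₃⟩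
    exact ⟨fun i => Submodule.add_mem _ (hv₁ i) (hw₁ i),
      fun e he => Submodule.add_mem _ (hv₂ e he) (hw₂ e he),
      fun e he => by simp [hv₃ e he, hw₃ e he]⟩
  zero_mem' := ⟨fun _ => Submodule.zero_mem _, fun _ _ => Submodule.zero_mem _, fun _ _ => rfl⟩
  smul_mem' := by
    rintro c v ⟨hv₁, hv₂, hv₃⟩
    exact ⟨fun i => Submodule.smul_mem _ c (hv₁ i), fun e he => Submodule.smul_mem _ c (hv₂ e he),
      fun e he => by simp [hv₃ e he]⟩

/-- The subspace `V_h^0` of the `v ∈ V_h` with `v_b = 0` on `∂Ω`. -/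
def PolytopalMesh.Vh0 (M : PolytopalMesh d Ω) (k : ℕ) : Set M.WeakFunction :=
  {v | v ∈ M.Vh k ∧ ∀ e ∈ M.edges, e ⊆ frontier Ω → v.2 e = 0}

/-! ### Projection, weak gradient, norms -/

/-- The `L²(e)` projection of `f` onto `P_r(e)`: the unique `w ∈ P_r(e)` with
`⟨w, p⟩_e = ⟨f, p⟩_e` for all `p ∈ P_r(e)`. For a facet `e` of a polytope and a square integrable
`f` on `e`, such a `w` exists and is unique. -/
def edgeProj (r : ℕ) (e : Set (Pt d)) (f : Pt d → ℝ) : Pt d → ℝ :=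
  Classical.epsilon fun w => w ∈ polyOn e r ∧ ∀ p ∈ polyOn e r,
    ∫ x in e, w x * p x ∂μHE[d - 1] = ∫ x in e, f x * p x ∂μHE[d - 1]

/-- `Q_b (v_b - v_0)` on the facet with normal `ν` of the cell `i`, with `Q_b` the projection
onto `P_{k-1}`. -/
def PolytopalMesh.edgeJump (M : PolytopalMesh d Ω) (k : ℕ) (v : M.WeakFunction)
    (i : Fin M.numCells) (ν : Pt d) : Pt d → ℝ :=
  edgeProj (k - 1) ((M.cell i).facet ν)
    (fun x => v.2 ((M.cell i).facet ν) x - polyFun (v.1 i) x)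

/-- `G` is the weak gradient of `v` on the cell `T` of index `i`: `G ∈ [P_j(T)]^d` and
`(G, q)_T = (∇v_0, q)_T + ⟨Q_b (v_b - v_0), q · n⟩_{∂T}` for all `q ∈ [P_j(T)]^d`. -/
def PolytopalMesh.IsWeakGradAt (M : PolytopalMesh d Ω) (k j : ℕ) (v : M.WeakFunction)
    (i : Fin M.numCells) (G : Fin d → Poly d) : Prop :=
  (∀ l, G l ∈ polySpace d j) ∧
    ∀ q : Fin d → Poly d, (∀ l, q l ∈ polySpace d j) →
      ∫ x in (M.cell i).carrier, vecFun G x ⬝ᵥ vecFun q x =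
        (∫ x in (M.cell i).carrier, vecFun (grad (v.1 i)) x ⬝ᵥ vecFun q x) +
          ∑ ν ∈ (M.cell i).normals, ∫ x in (M.cell i).facet ν,
            M.edgeJump k v i ν x * (vecFun q x ⬝ᵥ ν.ofLp) ∂μHE[d - 1]

/-- The weak gradient `∇_w v`, with polynomial degree `j i` on the cell `i`: the unique
piecewise polynomial vector field satisfying the defining relation on every cell. -/
def PolytopalMesh.weakGrad (M : PolytopalMesh d Ω) (k : ℕ) (j : Fin M.numCells → ℕ)
    (v : M.WeakFunction) (i : Fin M.numCells) : Fin d → Poly d :=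
  Classical.epsilon fun G => M.IsWeakGradAt k (j i) v i G

/-- The bilinear form `(a ∇_w v, ∇_w w)_{T_h}`. -/
def PolytopalMesh.energyForm (M : PolytopalMesh d Ω) (k : ℕ) (j : Fin M.numCells → ℕ)
    (a : Pt d → Matrix (Fin d) (Fin d) ℝ) (v w : M.WeakFunction) : ℝ :=
  ∑ i, ∫ x in (M.cell i).carrier,
    (a x *ᵥ vecFun (M.weakGrad k j v i) x) ⬝ᵥ vecFun (M.weakGrad k j w i) x

/-- The triple-bar norm `|||v||| = (a ∇_w v, ∇_w v)_{T_h}^{1/2}`. -/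
def PolytopalMesh.tripleBar (M : PolytopalMesh d Ω) (k : ℕ) (j : Fin M.numCells → ℕ)
    (a : Pt d → Matrix (Fin d) (Fin d) ℝ) (v : M.WeakFunction) : ℝ :=
  Real.sqrt (M.energyForm k j a v v)

/-- The discrete `H^1` norm
`‖v‖_{1,h} = (∑_T (‖∇v_0‖_T² + h_T⁻¹ ‖Q_b (v_0 - v_b)‖_{∂T}²))^{1/2}`. -/
def PolytopalMesh.discreteH1 (M : PolytopalMesh d Ω) (k : ℕ) (v : M.WeakFunction) : ℝ :=
  Real.sqrt (∑ i,
    ((∫ x in (M.cell i).carrier, vecFun (grad (v.1 i)) x ⬝ᵥ vecFun (grad (v.1 i)) x) +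
      (M.cell i).size⁻¹ *
        ∑ ν ∈ (M.cell i).normals,
          ∫ x in (M.cell i).facet ν, (M.edgeJump k v i ν x) ^ 2 ∂μHE[d - 1]))

/-! ### The boundary value problem and the scheme -/

/-- `a` is a symmetric measurable matrix-valued function on `Ω` with
`lam₁ ξᵗξ ≤ ξᵗ a ξ ≤ lam₂ ξᵗξ`. -/
structure IsEllipticTensor (Ω : Set (Pt d)) (a : Pt d → Matrix (Fin d) (Fin d) ℝ)
    (lam₁ lam₂ : ℝ) : Prop where
  measurable : ∀ l m, AEMeasurable (fun x => a x l m) (volume.restrict Ω)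
  symm : ∀ x ∈ Ω, (a x).IsSymm
  lower : ∀ x ∈ Ω, ∀ ξ : Fin d → ℝ, lam₁ * (ξ ⬝ᵥ ξ) ≤ ξ ⬝ᵥ (a x *ᵥ ξ)
  upper : ∀ x ∈ Ω, ∀ ξ : Fin d → ℝ, ξ ⬝ᵥ (a x *ᵥ ξ) ≤ lam₂ * (ξ ⬝ᵥ ξ)

/-- The degrees of the weak gradient satisfy `j_T ≥ n_T + k - 1`, where `n_T` is the number of
edges/faces of `T`. -/
def PolytopalMesh.DegreeAdmissible (M : PolytopalMesh d Ω) (k : ℕ)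
    (j : Fin M.numCells → ℕ) : Prop :=
  ∀ i, (M.cell i).normals.card + k - 1 ≤ j i

/-- `u ∈ V_h` solves the stabilizer-free weak Galerkin scheme: `u_b = Q_b g` on `∂Ω` and
`(a ∇_w u, ∇_w v)_{T_h} = (f, v_0)` for all `v ∈ V_h^0`. -/
structure PolytopalMesh.IsWGSolution (M : PolytopalMesh d Ω) (k : ℕ) (j : Fin M.numCells → ℕ)
    (a : Pt d → Matrix (Fin d) (Fin d) ℝ) (f g : Pt d → ℝ) (u : M.WeakFunction) : Prop where
  mem : u ∈ M.Vh k
  boundary : ∀ e ∈ M.edges, e ⊆ frontier Ω → u.2 e = edgeProj (k - 1) e g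
  equation : ∀ v ∈ M.Vh0 k,
    M.energyForm k j a u v = ∑ i, ∫ x in (M.cell i).carrier, f x * polyFun (v.1 i) x

end WG

end

/-! The norm equivalence is local. On a cell `T`, write `g = ∇v₀`, `p = Q_b(v_b - v₀)` and `G = ∇_w
v`, so that `(G, q) = (g, q) + ⟨p, q·n⟩` for all admissible `q`. Testing with `q = G` and with `q =
g`, a polynomial trace inequality and Young's inequality bound each of `‖G‖²`, `‖g‖²` by the other
plus a multiple of `h_T⁻¹‖p‖²`. What remains is `h_T⁻¹‖p‖² ≲ ‖G‖²`, and this is where the high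
degree of the weak gradient replaces a stabilizer.

For a facet `e` with normal `ν`, `exists_test_field` uses `q = b (W + λ r) ν`. Here `b` is the
product of the normalised distances to the other facet hyperplanes, `W` extends `p` off `e`, `λ` is
the normalised distance to the hyperplane of `e`, and `r` has degree at most `k - 1` and makes `q`
orthogonal to `[P_{k-1}(T)]^d`, which contains `g`. Since `b` vanishes on the other facets and `λ`
on `e`, testing leaves `(G, q) = ⟨p, b p⟩_e`, which controls `‖p‖_e²`. The degree is `(n_T - 1) +
k`, exactly the minimal `j_T`. `exists_local_bounds` combines these estimates.

The constants see the geometry only through `IsFat`: each cell and each facet has a point at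
distance at least `c h_T` from all the (other) facet hyperplanes. Polynomial estimates then reduce,
by scaling, to the unit ball (`exists_sq_le_integral_ball`). Shape regularity gives fatness by a
volume argument (`exists_deep_point`, `ConvexPolytope.exists_isFat`): thin slabs along a bounded
number of hyperplanes cannot fill a cell or a facet. A single finite mesh always has some fatness
constant, so the equivalence without uniformity follows from the same estimates.

For solvability, the lower bound reduces the question to definiteness of the discrete norm on
`V_h^0`. If it vanishes, `v₀` is constant on every cell and `v_b` equals that constant on each of
its facets. The cells with nonzero constant then have no boundary facet and are closed under passing
to neighbours. A generic ray leaving their union shows that there are none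
(`eq_empty_of_closed_under_neighbors`). Finite-dimensional linear algebra does the rest. -/

noncomputable section

namespace WG

variable {d : ℕ}

/-! ### Finite-dimensional linear algebra -/

section LinearAlgebra

variable {V : Type*} [AddCommGroup V] [Module ℝ V] [FiniteDimensional ℝ V]

/-- A definite bilinear form on a finite-dimensional space represents every linear functional. -/
lemma exists_repr_of_definite (b : V →ₗ[ℝ] V →ₗ[ℝ] ℝ) (hb : ∀ v, b v v = 0 → v = 0)
    (f : V →ₗ[ℝ] ℝ) : ∃ v, ∀ w, b v w = f w := by
  have hinj : Function.Injective b := by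
    rw [← LinearMap.ker_eq_bot, LinearMap.ker_eq_bot']
    intro v hv
    exact hb v (by rw [hv]; rfl)
  have hsurj : Function.Surjective b :=
    (LinearMap.injective_iff_surjective_of_finrank_eq_finrank
      (Subspace.dual_finrank_eq (K := ℝ) (V := V)).symm).1 hinj
  obtain ⟨v, hv⟩ := hsurj f
  exact ⟨v, fun w => by rw [hv]⟩

/-- A pointwise bounded family of functionals on a finite-dimensional space is uniformly bounded
with respect to a positive definite symmetric form. -/
lemma exists_bound_of_definite (b : V →ₗ[ℝ] V →ₗ[ℝ] ℝ) (hsymm : ∀ v w, b v w = b w v)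
    (hnonneg : ∀ v, 0 ≤ b v v) (hb : ∀ v, b v v = 0 → v = 0)
    (S : Set (V →ₗ[ℝ] ℝ)) (hS : ∀ v, ∃ c, ∀ f ∈ S, |f v| ≤ c) :
    ∃ C, 0 < C ∧ ∀ f ∈ S, ∀ v, f v ^ 2 ≤ C * b v v := by
  -- With `b` as inner product, a functional is bounded by Cauchy–Schwarz in `b`-orthonormal
  -- coordinates, so only its values on finitely many basis vectors matter.
  let core : InnerProductSpace.Core ℝ V :=
    { inner := fun v w => b v w
      conj_inner_symm := fun v w => by simpa using hsymm w v
      re_inner_nonneg := fun v => by simpa using hnonneg v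
      add_left := fun u v w => by simp
      smul_left := fun u v r => by simp
      definite := fun v hv => hb v hv }
  let _ : NormedAddCommGroup V := core.toNormedAddCommGroup
  let _ : InnerProductSpace ℝ V := InnerProductSpace.ofCore core.toCore
  let e := stdOrthonormalBasis ℝ V
  choose c hc using hS
  refine ⟨1 + ∑ i, c (e i) ^ 2, by positivity, fun f hf v => ?_⟩
  have hv : f v = ∑ i, inner ℝ (e i) v * f (e i) := by
    conv_lhs => rw [← e.sum_repr' v]
    simp
  have hn : b v v = ∑ i, (inner ℝ (e i) v) ^ 2 := by
    have h1 := e.sum_sq_norm_inner_right v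
    have h2 : b v v = ‖v‖ ^ 2 := by rw [← real_inner_self_eq_norm_sq]; rfl
    rw [h2, ← h1]
    simp
  have h1 := Finset.sum_mul_sq_le_sq_mul_sq Finset.univ (fun i => inner ℝ (e i) v)
    (fun i => f (e i))
  rw [← hv, ← hn] at h1
  have h2 : ∑ i, f (e i) ^ 2 ≤ ∑ i, c (e i) ^ 2 :=
    Finset.sum_le_sum fun i _ => sq_le_sq.2 ((hc (e i) f hf).trans (le_abs_self _))
  nlinarith [hnonneg v]

end LinearAlgebra

/-! ### Polynomial functions -/

@[simp] lemma polyFun_zero (x : Pt d) : polyFun 0 x = 0 := by simp [polyFun]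
@[simp] lemma polyFun_add (p q : Poly d) (x : Pt d) :
    polyFun (p + q) x = polyFun p x + polyFun q x := by simp [polyFun]
@[simp] lemma polyFun_sub (p q : Poly d) (x : Pt d) :
    polyFun (p - q) x = polyFun p x - polyFun q x := by simp [polyFun]
@[simp] lemma polyFun_mul (p q : Poly d) (x : Pt d) :
    polyFun (p * q) x = polyFun p x * polyFun q x := by simp [polyFun]
@[simp] lemma polyFun_smul (c : ℝ) (p : Poly d) (x : Pt d) :
    polyFun (c • p) x = c * polyFun p x := by simp [polyFun, MvPolynomial.smul_eval]
@[simp] lemma polyFun_C (c : ℝ) (x : Pt d) :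
    polyFun (MvPolynomial.C c : Poly d) x = c := by simp [polyFun]
@[simp] lemma polyFun_X (l : Fin d) (x : Pt d) :
    polyFun (MvPolynomial.X l : Poly d) x = x l := by simp [polyFun]
@[simp] lemma polyFun_sum {ι : Type*} (s : Finset ι) (p : ι → Poly d) (x : Pt d) :
    polyFun (∑ i ∈ s, p i) x = ∑ i ∈ s, polyFun (p i) x := by simp [polyFun]
@[simp] lemma polyFun_prod {ι : Type*} (s : Finset ι) (p : ι → Poly d) (x : Pt d) :
    polyFun (∏ i ∈ s, p i) x = ∏ i ∈ s, polyFun (p i) x := by simp [polyFun]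

lemma mem_polySpace {r : ℕ} {p : Poly d} : p ∈ polySpace d r ↔ p.totalDegree ≤ r :=
  MvPolynomial.mem_restrictTotalDegree _ _ _

lemma polySpace_mono {r s : ℕ} (h : r ≤ s) : polySpace d r ≤ polySpace d s := fun p hp => by
  rw [mem_polySpace] at *; omega

lemma mul_mem_polySpace {r s : ℕ} {p q : Poly d} (hp : p ∈ polySpace d r)
    (hq : q ∈ polySpace d s) : p * q ∈ polySpace d (r + s) := by
  rw [mem_polySpace] at *
  exact (MvPolynomial.totalDegree_mul _ _).trans (add_le_add hp hq)

lemma C_mem_polySpace (c : ℝ) (r : ℕ) : (MvPolynomial.C c : Poly d) ∈ polySpace d r := by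
  rw [mem_polySpace]; simp

lemma X_mem_polySpace (l : Fin d) : (MvPolynomial.X l : Poly d) ∈ polySpace d 1 := by
  rw [mem_polySpace]; simp

@[fun_prop]
lemma continuous_polyFun (p : Poly d) : Continuous (polyFun p) := by
  have h : Continuous fun x : Fin d → ℝ => MvPolynomial.eval x p := MvPolynomial.continuous_eval p
  exact h.comp (PiLp.continuous_ofLp 2 _)

/-- Composition with an affine map does not increase the degree of a polynomial. -/
lemma exists_polyFun_comp {m n r : ℕ} {p : Poly m} (hp : p ∈ polySpace m r)
    (A : Pt n →ᵃ[ℝ] Pt m) :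
    ∃ q ∈ polySpace n r, ∀ x, polyFun q x = polyFun p (A x) := by
  let L : Fin m → Poly n := fun i => MvPolynomial.C (A 0 i) +
    ∑ l, MvPolynomial.C (A.linear (EuclideanSpace.single l 1) i) * MvPolynomial.X l
  have hL : ∀ i, (L i).totalDegree ≤ 1 := fun i => by
    rw [← mem_polySpace]
    refine Submodule.add_mem _ (C_mem_polySpace _ _) (Submodule.sum_mem _ fun l _ => ?_)
    simpa using mul_mem_polySpace (C_mem_polySpace _ 0) (X_mem_polySpace l)
  refine ⟨MvPolynomial.aeval L p, ?_, fun x => ?_⟩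
  · rw [mem_polySpace] at *
    rw [MvPolynomial.aeval_def, MvPolynomial.eval₂_eq]
    refine MvPolynomial.totalDegree_finsetSum_le fun s hs => ?_
    refine (MvPolynomial.totalDegree_mul _ _).trans ?_
    rw [MvPolynomial.algebraMap_eq, MvPolynomial.totalDegree_C, zero_add]
    refine (MvPolynomial.totalDegree_finsetProd _ _).trans ?_
    refine le_trans (Finset.sum_le_sum fun i _ => (MvPolynomial.totalDegree_pow _ _).trans
      (Nat.mul_le_mul_left _ (hL i))) ?_
    simpa [Finsupp.sum] using (MvPolynomial.le_totalDegree hs).trans hp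
  · have hA : ∀ i, polyFun (L i) x = A x i := fun i => by
      have h1 : A x = A.linear x + A 0 := by
        have := A.map_vadd 0 x
        simpa using this
      have h2 : x = ∑ l, x l • EuclideanSpace.single l (1 : ℝ) := by
        ext i; simp [Pi.single_apply]
      conv_rhs => rw [h1, h2]
      simp [L, add_comm, mul_comm]
    unfold polyFun at *
    rw [MvPolynomial.aeval_def, MvPolynomial.eval₂_eq,
      MvPolynomial.eval_eq (fun l => (A x).ofLp l) p]
    simp [hA]

/-- A polynomial that vanishes on a nonempty open set is zero. -/
lemma eq_zero_of_polyFun_eq_zero {p : Poly d} {U : Set (Pt d)} (hU : IsOpen U)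
    (hne : U.Nonempty) (h : ∀ x ∈ U, polyFun p x = 0) : p = 0 := by
  obtain ⟨x, hx⟩ := hne
  have hU' : IsOpen ((WithLp.toLp 2 : (Fin d → ℝ) → Pt d) ⁻¹' U) :=
    hU.preimage (PiLp.continuous_toLp 2 _)
  obtain ⟨ε, hε, hball⟩ := Metric.isOpen_iff.1 hU' x.ofLp (by simpa using hx)
  -- In the sup metric a ball is a product of intervals, and a polynomial that vanishes on a product
  -- of infinite sets is zero.
  rw [ball_pi _ hε] at hball
  refine MvPolynomial.funext_set (fun i => Metric.ball (x.ofLp i) ε) (fun i => ?_) fun y hy => ?_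
  · rw [Real.ball_eq_Ioo]
    exact Set.Ioo_infinite (by linarith)
  · simpa [polyFun] using h _ (hball hy)

/-- A polynomial whose square has vanishing integral over a bounded set with nonempty interior is
zero. -/
lemma eq_zero_of_integral_sq_eq_zero {p : Poly d} {s : Set (Pt d)}
    (hint : IntegrableOn (fun x => polyFun p x ^ 2) s) (hne : (interior s).Nonempty)
    (h : ∫ x in s, polyFun p x ^ 2 = 0) : p = 0 := by
  have h1 : (fun x => polyFun p x ^ 2) =ᵐ[volume.restrict s] 0 :=
    (integral_eq_zero_iff_of_nonneg (fun x => sq_nonneg _) hint).1 h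
  have h2 : (fun x => polyFun p x ^ 2) =ᵐ[volume.restrict (interior s)] 0 :=
    ae_restrict_of_ae_restrict_of_subset interior_subset h1
  have h3 := Measure.eqOn_open_of_ae_eq h2 isOpen_interior
    (by fun_prop) continuousOn_const
  exact eq_zero_of_polyFun_eq_zero isOpen_interior hne fun x hx => by simpa using h3 hx

/-! ### Measures that integrate continuous functions -/

/-- Every continuous function is integrable for `μ`. -/
def IntegratesContinuous (μ : Measure (Pt d)) : Prop :=
  ∀ f : Pt d → ℝ, Continuous f → Integrable f μ

lemma integratesContinuous_restrict {s : Set (Pt d)} (hs : Bornology.IsBounded s) :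
    IntegratesContinuous ((volume : Measure (Pt d)).restrict s) := fun _ hf =>
  IntegrableOn.mono_set (hf.continuousOn.integrableOn_compact hs.isCompact_closure)
    subset_closure

/-- The weighted bilinear form `∫ w p q dμ` on polynomials. -/
def polyForm (μ : Measure (Pt d)) (hμ : IntegratesContinuous μ) (w : Pt d → ℝ)
    (hw : Continuous w) : Poly d →ₗ[ℝ] Poly d →ₗ[ℝ] ℝ :=
  LinearMap.mk₂ ℝ (fun p q => ∫ x, w x * (polyFun p x * polyFun q x) ∂μ)
    (fun p₁ p₂ q => by
      rw [← integral_add (hμ _ (by fun_prop)) (hμ _ (by fun_prop))]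
      simp only [polyFun_add]; congr 1; ext x; ring)
    (fun c p q => by
      rw [smul_eq_mul, ← integral_const_mul]
      simp only [polyFun_smul]; congr 1; ext x; ring)
    (fun p q₁ q₂ => by
      rw [← integral_add (hμ _ (by fun_prop)) (hμ _ (by fun_prop))]
      simp only [polyFun_add]; congr 1; ext x; ring)
    (fun c p q => by
      rw [smul_eq_mul, ← integral_const_mul]
      simp only [polyFun_smul]; congr 1; ext x; ring)

lemma polyForm_apply (μ : Measure (Pt d)) (hμ : IntegratesContinuous μ) (w : Pt d → ℝ)
    (hw : Continuous w) (p q : Poly d) :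
    polyForm μ hμ w hw p q = ∫ x, w x * (polyFun p x * polyFun q x) ∂μ := rfl

/-- On polynomials of bounded degree, the supremum over a ball is bounded by the `L²` norm over a
smaller ball, with a constant that depends only on the ratio of the radii. -/
lemma exists_sq_le_integral_ball (n m : ℕ) (K : ℝ) :
    ∃ C, 0 < C ∧ ∀ p ∈ polySpace n m, ∀ (x : Pt n) (r : ℝ), 0 < r → ∀ y, dist y x ≤ K * r →
      polyFun p y ^ 2 * r ^ n ≤ C * ∫ z in Metric.ball x r, polyFun p z ^ 2 := by
  have hμ := integratesContinuous_restrict (Metric.isBounded_ball (x := (0 : Pt n)) (r := 1))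
  let b := (polyForm _ hμ (fun _ => 1) continuous_const).domRestrict₁₂ (polySpace n m)
    (polySpace n m)
  have hb : ∀ p q, b p q = ∫ x in Metric.ball (0 : Pt n) 1, polyFun p.1 x * polyFun q.1 x :=
    fun p q => by simp [b, LinearMap.domRestrict₁₂_apply, polyForm_apply]
  let ev : Pt n → (polySpace n m →ₗ[ℝ] ℝ) := fun y =>
    { toFun := fun p => polyFun p.1 y, map_add' := by simp, map_smul' := by simp }
  obtain ⟨C, hC, h⟩ := exists_bound_of_definite b
    (fun p q => by simp only [hb, mul_comm])
    (fun p => by rw [hb]; exact integral_nonneg fun x => mul_self_nonneg _)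
    (fun p hp => by
      rw [hb] at hp
      simp only [← sq] at hp
      exact Subtype.ext (eq_zero_of_integral_sq_eq_zero (hμ _ (by fun_prop))
        ⟨0, by rw [Metric.isOpen_ball.interior_eq]; simp⟩ hp))
    -- The family consists of the evaluations at points of a compact ball; continuity of each
    -- polynomial gives pointwise boundedness.
    (ev '' Metric.closedBall 0 K) (fun p => by
      obtain ⟨c, hc⟩ := (isCompact_closedBall (0 : Pt n) K).exists_bound_of_continuousOn
        (continuous_polyFun p.1).continuousOn
      refine ⟨c, ?_⟩
      rintro _ ⟨y, hy, rfl⟩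
      exact hc y hy)
  refine ⟨C, hC, fun p hp x r hr y hy => ?_⟩
  -- Pulling back by `A` replaces the ball of radius `r` about `x` by the unit ball; the change of
  -- variables supplies the factor `r ^ n`.
  let A : Pt n →ᵃ[ℝ] Pt n := AffineMap.const ℝ _ x + r • AffineMap.id ℝ _
  have hA : ∀ z, A z = x + r • z := fun z => rfl
  obtain ⟨q, hq, hqA⟩ := exists_polyFun_comp hp A
  have h1 := h (ev (r⁻¹ • (y - x))) ⟨_, by
    rw [mem_closedBall_zero_iff, norm_smul, norm_inv, Real.norm_of_nonneg hr.le, ← dist_eq_norm,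
      inv_mul_le_iff₀ hr, mul_comm]
    exact hy, rfl⟩ ⟨q, hq⟩
  have h2 : ev (r⁻¹ • (y - x)) ⟨q, hq⟩ = polyFun p y := by
    change polyFun q _ = _
    rw [hqA, hA, smul_inv_smul₀ hr.ne']
    simp
  have h3 : ∫ z in Metric.ball (0 : Pt n) r, polyFun p (x + z) ^ 2 =
      ∫ z in Metric.ball x r, polyFun p z ^ 2 := by
    rw [← (measurePreserving_add_left volume x).setIntegral_preimage_emb
      (measurableEmbedding_addLeft x) (fun z => polyFun p z ^ 2) (Metric.ball x r)]
    simp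
  rw [h2, hb] at h1
  have h4 := Measure.setIntegral_comp_smul_of_pos (volume : Measure (Pt n))
    (fun z => polyFun p (x + z) ^ 2) (Metric.ball 0 1) hr
  rw [smul_unitBall_of_pos hr, h3, finrank_euclideanSpace_fin] at h4
  simp only [hqA, hA, ← sq] at h1
  rw [h4, smul_eq_mul] at h1
  calc polyFun p y ^ 2 * r ^ n ≤ C * ((r ^ n)⁻¹ * ∫ z in Metric.ball x r, polyFun p z ^ 2) * r ^ n :=
        by gcongr
    _ = _ := by field_simp

/-! ### Basic properties of polytopes -/

namespace ConvexPolytope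

variable (T : ConvexPolytope d) {ν : Pt d}

/-- The distance of `x` to the hyperplane with normal `ν`, with the sign that is nonnegative on
`T`. -/
def slack (ν x : Pt d) : ℝ := T.offset ν - inner ℝ ν x

@[fun_prop]
lemma continuous_slack (ν : Pt d) : Continuous (T.slack ν) := by
  unfold slack; fun_prop

lemma mem_carrier {x : Pt d} : x ∈ T.carrier ↔ ∀ ν ∈ T.normals, 0 ≤ T.slack ν x := by
  simp [carrier, halfSpaceInter, slack]

lemma mem_facet {x : Pt d} : x ∈ T.facet ν ↔ x ∈ T.carrier ∧ T.slack ν x = 0 := by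
  simp only [facet, slack, Set.mem_ofPred_eq, sub_eq_zero, eq_comm (a := T.offset ν)]

lemma facet_subset (ν : Pt d) : T.facet ν ⊆ T.carrier := fun _ hx => hx.1

lemma abs_slack_sub_le (hν : ν ∈ T.normals) (x y : Pt d) :
    |T.slack ν x - T.slack ν y| ≤ dist x y := by
  have h : T.slack ν x - T.slack ν y = inner ℝ ν (y - x) := by
    simp [slack, inner_sub_right]
  rw [h, dist_comm, dist_eq_norm]
  simpa [T.norm_eq_one ν hν] using abs_real_inner_le_norm ν (y - x)

lemma convex_carrier : Convex ℝ T.carrier := by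
  have : T.carrier = ⋂ ν ∈ T.normals, {x | inner ℝ ν x ≤ T.offset ν} := by
    ext x; simp [carrier, halfSpaceInter]
  rw [this]
  refine convex_iInter₂ fun ν _ => convex_halfSpace_le ⟨fun x y => ?_, fun c x => ?_⟩ _
  · exact inner_add_right _ _ _
  · exact real_inner_smul_right _ _ _

lemma isClosed_carrier : IsClosed T.carrier := by
  have : T.carrier = ⋂ ν ∈ T.normals, {x | 0 ≤ T.slack ν x} := by
    ext x; simp [mem_carrier]
  rw [this]
  exact isClosed_biInter fun ν _ => isClosed_le continuous_const (by fun_prop)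

lemma isBounded_carrier : Bornology.IsBounded T.carrier := T.isBounded

lemma isCompact_carrier : IsCompact T.carrier :=
  Metric.isCompact_of_isClosed_isBounded T.isClosed_carrier T.isBounded_carrier

lemma measurableSet_carrier : MeasurableSet T.carrier := T.isClosed_carrier.measurableSet

lemma isClosed_facet (ν : Pt d) : IsClosed (T.facet ν) := by
  have : T.facet ν = T.carrier ∩ {x | T.slack ν x = 0} := by ext x; exact T.mem_facet
  rw [this]
  exact T.isClosed_carrier.inter (isClosed_eq (by fun_prop) continuous_const)

lemma measurableSet_facet (ν : Pt d) : MeasurableSet (T.facet ν) :=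
  (T.isClosed_facet ν).measurableSet

lemma convex_facet (ν : Pt d) : Convex ℝ (T.facet ν) :=
  T.convex_carrier.inter (convex_hyperplane
    ⟨fun _ _ => inner_add_right _ _ _, fun _ _ => real_inner_smul_right _ _ _⟩ _)

lemma isBounded_facet (ν : Pt d) : Bornology.IsBounded (T.facet ν) :=
  T.isBounded_carrier.subset (T.facet_subset ν)

lemma dist_le_size {x y : Pt d} (hx : x ∈ T.carrier) (hy : y ∈ T.carrier) :
    dist x y ≤ T.size :=
  Metric.dist_le_diam_of_mem T.isBounded_carrier hx hy

/-- An empty facet would have a direction space of dimension `0`, so `facet_dim` would force `d =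
1`. -/
lemma facet_nonempty (hd : 2 ≤ d) (hν : ν ∈ T.normals) : (T.facet ν).Nonempty := by
  by_contra h
  have h1 := T.facet_dim ν hν
  have h2 : {x ∈ halfSpaceInter T.normals T.offset | inner ℝ ν x = T.offset ν} = ∅ :=
    Set.not_nonempty_iff_eq_empty.1 h
  rw [h2, vectorSpan_empty, finrank_bot] at h1
  omega

lemma slack_pos_of_mem_interior (hν : ν ∈ T.normals) {x : Pt d} (hx : x ∈ interior T.carrier) :
    0 < T.slack ν x := by
  obtain ⟨ε, hε, hb⟩ := Metric.isOpen_iff.1 isOpen_interior x hx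
  have h1 : x + (ε / 2) • ν ∈ T.carrier := interior_subset (hb (by
    simp [norm_smul, T.norm_eq_one ν hν, abs_of_pos hε]; linarith))
  have h2 := T.mem_carrier.1 h1 ν hν
  have h3 : inner ℝ ν ν = (1 : ℝ) := by
    rw [real_inner_self_eq_norm_sq, T.norm_eq_one ν hν]; norm_num
  simp only [slack, inner_add_right, real_inner_smul_right, h3] at h2 ⊢
  linarith

lemma size_pos (hd : 2 ≤ d) : 0 < T.size := by
  obtain ⟨x, hx⟩ := T.interior_nonempty
  have : Nontrivial (Pt d) := by
    have : Nonempty (Fin d) := ⟨⟨0, by omega⟩⟩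
    infer_instance
  obtain ⟨a, ha, b, hb, hab⟩ :=
    (infinite_of_mem_nhds x (isOpen_interior.mem_nhds hx)).nontrivial
  exact (dist_pos.2 hab).trans_le
    (T.dist_le_size (interior_subset ha) (interior_subset hb))

end ConvexPolytope

/-! ### Isometric charts of hyperplanes -/

/-- An isometric parametrisation of the hyperplane `⟪ν, x⟫ = c`, with a nonexpansive affine left
inverse. -/
structure HyperplaneChart (ν : Pt d) (c : ℝ) where
  map : Pt (d - 1) →ᵃⁱ[ℝ] Pt d
  proj : Pt d →ᵃ[ℝ] Pt (d - 1)
  range_map : Set.range map = {x | inner ℝ ν x = c}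
  proj_map : ∀ y, proj (map y) = y
  dist_proj_le : ∀ x x', dist (proj x) (proj x') ≤ dist x x'
  exists_gradient : ∀ μ : Pt d, ∃ u : Pt (d - 1),
    (∀ y, inner ℝ μ (map y) = inner ℝ μ (map 0) + inner ℝ u y) ∧
      ‖u‖ ^ 2 = ‖μ‖ ^ 2 - inner ℝ ν μ ^ 2

/-- An orthonormal basis of the orthogonal complement of `ν` gives a linear isometry `L`; the chart
is `L` shifted by `c • ν`, and the left inverse comes from the adjoint of `L`. The adjoint also
sends `μ` to the gradient of `inner ℝ μ` along the hyperplane. For a unit vector `μ`, the length of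
this gradient is the sine of the angle to `ν`, which is how dihedral angles enter later. -/
lemma exists_hyperplaneChart (hd : 1 ≤ d) {ν : Pt d} (hν : ‖ν‖ = 1) (c : ℝ) :
    Nonempty (HyperplaneChart ν c) := by
  have hfact : Fact (Module.finrank ℝ (Pt d) = d - 1 + 1) := ⟨by simp; omega⟩
  have hν0 : ν ≠ 0 := by rintro rfl; simp at hν
  have hνν : inner ℝ ν ν = (1 : ℝ) := by rw [real_inner_self_eq_norm_sq, hν]; norm_num
  let b := OrthonormalBasis.fromOrthogonalSpanSingleton (𝕜 := ℝ) (d - 1) hν0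
  let L : Pt (d - 1) →ₗᵢ[ℝ] Pt d := (ℝ ∙ ν)ᗮ.subtypeₗᵢ.comp b.repr.symm.toLinearIsometry
  have hL : ∀ y, inner ℝ ν (L y) = (0 : ℝ) := fun y =>
    Submodule.mem_orthogonal_singleton_iff_inner_right.1 (b.repr.symm y).2
  have hLs : ∀ x, inner ℝ ν x = (0 : ℝ) → ∃ y, L y = x := fun x hx =>
    ⟨b.repr ⟨x, Submodule.mem_orthogonal_singleton_iff_inner_right.2 hx⟩, by simp [L]⟩
  let P : Pt d →L[ℝ] Pt (d - 1) := ContinuousLinearMap.adjoint L.toContinuousLinearMap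
  have hP : ∀ x y, inner ℝ (P x) y = (inner ℝ x (L y) : ℝ) := fun x y =>
    ContinuousLinearMap.adjoint_inner_left _ _ _
  have hPL : ∀ y, P (L y) = y := fun y => ext_inner_right ℝ fun z => by
    rw [hP, L.inner_map_map]
  have hPn : ∀ x, ‖P x‖ ≤ ‖x‖ := fun x => by
    have h1 : ‖P x‖ ^ 2 ≤ ‖x‖ * ‖P x‖ := by
      rw [← real_inner_self_eq_norm_sq, hP]
      exact (real_inner_le_norm _ _).trans_eq (by rw [L.norm_map])
    nlinarith [norm_nonneg (P x), norm_nonneg x]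
  refine ⟨⟨⟨L.toLinearMap.toAffineMap + AffineMap.const ℝ _ (c • ν), fun y => ?_⟩,
    (P.toLinearMap).toAffineMap - AffineMap.const ℝ _ (P (c • ν)), ?_, fun y => ?_,
    fun x x' => ?_, fun μ => ⟨P μ, fun y => ?_, ?_⟩⟩⟩
  · simp
  · ext x
    constructor
    · rintro ⟨y, rfl⟩
      have : inner ℝ ν (L y + c • ν) = c := by
        rw [inner_add_right, hL, real_inner_smul_right, hνν]; ring
      exact this
    · intro hx
      obtain ⟨y, hy⟩ := hLs (x - c • ν) (by
        rw [inner_sub_right, real_inner_smul_right, hνν, hx.out]; ring)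
      refine ⟨y, ?_⟩
      change L y + c • ν = x
      rw [hy]; abel
  · change P (L y + c • ν) - P (c • ν) = y
    rw [map_add, hPL]; abel
  · change dist (P x - P (c • ν)) (P x' - P (c • ν)) ≤ _
    rw [dist_eq_norm, dist_eq_norm, sub_sub_sub_cancel_right, ← map_sub]
    exact hPn _
  · change inner ℝ μ (L y + c • ν) = inner ℝ μ (L 0 + c • ν) + inner ℝ (P μ) y
    rw [hP, map_zero, inner_add_right, inner_add_right, inner_zero_right]; ring
  · obtain ⟨y, hy⟩ := hLs (μ - inner ℝ ν μ • ν) (by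
      rw [inner_sub_right, real_inner_smul_right, hνν]; ring)
    have h1 : P μ = y := ext_inner_right ℝ fun z => by
      have h2 : μ = L y + inner ℝ ν μ • ν := by rw [hy]; abel
      rw [hP, h2, inner_add_left, L.inner_map_map, real_inner_smul_left, hL]; ring
    rw [h1, ← L.norm_map, hy, ← real_inner_self_eq_norm_sq, ← real_inner_self_eq_norm_sq,
      inner_sub_left, inner_sub_right, inner_sub_right, real_inner_smul_left,
      real_inner_smul_right, real_inner_smul_right, real_inner_smul_left, hνν,
      real_inner_comm μ ν]
    ring

/-! ### Facets and surface measure in a chart -/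

namespace ConvexPolytope

variable (T : ConvexPolytope d) {ν : Pt d}

lemma facet_subset_range (φ : HyperplaneChart ν (T.offset ν)) :
    T.facet ν ⊆ Set.range φ.map := by
  rw [φ.range_map]; exact fun x hx => hx.2

lemma slack_map (φ : HyperplaneChart ν (T.offset ν)) (y : Pt (d - 1)) :
    T.slack ν (φ.map y) = 0 := by
  have : φ.map y ∈ {x | inner ℝ ν x = T.offset ν} := φ.range_map ▸ Set.mem_range_self y
  simp [slack, this.out]

lemma map_proj (φ : HyperplaneChart ν (T.offset ν)) {x : Pt d} (hx : x ∈ T.facet ν) :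
    φ.map (φ.proj x) = x := by
  obtain ⟨y, rfl⟩ := T.facet_subset_range φ hx
  rw [φ.proj_map]

lemma measurableEmbedding_map {c : ℝ} (φ : HyperplaneChart ν c) : MeasurableEmbedding φ.map :=
  φ.map.isometry.isClosedEmbedding.measurableEmbedding

/-- The surface measure on a facet is the image of Lebesgue measure under a chart. -/
lemma restrict_facet_eq_map (φ : HyperplaneChart ν (T.offset ν)) :
    (μHE[d - 1] : Measure (Pt d)).restrict (T.facet ν) =
      (volume.restrict (φ.map ⁻¹' T.facet ν)).map φ.map := by
  have h := φ.map.isometry.map_euclideanHausdorffMeasure (d := d - 1)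
  rw [EuclideanSpace.euclideanHausdorffMeasure_eq_volume] at h
  rw [← Measure.restrict_map φ.map.continuous.measurable (T.measurableSet_facet ν), h,
    Measure.restrict_restrict (T.measurableSet_facet ν),
    Set.inter_eq_left.2 (T.facet_subset_range φ)]

lemma setIntegral_facet (φ : HyperplaneChart ν (T.offset ν)) (f : Pt d → ℝ) :
    ∫ x in T.facet ν, f x ∂μHE[d - 1] = ∫ y in φ.map ⁻¹' T.facet ν, f (φ.map y) := by
  rw [T.restrict_facet_eq_map φ, (measurableEmbedding_map φ).integral_map]

lemma measureReal_facet (φ : HyperplaneChart ν (T.offset ν)) :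
    μHE[d - 1].real (T.facet ν) = volume.real (φ.map ⁻¹' T.facet ν) := by
  have h := T.setIntegral_facet φ (fun _ => 1)
  simpa using h

lemma isBounded_preimage_facet (φ : HyperplaneChart ν (T.offset ν)) :
    Bornology.IsBounded (φ.map ⁻¹' T.facet ν) :=
  φ.map.isometry.antilipschitz.isBounded_preimage (T.isBounded_facet ν)

lemma integratesContinuous_facet (hd : 1 ≤ d) (hν : ν ∈ T.normals) :
    IntegratesContinuous ((μHE[d - 1] : Measure (Pt d)).restrict (T.facet ν)) := fun f hf => by
  obtain ⟨φ⟩ := exists_hyperplaneChart hd (T.norm_eq_one ν hν) (T.offset ν)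
  rw [T.restrict_facet_eq_map φ, (measurableEmbedding_map φ).integrable_map_iff]
  exact integratesContinuous_restrict (T.isBounded_preimage_facet φ) _
    (hf.comp φ.map.continuous)

lemma integratesContinuous_carrier :
    IntegratesContinuous ((volume : Measure (Pt d)).restrict T.carrier) :=
  integratesContinuous_restrict T.isBounded_carrier

/-- In a chart, a facet has nonempty interior. -/
lemma interior_preimage_facet_nonempty (hd : 2 ≤ d) (hν : ν ∈ T.normals)
    (φ : HyperplaneChart ν (T.offset ν)) : (interior (φ.map ⁻¹' T.facet ν)).Nonempty := by
  have hconv : Convex ℝ (φ.map ⁻¹' T.facet ν) :=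
    (T.convex_facet ν).affine_preimage φ.map.toAffineMap
  have himg : φ.map '' (φ.map ⁻¹' T.facet ν) = T.facet ν :=
    Set.image_preimage_eq_of_subset (T.facet_subset_range φ)
  have hne : (φ.map ⁻¹' T.facet ν).Nonempty := by
    have := T.facet_nonempty hd hν
    rw [← himg] at this
    exact this.of_image
  -- A convex set has interior points exactly when it affinely spans. The dimension `d - 1` comes
  -- from `facet_dim`, transported through the injective linear part of the chart.
  rw [hconv.interior_nonempty_iff_affineSpan_eq_top,
    AffineSubspace.affineSpan_eq_top_iff_vectorSpan_eq_top_of_nonempty ℝ _ _ hne]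
  apply Submodule.eq_top_of_finrank_eq
  have h1 : vectorSpan ℝ (T.facet ν) =
      (vectorSpan ℝ (φ.map ⁻¹' T.facet ν)).map φ.map.toAffineMap.linear := by
    rw [AffineMap.map_vectorSpan]
    exact congrArg _ himg.symm
  have h2 : Module.finrank ℝ (vectorSpan ℝ (T.facet ν)) + 1 = d := T.facet_dim ν hν
  have hinj : Function.Injective φ.map.toAffineMap.linear := φ.map.linearIsometry.injective
  rw [h1, ← (Submodule.equivMapOfInjective _ hinj _).finrank_eq] at h2
  rw [finrank_euclideanSpace_fin]; omega

end ConvexPolytope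

/-! ### Vector-valued polynomials -/

@[fun_prop]
lemma continuous_vecFun (G : Fin d → Poly d) : Continuous (vecFun G) :=
  continuous_pi fun l => continuous_polyFun (G l)

@[simp] lemma vecFun_add (G H : Fin d → Poly d) (x : Pt d) :
    vecFun (G + H) x = vecFun G x + vecFun H x := by ext l; simp [vecFun]
@[simp] lemma vecFun_sub (G H : Fin d → Poly d) (x : Pt d) :
    vecFun (G - H) x = vecFun G x - vecFun H x := by ext l; simp [vecFun]
@[simp] lemma vecFun_smul (c : ℝ) (G : Fin d → Poly d) (x : Pt d) :
    vecFun (c • G) x = c • vecFun G x := by ext l; simp [vecFun]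

/-- Each monomial either loses one degree or is killed; for `k = 0` all are killed, so the truncated
`k - 1` does no harm. -/
lemma grad_mem_polySpace {k : ℕ} {p : Poly d} (hp : p ∈ polySpace d k) (l : Fin d) :
    grad p l ∈ polySpace d (k - 1) := by
  rw [mem_polySpace] at hp
  unfold grad
  rw [p.as_sum, map_sum]
  refine Submodule.sum_mem _ fun s hs => ?_
  rw [MvPolynomial.pderiv_monomial, mem_polySpace]
  by_cases h0 : s l = 0
  · simp [h0]
  · refine (MvPolynomial.totalDegree_monomial_le _ _).trans ?_
    have h1 := (MvPolynomial.le_totalDegree hs).trans hp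
    have h2 : s = (s - Finsupp.single l 1) + Finsupp.single l 1 :=
      (tsub_add_cancel_of_le (by simpa using Nat.one_le_iff_ne_zero.2 h0)).symm
    rw [h2, Finsupp.sum_add_index' (by simp) (by simp), Finsupp.sum_single_index rfl] at h1
    simp only [Function.id_def] at *
    omega

/-! ### The edgewise projection -/

section EdgeProj

variable {e : Set (Pt d)} {r : ℕ}

instance (e : Set (Pt d)) (r : ℕ) : FiniteDimensional ℝ (polyOn e r) := by
  unfold polyOn; infer_instance

lemma exists_poly_of_mem_polyOn {w : Pt d → ℝ} (hw : w ∈ polyOn e r) :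
    ∃ p ∈ polySpace d r, w = e.indicator (polyFun p) := by
  obtain ⟨p, hp, rfl⟩ := hw
  exact ⟨p, hp, rfl⟩

lemma indicator_mem_polyOn {p : Poly d} (hp : p ∈ polySpace d r) :
    e.indicator (polyFun p) ∈ polyOn e r := ⟨p, hp, rfl⟩

end EdgeProj

namespace ConvexPolytope

variable (T : ConvexPolytope d) {ν : Pt d} {r : ℕ}

/-- The product of `f` with every polynomial is integrable over `e`. -/
def _root_.WG.TestIntegrable (e : Set (Pt d)) (f : Pt d → ℝ) : Prop :=
  ∀ p : Poly d, IntegrableOn (fun x => f x * polyFun p x) e μHE[d - 1]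

lemma integrableOn_facet (hd : 1 ≤ d) (hν : ν ∈ T.normals) {f : Pt d → ℝ} (hf : Continuous f) :
    IntegrableOn f (T.facet ν) μHE[d - 1] := T.integratesContinuous_facet hd hν f hf

lemma integrableOn_facet_of_eqOn (hd : 1 ≤ d) (hν : ν ∈ T.normals) {f g : Pt d → ℝ}
    (hg : Continuous g) (h : Set.EqOn f g (T.facet ν)) :
    IntegrableOn f (T.facet ν) μHE[d - 1] :=
  (T.integrableOn_facet hd hν hg).congr_fun h.symm (T.measurableSet_facet ν)

lemma testIntegrable_of_eqOn (hd : 1 ≤ d) (hν : ν ∈ T.normals) {f g : Pt d → ℝ}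
    (hg : Continuous g) (h : Set.EqOn f g (T.facet ν)) : TestIntegrable (T.facet ν) f :=
  fun p => T.integrableOn_facet_of_eqOn hd hν (g := fun x => g x * polyFun p x) (by fun_prop)
    fun x hx => by simp only [h hx]

lemma eqOn_poly_of_mem_polyOn {e : Set (Pt d)} {w : Pt d → ℝ} (hw : w ∈ polyOn e r) :
    ∃ p ∈ polySpace d r, Set.EqOn w (polyFun p) e := by
  obtain ⟨p, hp, rfl⟩ := exists_poly_of_mem_polyOn hw
  exact ⟨p, hp, fun x hx => Set.indicator_of_mem hx _⟩

lemma testIntegrable_of_mem_polyOn (hd : 1 ≤ d) (hν : ν ∈ T.normals) {w : Pt d → ℝ}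
    (hw : w ∈ polyOn (T.facet ν) r) : TestIntegrable (T.facet ν) w := by
  obtain ⟨p, -, h⟩ := eqOn_poly_of_mem_polyOn hw
  exact T.testIntegrable_of_eqOn hd hν (continuous_polyFun p) h

lemma integrableOn_mul_of_mem_polyOn {e : Set (Pt d)} (he : MeasurableSet e) {f w : Pt d → ℝ}
    (hf : TestIntegrable e f) (hw : w ∈ polyOn e r) :
    IntegrableOn (fun x => f x * w x) e μHE[d - 1] := by
  obtain ⟨p, -, h⟩ := eqOn_poly_of_mem_polyOn hw
  exact (hf p).congr_fun (fun x hx => by simp only [h hx]) he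

/-- A function in `P_r(e)` with zero `L²(e)` norm is zero. -/
lemma eq_zero_of_mem_polyOn (hd : 2 ≤ d) (hν : ν ∈ T.normals) {w : Pt d → ℝ}
    (hw : w ∈ polyOn (T.facet ν) r) (h : ∫ x in T.facet ν, w x ^ 2 ∂μHE[d - 1] = 0) : w = 0 := by
  obtain ⟨p, hp, rfl⟩ := exists_poly_of_mem_polyOn hw
  obtain ⟨φ⟩ := exists_hyperplaneChart (by omega) (T.norm_eq_one ν hν) (T.offset ν)
  obtain ⟨q, hq, hqφ⟩ := exists_polyFun_comp hp φ.map.toAffineMap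
  rw [setIntegral_congr_fun (g := fun x => polyFun p x ^ 2) (T.measurableSet_facet ν)
    (fun x hx => by simp only [Set.indicator_of_mem hx]), T.setIntegral_facet φ] at h
  -- Only the pullback `q` to the chart is shown to vanish; `p` itself may be nonzero away from the
  -- hyperplane.
  have h1 : q = 0 := by
    refine eq_zero_of_integral_sq_eq_zero
      (integratesContinuous_restrict (T.isBounded_preimage_facet φ) _ (by fun_prop))
      (T.interior_preimage_facet_nonempty hd hν φ) ?_
    simp only [hqφ]
    exact h
  ext x
  by_cases hx : x ∈ T.facet ν
  · have h2 := hqφ (φ.proj x)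
    rw [h1, polyFun_zero] at h2
    simp only [Set.indicator_of_mem hx, Pi.zero_apply]
    rw [h2]
    exact congrArg _ (T.map_proj φ hx).symm
  · simp [hx]

/-- `w` is the `L²(e)` projection of `f` onto `P_r(e)`. -/
def _root_.WG.IsEdgeProj (r : ℕ) (e : Set (Pt d)) (f w : Pt d → ℝ) : Prop :=
  w ∈ polyOn e r ∧ ∀ p ∈ polyOn e r,
    ∫ x in e, w x * p x ∂μHE[d - 1] = ∫ x in e, f x * p x ∂μHE[d - 1]

/-- Riesz representation in the finite-dimensional space `P_r(e)`, whose `L²(e)` form is definite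
because a facet has interior points in a chart. -/
lemma exists_isEdgeProj (hd : 2 ≤ d) (hν : ν ∈ T.normals) {f : Pt d → ℝ}
    (hf : TestIntegrable (T.facet ν) f) : ∃ w, IsEdgeProj r (T.facet ν) f w := by
  have hd1 : 1 ≤ d := by omega
  have hm := T.measurableSet_facet ν
  have hi : ∀ v w : polyOn (T.facet ν) r,
      IntegrableOn (fun x => v.1 x * w.1 x) (T.facet ν) μHE[d - 1] := fun v w =>
    integrableOn_mul_of_mem_polyOn hm (T.testIntegrable_of_mem_polyOn hd1 hν v.2) w.2
  have hif : ∀ w : polyOn (T.facet ν) r,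
      IntegrableOn (fun x => f x * w.1 x) (T.facet ν) μHE[d - 1] := fun w =>
    integrableOn_mul_of_mem_polyOn hm hf w.2
  let b : polyOn (T.facet ν) r →ₗ[ℝ] polyOn (T.facet ν) r →ₗ[ℝ] ℝ :=
    LinearMap.mk₂ ℝ (fun v w => ∫ x in T.facet ν, v.1 x * w.1 x ∂μHE[d - 1])
      (fun v₁ v₂ w => by
        rw [← integral_add (hi _ _) (hi _ _)]; congr 1; ext x; simp [add_mul])
      (fun c v w => by
        rw [smul_eq_mul, ← integral_const_mul]; congr 1; ext x; simp [mul_assoc])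
      (fun v w₁ w₂ => by
        rw [← integral_add (hi _ _) (hi _ _)]; congr 1; ext x; simp [mul_add])
      (fun c v w => by
        rw [smul_eq_mul, ← integral_const_mul]; congr 1; ext x; simp [mul_left_comm])
  let F : polyOn (T.facet ν) r →ₗ[ℝ] ℝ :=
    { toFun := fun w => ∫ x in T.facet ν, f x * w.1 x ∂μHE[d - 1]
      map_add' := fun v w => by
        rw [← integral_add (hif _) (hif _)]; congr 1; ext x; simp [mul_add]
      map_smul' := fun c w => by
        rw [RingHom.id_apply, smul_eq_mul, ← integral_const_mul]
        congr 1; ext x; simp [mul_left_comm] }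
  obtain ⟨w, hw⟩ := exists_repr_of_definite b (fun v hv => by
    refine Subtype.ext (T.eq_zero_of_mem_polyOn hd hν v.2 ?_)
    simp only [sq]
    exact hv) F
  exact ⟨w.1, w.2, fun p hp => hw ⟨p, hp⟩⟩

lemma isEdgeProj_unique (hd : 2 ≤ d) (hν : ν ∈ T.normals) {f v w : Pt d → ℝ}
    (hv : IsEdgeProj r (T.facet ν) f v) (hw : IsEdgeProj r (T.facet ν) f w) : v = w := by
  have hd1 : 1 ≤ d := by omega
  have hm := T.measurableSet_facet ν
  have hs : v - w ∈ polyOn (T.facet ν) r := Submodule.sub_mem _ hv.1 hw.1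
  rw [← sub_eq_zero]
  refine T.eq_zero_of_mem_polyOn hd hν hs ?_
  have h1 := (hv.2 _ hs).trans (hw.2 _ hs).symm
  rw [← sub_eq_zero, ← integral_sub
    (integrableOn_mul_of_mem_polyOn hm (T.testIntegrable_of_mem_polyOn hd1 hν hv.1) hs)
    (integrableOn_mul_of_mem_polyOn hm (T.testIntegrable_of_mem_polyOn hd1 hν hw.1) hs)] at h1
  rw [← h1]
  congr 1; ext x; simp only [Pi.sub_apply]; ring

lemma edgeProj_spec (hd : 2 ≤ d) (hν : ν ∈ T.normals) {f : Pt d → ℝ}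
    (hf : TestIntegrable (T.facet ν) f) :
    IsEdgeProj r (T.facet ν) f (edgeProj r (T.facet ν) f) :=
  Classical.epsilon_spec (T.exists_isEdgeProj hd hν hf)

/-- By uniqueness, any function with the projection property is the one chosen in `edgeProj`;
linearity of the projection is deduced from this. -/
lemma _root_.WG.IsEdgeProj.eq_edgeProj (hd : 2 ≤ d) (hν : ν ∈ T.normals) {f w : Pt d → ℝ}
    (hw : IsEdgeProj r (T.facet ν) f w) : edgeProj r (T.facet ν) f = w :=
  T.isEdgeProj_unique hd hν (Classical.epsilon_spec ⟨w, hw⟩) hw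

lemma edgeProj_add (hd : 2 ≤ d) (hν : ν ∈ T.normals) {f g : Pt d → ℝ}
    (hf : TestIntegrable (T.facet ν) f) (hg : TestIntegrable (T.facet ν) g) :
    edgeProj r (T.facet ν) (fun x => f x + g x) =
      edgeProj r (T.facet ν) f + edgeProj r (T.facet ν) g := by
  have hd1 : 1 ≤ d := by omega
  have hm := T.measurableSet_facet ν
  have h1 := T.edgeProj_spec (r := r) hd hν hf
  have h2 := T.edgeProj_spec (r := r) hd hν hg
  refine IsEdgeProj.eq_edgeProj T hd hν ⟨Submodule.add_mem _ h1.1 h2.1, fun p hp => ?_⟩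
  simp only [Pi.add_apply, add_mul]
  rw [integral_add
    (integrableOn_mul_of_mem_polyOn hm (T.testIntegrable_of_mem_polyOn hd1 hν h1.1) hp)
    (integrableOn_mul_of_mem_polyOn hm (T.testIntegrable_of_mem_polyOn hd1 hν h2.1) hp),
    integral_add (integrableOn_mul_of_mem_polyOn hm hf hp)
    (integrableOn_mul_of_mem_polyOn hm hg hp), h1.2 p hp, h2.2 p hp]

lemma edgeProj_smul (hd : 2 ≤ d) (hν : ν ∈ T.normals) {f : Pt d → ℝ} (c : ℝ)
    (hf : TestIntegrable (T.facet ν) f) :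
    edgeProj r (T.facet ν) (fun x => c * f x) = c • edgeProj r (T.facet ν) f := by
  have h1 := T.edgeProj_spec (r := r) hd hν hf
  refine IsEdgeProj.eq_edgeProj T hd hν ⟨Submodule.smul_mem _ c h1.1, fun p hp => ?_⟩
  simp only [Pi.smul_apply, smul_eq_mul, mul_assoc]
  rw [integral_const_mul, integral_const_mul, h1.2 p hp]

/-! ### Riesz representation of the weak gradient on a cell -/

lemma integrableOn_carrier {f : Pt d → ℝ} (hf : Continuous f) :
    IntegrableOn f T.carrier := T.integratesContinuous_carrier f hf

lemma eq_zero_of_integral_dotProduct_self_eq_zero {G : Fin d → Poly d}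
    (h : ∫ x in T.carrier, vecFun G x ⬝ᵥ vecFun G x = 0) : G = 0 := by
  have hi : ∀ l, IntegrableOn (fun x => polyFun (G l) x ^ 2) T.carrier := fun l =>
    T.integrableOn_carrier (by fun_prop)
  have h1 : ∫ x in T.carrier, vecFun G x ⬝ᵥ vecFun G x =
      ∑ l, ∫ x in T.carrier, polyFun (G l) x ^ 2 := by
    rw [← integral_finsetSum _ fun l _ => hi l]
    simp only [dotProduct, vecFun, sq]
  rw [h1, Finset.sum_eq_zero_iff_of_nonneg fun l _ => integral_nonneg fun x => sq_nonneg _] at h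
  ext1 l
  exact eq_zero_of_integral_sq_eq_zero (hi l) T.interior_nonempty (h l (Finset.mem_univ l))

/-- Riesz representation in `[P_j(T)]^d`. With `weakGradRhs` as the functional it yields the weak
gradient in any degree. -/
lemma exists_cell_repr (j : ℕ) (F : (Fin d → Poly d) →ₗ[ℝ] ℝ) :
    ∃ G : Fin d → Poly d, (∀ l, G l ∈ polySpace d j) ∧
      ∀ q : Fin d → Poly d, (∀ l, q l ∈ polySpace d j) →
        ∫ x in T.carrier, vecFun G x ⬝ᵥ vecFun q x = F q := by
  let ι : (Fin d → polySpace d j) →ₗ[ℝ] (Fin d → Poly d) :=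
    LinearMap.pi fun l => (polySpace d j).subtype ∘ₗ LinearMap.proj l
  have hi : ∀ G H : Fin d → Poly d,
      IntegrableOn (fun x => vecFun G x ⬝ᵥ vecFun H x) T.carrier := fun G H =>
    T.integrableOn_carrier (by fun_prop)
  let b : (Fin d → Poly d) →ₗ[ℝ] (Fin d → Poly d) →ₗ[ℝ] ℝ :=
    LinearMap.mk₂ ℝ (fun G H => ∫ x in T.carrier, vecFun G x ⬝ᵥ vecFun H x)
      (fun G₁ G₂ H => by rw [← integral_add (hi _ _) (hi _ _)]; simp [add_dotProduct])
      (fun c G H => by rw [smul_eq_mul, ← integral_const_mul]; simp)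
      (fun G H₁ H₂ => by rw [← integral_add (hi _ _) (hi _ _)]; simp [dotProduct_add])
      (fun c G H => by rw [smul_eq_mul, ← integral_const_mul]; simp)
  obtain ⟨G, hG⟩ := exists_repr_of_definite (b.compl₁₂ ι ι) (fun v hv => by
    have h1 : ι v = 0 := T.eq_zero_of_integral_dotProduct_self_eq_zero hv
    ext1 l
    exact Subtype.ext (congrFun h1 l)) (F ∘ₗ ι)
  exact ⟨ι G, fun l => (G l).2, fun q hq => hG fun l => ⟨q l, hq l⟩⟩

lemma cell_repr_unique {j : ℕ} {G H : Fin d → Poly d} (hG : ∀ l, G l ∈ polySpace d j)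
    (hH : ∀ l, H l ∈ polySpace d j)
    (h : ∀ q : Fin d → Poly d, (∀ l, q l ∈ polySpace d j) →
      ∫ x in T.carrier, vecFun G x ⬝ᵥ vecFun q x = ∫ x in T.carrier, vecFun H x ⬝ᵥ vecFun q x) :
    G = H := by
  rw [← sub_eq_zero]
  apply T.eq_zero_of_integral_dotProduct_self_eq_zero
  have h1 := h (G - H) fun l => Submodule.sub_mem _ (hG l) (hH l)
  rw [← sub_eq_zero, ← integral_sub (T.integrableOn_carrier (by fun_prop))
    (T.integrableOn_carrier (by fun_prop))] at h1
  rw [← h1]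
  simp only [← sub_dotProduct, ← vecFun_sub]

end ConvexPolytope

/-! ### The weak gradient -/

namespace PolytopalMesh

variable {Ω : Set (Pt d)} (M : PolytopalMesh d Ω) {k : ℕ} {v w : M.WeakFunction}
  {i : Fin M.numCells} {ν : Pt d}

lemma exists_poly_of_mem_Vh (hv : v ∈ M.Vh k) (hν : ν ∈ (M.cell i).normals) :
    ∃ p ∈ polySpace d (k - 1), Set.EqOn (v.2 ((M.cell i).facet ν)) (polyFun p)
      ((M.cell i).facet ν) :=
  ConvexPolytope.eqOn_poly_of_mem_polyOn (hv.2.1 _ ⟨i, ν, hν, rfl⟩)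

lemma testIntegrable_jump (hd : 2 ≤ d) (hv : v ∈ M.Vh k) (hν : ν ∈ (M.cell i).normals) :
    TestIntegrable ((M.cell i).facet ν)
      (fun x => v.2 ((M.cell i).facet ν) x - polyFun (v.1 i) x) := by
  obtain ⟨p, -, h⟩ := M.exists_poly_of_mem_Vh hv hν
  exact (M.cell i).testIntegrable_of_eqOn (by omega) hν
    (g := fun x => polyFun p x - polyFun (v.1 i) x) (by fun_prop) fun x hx => by simp only [h hx]

lemma edgeJump_spec (hd : 2 ≤ d) (hv : v ∈ M.Vh k) (hν : ν ∈ (M.cell i).normals) :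
    IsEdgeProj (k - 1) ((M.cell i).facet ν)
      (fun x => v.2 ((M.cell i).facet ν) x - polyFun (v.1 i) x) (M.edgeJump k v i ν) :=
  (M.cell i).edgeProj_spec hd hν (M.testIntegrable_jump hd hv hν)

lemma edgeJump_add (hd : 2 ≤ d) (hv : v ∈ M.Vh k) (hw : w ∈ M.Vh k)
    (hν : ν ∈ (M.cell i).normals) :
    M.edgeJump k (v + w) i ν = M.edgeJump k v i ν + M.edgeJump k w i ν := by
  unfold edgeJump
  rw [← (M.cell i).edgeProj_add hd hν (M.testIntegrable_jump hd hv hν)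
    (M.testIntegrable_jump hd hw hν)]
  congr 1
  ext x
  simp only [Prod.snd_add, Prod.fst_add, Pi.add_apply, polyFun_add]
  ring

lemma edgeJump_smul (hd : 2 ≤ d) (c : ℝ) (hv : v ∈ M.Vh k) (hν : ν ∈ (M.cell i).normals) :
    M.edgeJump k (c • v) i ν = c • M.edgeJump k v i ν := by
  unfold edgeJump
  rw [← (M.cell i).edgeProj_smul hd hν c (M.testIntegrable_jump hd hv hν)]
  congr 1
  ext x
  simp only [Prod.smul_snd, Prod.smul_fst, Pi.smul_apply, polyFun_smul, smul_eq_mul]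
  ring

lemma integrableOn_edgeJump_mul (hd : 2 ≤ d) (hv : v ∈ M.Vh k) (hν : ν ∈ (M.cell i).normals)
    {f : Pt d → ℝ} (hf : Continuous f) :
    IntegrableOn (fun x => M.edgeJump k v i ν x * f x) ((M.cell i).facet ν) μHE[d - 1] := by
  obtain ⟨p, -, h⟩ := ConvexPolytope.eqOn_poly_of_mem_polyOn (M.edgeJump_spec hd hv hν).1
  exact (M.cell i).integrableOn_facet_of_eqOn (by omega) hν
    (g := fun x => polyFun p x * f x) (by fun_prop) fun x hx => by simp only [h hx]

/-- The right-hand side in the definition of the weak gradient. -/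
def weakGradRhs (hd : 2 ≤ d) (hv : v ∈ M.Vh k) (i : Fin M.numCells) :
    (Fin d → Poly d) →ₗ[ℝ] ℝ where
  toFun q := (∫ x in (M.cell i).carrier, vecFun (grad (v.1 i)) x ⬝ᵥ vecFun q x) +
    ∑ ν ∈ (M.cell i).normals, ∫ x in (M.cell i).facet ν,
      M.edgeJump k v i ν x * (vecFun q x ⬝ᵥ ν.ofLp) ∂μHE[d - 1]
  map_add' p q := by
    have h1 : ∀ ν ∈ (M.cell i).normals, ∫ x in (M.cell i).facet ν,
        M.edgeJump k v i ν x * (vecFun (p + q) x ⬝ᵥ ν.ofLp) ∂μHE[d - 1] =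
        (∫ x in (M.cell i).facet ν, M.edgeJump k v i ν x * (vecFun p x ⬝ᵥ ν.ofLp) ∂μHE[d - 1]) +
        ∫ x in (M.cell i).facet ν, M.edgeJump k v i ν x * (vecFun q x ⬝ᵥ ν.ofLp) ∂μHE[d - 1] :=
      fun ν hν => by
        rw [← integral_add (M.integrableOn_edgeJump_mul hd hv hν (by fun_prop))
          (M.integrableOn_edgeJump_mul hd hv hν (by fun_prop))]
        simp [add_dotProduct, mul_add]
    rw [Finset.sum_congr rfl h1, Finset.sum_add_distrib]
    simp only [vecFun_add, dotProduct_add]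
    rw [integral_add ((M.cell i).integrableOn_carrier (by fun_prop))
      ((M.cell i).integrableOn_carrier (by fun_prop))]
    ring
  map_smul' c q := by
    simp only [vecFun_smul, dotProduct_smul, smul_dotProduct, smul_eq_mul, mul_left_comm _ c,
      integral_const_mul, RingHom.id_apply, mul_add, Finset.mul_sum]

lemma weakGrad_spec (hd : 2 ≤ d) (hv : v ∈ M.Vh k) (j : Fin M.numCells → ℕ)
    (i : Fin M.numCells) : M.IsWeakGradAt k (j i) v i (M.weakGrad k j v i) :=
  Classical.epsilon_spec ((M.cell i).exists_cell_repr (j i) (M.weakGradRhs hd hv i))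

variable {j : Fin M.numCells → ℕ}

lemma IsWeakGradAt.eq_weakGrad {G : Fin d → Poly d} (hG : M.IsWeakGradAt k (j i) v i G) :
    M.weakGrad k j v i = G := by
  have h : M.IsWeakGradAt k (j i) v i (M.weakGrad k j v i) := Classical.epsilon_spec ⟨G, hG⟩
  exact (M.cell i).cell_repr_unique h.1 hG.1 fun q hq => by rw [h.2 q hq, hG.2 q hq]

lemma grad_add (p q : Poly d) : grad (p + q) = grad p + grad q := by
  ext1 l; simp [grad]

lemma grad_smul (c : ℝ) (p : Poly d) : grad (c • p) = c • grad p := by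
  ext1 l; simp [grad]

lemma weakGrad_add (hd : 2 ≤ d) (hv : v ∈ M.Vh k) (hw : w ∈ M.Vh k) :
    M.weakGrad k j (v + w) i = M.weakGrad k j v i + M.weakGrad k j w i := by
  have h1 := M.weakGrad_spec hd hv j i
  have h2 := M.weakGrad_spec hd hw j i
  refine IsWeakGradAt.eq_weakGrad M ⟨fun l => Submodule.add_mem _ (h1.1 l) (h2.1 l),
    fun q hq => ?_⟩
  have h3 : ∀ ν ∈ (M.cell i).normals, ∫ x in (M.cell i).facet ν,
      M.edgeJump k (v + w) i ν x * (vecFun q x ⬝ᵥ ν.ofLp) ∂μHE[d - 1] =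
      (∫ x in (M.cell i).facet ν, M.edgeJump k v i ν x * (vecFun q x ⬝ᵥ ν.ofLp) ∂μHE[d - 1]) +
      ∫ x in (M.cell i).facet ν, M.edgeJump k w i ν x * (vecFun q x ⬝ᵥ ν.ofLp) ∂μHE[d - 1] :=
    fun ν hν => by
      rw [← integral_add (M.integrableOn_edgeJump_mul hd hv hν (by fun_prop))
        (M.integrableOn_edgeJump_mul hd hw hν (by fun_prop)), M.edgeJump_add hd hv hw hν]
      simp [add_mul]
  have h4 : grad ((v + w).1 i) = grad (v.1 i) + grad (w.1 i) := grad_add _ _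
  rw [Finset.sum_congr rfl h3, Finset.sum_add_distrib, h4]
  simp only [vecFun_add, add_dotProduct]
  have hi : ∀ G H : Fin d → Poly d, IntegrableOn (fun x => vecFun G x ⬝ᵥ vecFun H x)
      (M.cell i).carrier := fun G H => (M.cell i).integrableOn_carrier (by fun_prop)
  rw [integral_add (hi _ _) (hi _ _), integral_add (hi _ _) (hi _ _), h1.2 q hq, h2.2 q hq]
  ring

lemma weakGrad_smul (hd : 2 ≤ d) (c : ℝ) (hv : v ∈ M.Vh k) :
    M.weakGrad k j (c • v) i = c • M.weakGrad k j v i := by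
  have h1 := M.weakGrad_spec hd hv j i
  refine IsWeakGradAt.eq_weakGrad M ⟨fun l => Submodule.smul_mem _ c (h1.1 l), fun q hq => ?_⟩
  have h3 : ∀ ν ∈ (M.cell i).normals, ∫ x in (M.cell i).facet ν,
      M.edgeJump k (c • v) i ν x * (vecFun q x ⬝ᵥ ν.ofLp) ∂μHE[d - 1] =
      c * ∫ x in (M.cell i).facet ν, M.edgeJump k v i ν x * (vecFun q x ⬝ᵥ ν.ofLp) ∂μHE[d - 1] :=
    fun ν hν => by
      rw [← integral_const_mul, M.edgeJump_smul hd c hv hν]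
      simp [mul_assoc]
  have h4 : grad ((c • v).1 i) = c • grad (v.1 i) := grad_smul _ _
  rw [Finset.sum_congr rfl h3, ← Finset.mul_sum, h4]
  simp only [vecFun_smul, smul_dotProduct, smul_eq_mul]
  rw [integral_const_mul, integral_const_mul, h1.2 q hq]
  ring

end PolytopalMesh

/-! ### Points far from all bounding hyperplanes -/

/-- The part of a ball within a slab of width `δ / ‖u‖` has small volume: `N` disjoint translates
of it fit in a ball of twice the radius. -/
lemma volume_slab_le {m N : ℕ} {x₀ u : Pt m} {h δ s c : ℝ} (hs : 0 < s) (hu : s ≤ ‖u‖)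
    (hδ : 0 < δ) (hN : N * δ ≤ s * h) :
    N * volume.real (Metric.closedBall x₀ h ∩ {y | 0 ≤ c - inner ℝ u y ∧ c - inner ℝ u y < δ}) ≤
      volume.real (Metric.closedBall x₀ (2 * h)) := by
  set S := Metric.closedBall x₀ h ∩ {y | 0 ≤ c - inner ℝ u y ∧ c - inner ℝ u y < δ} with hS
  have hu0 : 0 < ‖u‖ := hs.trans_le hu
  have hSm : MeasurableSet S := by
    refine Metric.isClosed_closedBall.measurableSet.inter ?_
    have hc : Continuous fun y : Pt m => c - inner ℝ u y := by fun_prop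
    exact (isClosed_le continuous_const hc).measurableSet.inter
      (isOpen_lt hc continuous_const).measurableSet
  -- The shift by `a n` changes `inner ℝ u` by exactly `n * δ`, so the shifted slabs occupy the
  -- disjoint level ranges from `n * δ` to `(n + 1) * δ`.
  let a : ℕ → Pt m := fun n => (n * δ / ‖u‖ ^ 2) • u
  have ha : ∀ n, inner ℝ u (a n) = n * δ := fun n => by
    simp only [a, real_inner_smul_right, real_inner_self_eq_norm_sq]
    field_simp
  have hmem : ∀ n y, y ∈ (fun y => y + a n) ⁻¹' S →
      n * δ ≤ c - inner ℝ u y ∧ c - inner ℝ u y < (n + 1) * δ := by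
    rintro n y ⟨-, h1, h2⟩
    rw [inner_add_right, ha] at h1 h2
    constructor <;> linarith
  have hdisj : Set.PairwiseDisjoint (↑(Finset.range N)) fun n => (fun y => y + a n) ⁻¹' S := by
    intro n _ n' _ hne
    refine Set.disjoint_left.2 fun y hy hy' => hne ?_
    have h1 := hmem n y hy
    have h2 := hmem n' y hy'
    have h3 : (n : ℝ) < n' + 1 := lt_of_mul_lt_mul_right (h1.1.trans_lt h2.2) hδ.le
    have h4 : (n' : ℝ) < n + 1 := lt_of_mul_lt_mul_right (h2.1.trans_lt h1.2) hδ.le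
    norm_cast at h3 h4
    omega
  have hvol : ∀ n, volume.real ((fun y => y + a n) ⁻¹' S) = volume.real S := fun n => by
    simp only [measureReal_def, measure_preimage_add_right]
  have hfin : ∀ n ∈ Finset.range N, volume ((fun y => y + a n) ⁻¹' S) ≠ ⊤ := fun n _ => by
    rw [measure_preimage_add_right]
    exact ((measure_mono Set.inter_subset_left).trans_lt measure_closedBall_lt_top).ne
  have hsum := measureReal_biUnion_finset hdisj
    (fun n _ => hSm.preimage (measurable_add_const (a n))) hfin
  simp only [hvol, Finset.sum_const, Finset.card_range, nsmul_eq_mul] at hsum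
  rw [← hsum]
  refine measureReal_mono (Set.iUnion₂_subset fun n hn y hy => ?_) measure_closedBall_lt_top.ne
  have h1 : dist (y + a n) x₀ ≤ h := hy.1
  -- The shifts have length at most `N * δ / ‖u‖ ≤ h`, which keeps all translates in the ball of
  -- radius `2 * h`.
  have h2 : ‖a n‖ ≤ h := by
    simp only [a, norm_smul, norm_div, norm_mul, norm_pow, norm_norm, Real.norm_natCast,
      Real.norm_of_nonneg hδ.le]
    have hn : (n : ℝ) ≤ N := by exact_mod_cast (Finset.mem_range.1 hn).le
    have h3 : (n : ℝ) * δ ≤ ‖u‖ * h := by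
      have h5 : 0 ≤ h := by
        have : 0 ≤ s * h := (by positivity : (0 : ℝ) ≤ N * δ).trans hN
        exact nonneg_of_mul_nonneg_right this hs
      calc (n : ℝ) * δ ≤ N * δ := by gcongr
        _ ≤ s * h := hN
        _ ≤ ‖u‖ * h := by gcongr
    calc n * δ / ‖u‖ ^ 2 * ‖u‖ = n * δ / ‖u‖ := by field_simp
      _ ≤ h := by rw [div_le_iff₀ hu0]; linarith
  rw [Metric.mem_closedBall]
  calc dist y x₀ ≤ dist y (y + a n) + dist (y + a n) x₀ := dist_triangle _ _ _
    _ ≤ 2 * h := by rw [dist_self_add_right]; linarith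

/-- Otherwise `E` is covered by at most `J` slabs, each holding at most a fraction `1 / N` of the
volume of a ball of radius `2 * h`; for large `N` this contradicts the lower volume bound. It serves
for cells with `m = d`, and for facets in a chart with `m = d - 1`, where the gradients `u i` are no
longer unit vectors and `s` bounds them below. -/
lemma exists_deep_point (m J : ℕ) {ρ s : ℝ} (hρ : 0 < ρ) (hs : 0 < s) :
    ∃ c, 0 < c ∧ ∀ (x₀ : Pt m) (h : ℝ), 0 < h → ∀ E : Set (Pt m), E ⊆ Metric.closedBall x₀ h →
      ρ * h ^ m ≤ volume.real E → ∀ {ι : Type} (I : Finset ι) (u : ι → Pt m) (b : ι → ℝ),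
      I.card ≤ J → (∀ i ∈ I, s ≤ ‖u i‖) → (∀ i ∈ I, ∀ y ∈ E, 0 ≤ b i - inner ℝ (u i) y) →
      ∃ y ∈ E, ∀ i ∈ I, c * h ≤ b i - inner ℝ (u i) y := by
  set ω := volume.real (Metric.ball (0 : Pt m) 1)
  obtain ⟨N, hN⟩ := exists_nat_gt (J * (2 ^ m * ω) / ρ)
  have hN0 : (0 : ℝ) < N := (by positivity : (0 : ℝ) ≤ J * (2 ^ m * ω) / ρ).trans_lt hN
  rw [div_lt_iff₀ hρ] at hN
  refine ⟨s / N, by positivity, fun x₀ h hh E hE hvol ι I u b hI hu hb => ?_⟩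
  by_contra! hcon
  let S : ι → Set (Pt m) := fun i => Metric.closedBall x₀ h ∩
    {y | 0 ≤ b i - inner ℝ (u i) y ∧ b i - inner ℝ (u i) y < s / N * h}
  have hcov : E ⊆ ⋃ i ∈ I, S i := fun y hy => by
    obtain ⟨i, hi, hlt⟩ := hcon y hy
    exact Set.mem_iUnion₂.2 ⟨i, hi, hE hy, hb i hi y hy, hlt⟩
  have hball : volume.real (Metric.closedBall x₀ (2 * h)) = 2 ^ m * ω * h ^ m := by
    rw [Measure.addHaar_real_closedBall _ _ (by positivity), finrank_euclideanSpace_fin, mul_pow]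
    ring
  have hS : ∀ i ∈ I, N * volume.real (S i) ≤ 2 ^ m * ω * h ^ m := fun i hi => by
    rw [← hball]
    refine volume_slab_le hs (hu i hi) (by positivity) (le_of_eq ?_)
    field_simp
  have hfin : volume (⋃ i ∈ I, S i) ≠ ⊤ :=
    ((measure_mono (Set.iUnion₂_subset fun i _ => Set.inter_subset_left)).trans_lt
      (measure_closedBall_lt_top (x := x₀) (r := h))).ne
  have h1 : N * volume.real E ≤ J * (2 ^ m * ω * h ^ m) := by
    calc N * volume.real E ≤ N * ∑ i ∈ I, volume.real (S i) := by
          gcongr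
          exact (measureReal_mono hcov hfin).trans (measureReal_biUnion_finset_le _ _)
      _ = ∑ i ∈ I, N * volume.real (S i) := Finset.mul_sum _ _ _
      _ ≤ ∑ i ∈ I, 2 ^ m * ω * h ^ m := Finset.sum_le_sum hS
      _ = I.card * (2 ^ m * ω * h ^ m) := by simp
      _ ≤ J * (2 ^ m * ω * h ^ m) := by gcongr
  have h2 : N * (ρ * h ^ m) ≤ N * volume.real E := by gcongr
  have h3 : 0 < h ^ m := by positivity
  nlinarith

/-! ### Shape regularity implies fatness -/

namespace ConvexPolytope

/-- Quantitative nondegeneracy: `T` and each of its facets contain a point whose distance to all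
(other) bounding hyperplanes is at least `c * h_T`. -/
def IsFat (T : ConvexPolytope d) (c : ℝ) : Prop :=
  (∃ z ∈ T.carrier, ∀ ν ∈ T.normals, c * T.size ≤ T.slack ν z) ∧
    ∀ ν ∈ T.normals, ∃ x ∈ T.facet ν, ∀ μ ∈ T.normals, μ ≠ ν → c * T.size ≤ T.slack μ x

/-- The cell part is `exists_deep_point` applied to `T`. On a facet the same argument works in a
chart for normals `μ` that are not nearly opposite to `ν`, since the slack of `μ` then has gradient
bounded below along the facet. A nearly opposite `μ` belongs to an almost parallel hyperplane on the
other side, and the deep point of the cell shows that it is far from the whole facet. -/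
lemma exists_isFat (hd : 2 ≤ d) (J : ℕ) {ρv ρe κ θ : ℝ} (hρv : 0 < ρv) (hρe : 0 < ρe)
    (hκ : 0 < κ) (hθ : 0 < θ) :
    ∃ c, 0 < c ∧ ∀ T : ConvexPolytope d, T.normals.card ≤ J →
      ρv * T.size ^ d ≤ volume.real T.carrier →
      (∀ ν ∈ T.normals,
        ρe * Metric.diam (T.facet ν) ^ (d - 1) ≤ μHE[d - 1].real (T.facet ν)) →
      (∀ ν ∈ T.normals, κ * T.size ≤ Metric.diam (T.facet ν)) →
      (∀ ν ∈ T.normals, ∀ ν' ∈ T.normals, ν ≠ ν' → θ ≤ InnerProductGeometry.angle ν ν') →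
      T.IsFat c := by
  obtain ⟨c₁, hc₁, H₁⟩ := exists_deep_point d J hρv one_pos
  -- The minimum keeps the argument in the range where the cosine is decreasing, as `θ` may exceed
  -- `π`.
  have hcos : Real.cos (min θ Real.pi) < 1 := by
    rw [← Real.cos_zero]
    exact Real.cos_lt_cos_of_nonneg_of_le_pi le_rfl (min_le_right _ _)
      (lt_min hθ Real.pi_pos)
  -- This is the threshold for nearly opposite: `inner ℝ ν μ < -1 + ε` gives `‖ν + μ‖ ^ 2 < 2 * ε =
  -- c₁ ^ 2`. Above it, the squared gradient `(1 - inner ℝ ν μ) * (1 + inner ℝ ν μ)` is at least `s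
  -- ^ 2`.
  set ε := c₁ ^ 2 / 2 with hε
  set s := Real.sqrt ((1 - Real.cos (min θ Real.pi)) * ε) with hsdef
  have hs : 0 < s := Real.sqrt_pos.2 (mul_pos (by linarith) (by positivity))
  obtain ⟨c₂, hc₂, H₂⟩ := exists_deep_point (d - 1) J
    (show 0 < ρe * κ ^ (d - 1) by positivity) hs
  refine ⟨min c₁ c₂, lt_min hc₁ hc₂, fun T hJ hvol harea hdiam hangle => ?_⟩
  have hh := T.size_pos hd
  obtain ⟨x₁, hx₁⟩ := T.interior_nonempty.mono interior_subset
  obtain ⟨z, hz, hzs⟩ := H₁ x₁ T.size hh T.carrier (fun y hy => T.dist_le_size hy hx₁) hvol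
    T.normals id T.offset hJ (fun ν hν => (T.norm_eq_one ν hν).ge)
    (fun ν hν y hy => T.mem_carrier.1 hy ν hν)
  replace hzs : ∀ ν ∈ T.normals, c₁ * T.size ≤ T.slack ν z := hzs
  refine ⟨⟨z, hz, fun ν hν => le_trans ?_ (hzs ν hν)⟩, fun ν hν => ?_⟩
  · gcongr; exact min_le_left _ _
  obtain ⟨φ⟩ := exists_hyperplaneChart (by omega) (T.norm_eq_one ν hν) (T.offset ν)
  choose u hu₁ hu₂ using φ.exists_gradient
  obtain ⟨y₀, hy₀⟩ := (T.interior_preimage_facet_nonempty hd hν φ).mono interior_subset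
  classical
  obtain ⟨y, hy, hys⟩ := H₂ y₀ T.size hh (φ.map ⁻¹' T.facet ν)
    (fun y hy => by
      rw [Metric.mem_closedBall, ← φ.map.dist_map]
      exact T.dist_le_size (T.facet_subset ν hy) (T.facet_subset ν hy₀))
    (by
      rw [← T.measureReal_facet φ]
      refine le_trans ?_ (harea ν hν)
      rw [mul_assoc, ← mul_pow]
      gcongr
      exact hdiam ν hν)
    (T.normals.filter fun μ => μ ≠ ν ∧ -1 + ε ≤ inner ℝ ν μ) u
    (fun μ => T.offset μ - inner ℝ μ (φ.map 0)) ((Finset.card_filter_le _ _).trans hJ)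
    (fun μ hμ => by
      obtain ⟨hμ, hne, hin⟩ := Finset.mem_filter.1 hμ
      refine Real.sqrt_le_iff.2 ⟨norm_nonneg _, ?_⟩
      have h1 : inner ℝ ν μ ≤ Real.cos (min θ Real.pi) := by
        have h2 : inner ℝ ν μ = Real.cos (InnerProductGeometry.angle ν μ) := by
          rw [InnerProductGeometry.cos_angle, T.norm_eq_one ν hν, T.norm_eq_one μ hμ]; simp
        rw [h2]
        exact Real.cos_le_cos_of_nonneg_of_le_pi (le_min hθ.le Real.pi_pos.le)
          (InnerProductGeometry.angle_le_pi _ _)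
          ((min_le_left _ _).trans (hangle ν hν μ hμ hne.symm))
      rw [hu₂, T.norm_eq_one μ hμ]
      calc (1 - Real.cos (min θ Real.pi)) * ε ≤ (1 - inner ℝ ν μ) * (1 + inner ℝ ν μ) :=
            mul_le_mul (by linarith) (by linarith) (by positivity) (by linarith)
        _ = _ := by ring)
    (fun μ hμ y hy => by
      have h1 := T.mem_carrier.1 (T.facet_subset ν hy) μ (Finset.mem_filter.1 hμ).1
      rw [slack, hu₁] at h1
      linarith)
  refine ⟨φ.map y, hy, fun μ hμ hne => ?_⟩
  by_cases hin : -1 + ε ≤ inner ℝ ν μ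
  · have h1 := hys μ (Finset.mem_filter.2 ⟨hμ, hne, hin⟩)
    calc min c₁ c₂ * T.size ≤ c₂ * T.size := by gcongr; exact min_le_right _ _
      _ ≤ T.slack μ (φ.map y) := by rw [slack, hu₁]; linarith
  -- The sum of the two slacks is at least `2 * c₁ * T.size` at `z`, and it changes by at most `c₁ *
  -- T.size` across the cell. On the facet the slack of `ν` is zero, so all that remains belongs to
  -- `μ`.
  · have h1 : ‖ν + μ‖ ≤ c₁ := by
      refine abs_le_of_sq_le_sq' ?_ hc₁.le |>.2
      rw [norm_add_sq_real, T.norm_eq_one ν hν, T.norm_eq_one μ hμ]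
      linarith
    have h2 : T.slack μ (φ.map y) + T.slack ν (φ.map y) =
        T.slack μ z + T.slack ν z - inner ℝ (ν + μ) (φ.map y - z) := by
      simp only [slack, inner_add_left, inner_sub_right]; ring
    rw [T.slack_map φ] at h2
    have h3 : inner ℝ (ν + μ) (φ.map y - z) ≤ c₁ * T.size := by
      refine (real_inner_le_norm _ _).trans ?_
      have h4 : ‖φ.map y - z‖ ≤ T.size := by
        rw [← dist_eq_norm]; exact T.dist_le_size (T.facet_subset ν hy) hz
      gcongr
    have h5 : min c₁ c₂ * T.size ≤ c₁ * T.size := by gcongr; exact min_le_left _ _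
    linarith [hzs μ hμ, hzs ν hν]

end ConvexPolytope

/-! ### Polynomial estimates on a fat cell -/

lemma setIntegral_le_mul_of_le {X : Type*} [MeasurableSpace X] {μ : Measure X} {s : Set X}
    (hs : MeasurableSet s) (hμ : μ s ≠ ⊤) {f : X → ℝ} (hf : IntegrableOn f s μ) {M V : ℝ}
    (hM : 0 ≤ M) (h : ∀ x ∈ s, f x ≤ M) (hV : μ.real s ≤ V) : ∫ x in s, f x ∂μ ≤ M * V := by
  calc ∫ x in s, f x ∂μ ≤ ∫ _ in s, M ∂μ :=
        setIntegral_mono_on hf (integrableOn_const hμ) hs h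
    _ = M * μ.real s := by rw [setIntegral_const, smul_eq_mul, mul_comm]
    _ ≤ M * V := by gcongr

namespace ConvexPolytope

variable (T : ConvexPolytope d) {ν : Pt d} {c : ℝ}

lemma IsFat.mono {T : ConvexPolytope d} {c c' : ℝ} (h : T.IsFat c) (hc : c' ≤ c) :
    T.IsFat c' := by
  have h0 : c' * T.size ≤ c * T.size := mul_le_mul_of_nonneg_right hc Metric.diam_nonneg
  obtain ⟨⟨z, hz, hzs⟩, h2⟩ := h
  refine ⟨⟨z, hz, fun ν hν => h0.trans (hzs ν hν)⟩, fun ν hν => ?_⟩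
  obtain ⟨x, hx, hxs⟩ := h2 ν hν
  exact ⟨x, hx, fun μ hμ hne => h0.trans (hxs μ hμ hne)⟩

lemma slack_le_size (hd : 2 ≤ d) (hν : ν ∈ T.normals) {x : Pt d} (hx : x ∈ T.carrier) :
    T.slack ν x ≤ T.size := by
  obtain ⟨y, hy⟩ := T.facet_nonempty hd hν
  have h1 := (le_abs_self _).trans (T.abs_slack_sub_le hν x y)
  rw [(T.mem_facet.1 hy).2, sub_zero] at h1
  exact h1.trans (T.dist_le_size hx hy.1)

lemma size_nonneg : 0 ≤ T.size := Metric.diam_nonneg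

/-- The volume of the unit ball. -/
abbrev _root_.WG.unitBallVolume (n : ℕ) : ℝ := volume.real (Metric.ball (0 : Pt n) 1)

lemma volume_ne_top : volume T.carrier ≠ ⊤ := T.isBounded_carrier.measure_lt_top.ne

lemma volume_le (T : ConvexPolytope d) : volume.real T.carrier ≤ unitBallVolume d * T.size ^ d := by
  obtain ⟨z, hz⟩ := T.interior_nonempty.mono interior_subset
  calc volume.real T.carrier ≤ volume.real (Metric.closedBall z T.size) :=
        measureReal_mono (fun x hx => T.dist_le_size hx hz) measure_closedBall_lt_top.ne
    _ = _ := by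
        rw [Measure.addHaar_real_closedBall _ _ T.size_nonneg, finrank_euclideanSpace_fin,
          mul_comm]

lemma measure_facet_ne_top (hd : 1 ≤ d) (hν : ν ∈ T.normals) :
    (μHE[d - 1] : Measure (Pt d)) (T.facet ν) ≠ ⊤ := by
  have h := T.integrableOn_facet hd hν (f := fun _ => 1) continuous_const
  rw [integrableOn_const_iff] at h
  simpa using h.resolve_left (by norm_num) |>.ne

lemma measure_facet_le (hd : 2 ≤ d) (hν : ν ∈ T.normals) :
    μHE[d - 1].real (T.facet ν) ≤ unitBallVolume (d - 1) * T.size ^ (d - 1) := by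
  obtain ⟨φ⟩ := exists_hyperplaneChart (by omega) (T.norm_eq_one ν hν) (T.offset ν)
  obtain ⟨y, hy⟩ := (T.interior_preimage_facet_nonempty hd hν φ).mono interior_subset
  rw [T.measureReal_facet φ]
  calc _ ≤ volume.real (Metric.closedBall y T.size) :=
        measureReal_mono (fun x hx => by
          rw [Metric.mem_closedBall, ← φ.map.dist_map]
          exact T.dist_le_size (T.facet_subset ν hx) (T.facet_subset ν hy))
          measure_closedBall_lt_top.ne
    _ = _ := by
        rw [Measure.addHaar_real_closedBall _ _ T.size_nonneg, finrank_euclideanSpace_fin,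
          mul_comm]

lemma half_le_slack {c : ℝ} (hν : ν ∈ T.normals) {z y : Pt d} (hz : c * T.size ≤ T.slack ν z)
    (hy : dist y z < c / 2 * T.size) : c / 2 * T.size ≤ T.slack ν y := by
  have h := neg_le_of_abs_le (T.abs_slack_sub_le hν y z)
  linarith

lemma ball_subset_carrier (hc : 0 < c) {z : Pt d}
    (hz : ∀ ν ∈ T.normals, c * T.size ≤ T.slack ν z) :
    Metric.ball z (c / 2 * T.size) ⊆ T.carrier := fun y hy =>
  T.mem_carrier.2 fun ν hν => by
    have h0 : 0 ≤ T.size := Metric.diam_nonneg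
    exact (by positivity : 0 ≤ c / 2 * T.size).trans (T.half_le_slack hν (hz ν hν) hy)

/-- A polynomial on a fat cell is bounded by its `L²` norm over a ball inside the cell. -/
lemma exists_sq_le_integral_inner_ball (hd : 2 ≤ d) (m : ℕ) (hc : 0 < c) :
    ∃ C, 0 < C ∧ ∀ T : ConvexPolytope d, ∀ z ∈ T.carrier, ∀ p ∈ polySpace d m, ∀ x ∈ T.carrier,
      polyFun p x ^ 2 * T.size ^ d ≤
        C * ∫ y in Metric.ball z (c / 2 * T.size), polyFun p y ^ 2 := by
  -- The whole cell lies within `2 / c` times the radius `c / 2 * T.size` from `z`.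
  obtain ⟨C, hC, H⟩ := exists_sq_le_integral_ball d m (2 / c)
  refine ⟨(2 / c) ^ d * C, by positivity, fun T z hz p hp x hx => ?_⟩
  have hh := T.size_pos hd
  have h1 := H p hp z (c / 2 * T.size) (by positivity) x (by
    have : 2 / c * (c / 2 * T.size) = T.size := by field_simp
    rw [this]; exact T.dist_le_size hx hz)
  have h2 : (2 / c) ^ d * (c / 2) ^ d = 1 := by
    rw [← mul_pow]; field_simp; simp
  calc polyFun p x ^ 2 * T.size ^ d
      = (2 / c) ^ d * (c / 2) ^ d * (polyFun p x ^ 2 * T.size ^ d) := by rw [h2, one_mul]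
    _ = (2 / c) ^ d * (polyFun p x ^ 2 * (c / 2 * T.size) ^ d) := by rw [mul_pow]; ring
    _ ≤ (2 / c) ^ d * (C * ∫ y in Metric.ball z (c / 2 * T.size), polyFun p y ^ 2) := by gcongr
    _ = _ := by ring

/-- Fatness puts the ball of radius `c / 2 * T.size` about the deep point inside the cell. -/
lemma exists_sq_le_integral (hd : 2 ≤ d) (m : ℕ) (hc : 0 < c) :
    ∃ C, 0 < C ∧ ∀ T : ConvexPolytope d, T.IsFat c → ∀ p ∈ polySpace d m, ∀ x ∈ T.carrier,
      polyFun p x ^ 2 * T.size ^ d ≤ C * ∫ y in T.carrier, polyFun p y ^ 2 := by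
  obtain ⟨C, hC, H⟩ := exists_sq_le_integral_inner_ball hd m hc
  refine ⟨C, hC, fun T hT p hp x hx => ?_⟩
  obtain ⟨⟨z, hz, hzs⟩, -⟩ := hT
  refine (H T z hz p hp x hx).trans ?_
  refine mul_le_mul_of_nonneg_left ?_ hC.le
  exact setIntegral_mono_set
    (T.integrableOn_carrier (f := fun y => polyFun p y ^ 2) (by fun_prop))
    (Filter.Eventually.of_forall fun y => sq_nonneg _)
    (T.ball_subset_carrier hc hzs).eventuallyLE

/-- The trace inequality for polynomials. -/
lemma exists_trace_bound (hd : 2 ≤ d) (m : ℕ) (hc : 0 < c) :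
    ∃ C, 0 < C ∧ ∀ T : ConvexPolytope d, T.IsFat c → ∀ ν ∈ T.normals, ∀ p ∈ polySpace d m,
      T.size * ∫ x in T.facet ν, polyFun p x ^ 2 ∂μHE[d - 1] ≤
        C * ∫ x in T.carrier, polyFun p x ^ 2 := by
  obtain ⟨C, hC, H⟩ := exists_sq_le_integral hd m hc
  refine ⟨C * (unitBallVolume (d - 1) + 1), by positivity, fun T hT ν hν p hp => ?_⟩
  have hh := T.size_pos hd
  set I := ∫ x in T.carrier, polyFun p x ^ 2
  have hI : 0 ≤ I := integral_nonneg fun x => sq_nonneg _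
  have hpow : T.size ^ d = T.size * T.size ^ (d - 1) := by
    rw [← pow_succ']; congr 1; omega
  -- The trace is at most the squared supremum times the facet area; the powers `d` and `d - 1` of
  -- the size leave the factor `T.size` of the claim.
  have h1 := setIntegral_le_mul_of_le (T.measurableSet_facet ν)
    (T.measure_facet_ne_top (by omega) hν)
    (T.integrableOn_facet (f := fun x => polyFun p x ^ 2) (by omega) hν (by fun_prop))
    (M := C * I / T.size ^ d) (by positivity) (fun x hx => by
      rw [le_div_iff₀ (by positivity)]
      exact H T hT p hp x (T.facet_subset ν hx)) (T.measure_facet_le hd hν)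
  calc T.size * ∫ x in T.facet ν, polyFun p x ^ 2 ∂μHE[d - 1]
      ≤ T.size * (C * I / T.size ^ d * (unitBallVolume (d - 1) * T.size ^ (d - 1))) := by gcongr
    _ = C * unitBallVolume (d - 1) * I := by rw [hpow]; field_simp
    _ ≤ C * (unitBallVolume (d - 1) + 1) * I := by gcongr; linarith

lemma dotProduct_sq_le (G : Fin d → ℝ) {ν : Pt d} (hν : ‖ν‖ = 1) :
    (G ⬝ᵥ ν.ofLp) ^ 2 ≤ G ⬝ᵥ G := by
  have h1 : ∑ l, ν l ^ 2 = 1 := by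
    rw [← EuclideanSpace.real_norm_sq_eq, hν]; norm_num
  have h2 := Finset.sum_mul_sq_le_sq_mul_sq Finset.univ G ν
  rw [h1, mul_one] at h2
  simpa only [dotProduct, sq] using h2

lemma dotProduct_self_ofLp {ν : Pt d} (hν : ‖ν‖ = 1) : ν.ofLp ⬝ᵥ ν.ofLp = 1 := by
  have h1 : ∑ l, ν l ^ 2 = 1 := by
    rw [← EuclideanSpace.real_norm_sq_eq, hν]; norm_num
  simpa only [dotProduct, sq] using h1

/-- The normal component of a polynomial vector field. -/
def normalPoly (G : Fin d → Poly d) (ν : Pt d) : Poly d := ∑ l, MvPolynomial.C (ν l) * G l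

lemma normalPoly_mem {m : ℕ} {G : Fin d → Poly d} (hG : ∀ l, G l ∈ polySpace d m) (ν : Pt d) :
    normalPoly G ν ∈ polySpace d m :=
  Submodule.sum_mem _ fun l _ => by
    simpa using mul_mem_polySpace (C_mem_polySpace (ν l) 0) (hG l)

lemma polyFun_normalPoly (G : Fin d → Poly d) (ν x : Pt d) :
    polyFun (normalPoly G ν) x = vecFun G x ⬝ᵥ ν.ofLp := by
  simp [normalPoly, dotProduct, vecFun, mul_comm]

lemma exists_normal_trace_bound (hd : 2 ≤ d) (m : ℕ) (hc : 0 < c) :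
    ∃ C, 0 < C ∧ ∀ T : ConvexPolytope d, T.IsFat c → ∀ ν ∈ T.normals, ∀ G : Fin d → Poly d,
      (∀ l, G l ∈ polySpace d m) →
      T.size * ∫ x in T.facet ν, (vecFun G x ⬝ᵥ ν.ofLp) ^ 2 ∂μHE[d - 1] ≤
        C * ∫ x in T.carrier, vecFun G x ⬝ᵥ vecFun G x := by
  obtain ⟨C, hC, H⟩ := exists_trace_bound hd m hc
  refine ⟨C, hC, fun T hT ν hν G hG => ?_⟩
  have h1 := H T hT ν hν _ (normalPoly_mem hG ν)
  simp only [polyFun_normalPoly] at h1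
  refine h1.trans ?_
  refine mul_le_mul_of_nonneg_left ?_ hC.le
  exact setIntegral_mono_on (T.integrableOn_carrier (by fun_prop))
    (T.integrableOn_carrier (by fun_prop)) T.measurableSet_carrier
    fun x _ => dotProduct_sq_le _ (T.norm_eq_one ν hν)

/-- A polynomial on a facet is controlled by its `L²` norm over a ball in the facet. -/
lemma exists_sq_proj_le_integral (hd : 2 ≤ d) (m : ℕ) (hc : 0 < c) :
    ∃ C, 0 < C ∧ ∀ T : ConvexPolytope d, ∀ ν ∈ T.normals,
      ∀ φ : HyperplaneChart ν (T.offset ν), ∀ x₀ ∈ T.facet ν, ∀ p ∈ polySpace d m,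
      ∀ x ∈ T.carrier, polyFun p (φ.map (φ.proj x)) ^ 2 * T.size ^ (d - 1) ≤
        C * ∫ y in Metric.ball (φ.proj x₀) (c / 2 * T.size), polyFun p (φ.map y) ^ 2 := by
  obtain ⟨C, hC, H⟩ := exists_sq_le_integral_ball (d - 1) m (2 / c)
  refine ⟨(2 / c) ^ (d - 1) * C, by positivity, fun T ν hν φ x₀ hx₀ p hp x hx => ?_⟩
  have hh := T.size_pos hd
  obtain ⟨q, hq, hqφ⟩ := exists_polyFun_comp hp φ.map.toAffineMap
  replace hqφ : ∀ y, polyFun q y = polyFun p (φ.map y) := hqφ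
  have h1 := H q hq (φ.proj x₀) (c / 2 * T.size) (by positivity) (φ.proj x) (by
    have : 2 / c * (c / 2 * T.size) = T.size := by field_simp
    rw [this]; exact (φ.dist_proj_le _ _).trans (T.dist_le_size hx hx₀.1))
  have h2 : (2 / c) ^ (d - 1) * (c / 2) ^ (d - 1) = 1 := by
    rw [← mul_pow]; field_simp; simp
  simp only [hqφ] at h1
  set P := polyFun p (φ.map (φ.proj x)) ^ 2
  calc P * T.size ^ (d - 1)
      = (2 / c) ^ (d - 1) * (c / 2) ^ (d - 1) * (P * T.size ^ (d - 1)) := by rw [h2, one_mul]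
    _ = (2 / c) ^ (d - 1) * (P * (c / 2 * T.size) ^ (d - 1)) := by rw [mul_pow]; ring
    _ ≤ (2 / c) ^ (d - 1) * (C * ∫ y in Metric.ball (φ.proj x₀) (c / 2 * T.size),
          polyFun p (φ.map y) ^ 2) := by gcongr
    _ = _ := by ring

end ConvexPolytope

namespace ConvexPolytope

variable (T : ConvexPolytope d) {ν : Pt d} {c : ℝ}

/-! ### The test field attached to a facet -/

/-- The normalised distance to the hyperplane of the facet with normal `ν`. -/
def lamPoly (ν : Pt d) : Poly d :=
  MvPolynomial.C (T.offset ν / T.size) - ∑ l, MvPolynomial.C (ν l / T.size) * MvPolynomial.X l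

lemma lamPoly_mem (ν : Pt d) : T.lamPoly ν ∈ polySpace d 1 := by
  refine Submodule.sub_mem _ (C_mem_polySpace _ _) (Submodule.sum_mem _ fun l _ => ?_)
  simpa using mul_mem_polySpace (C_mem_polySpace _ 0) (X_mem_polySpace l)

lemma polyFun_lamPoly (ν x : Pt d) : polyFun (T.lamPoly ν) x = T.slack ν x / T.size := by
  simp only [lamPoly, polyFun_sub, polyFun_C, polyFun_sum, polyFun_mul, polyFun_X, slack, sub_div,
    PiLp.inner_apply, Finset.sum_div]
  congr 1
  refine Finset.sum_congr rfl fun l _ => ?_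
  simp only [RCLike.inner_apply, conj_trivial]
  ring

/-- The product of the normalised distances to all hyperplanes but the one with normal `ν`. -/
def bubble (ν : Pt d) : Poly d :=
  open scoped Classical in ∏ μ ∈ T.normals.erase ν, T.lamPoly μ

lemma prod_mem_polySpace {ι : Type*} (s : Finset ι) (p : ι → Poly d)
    (h : ∀ i ∈ s, p i ∈ polySpace d 1) : ∏ i ∈ s, p i ∈ polySpace d s.card := by
  rw [mem_polySpace]
  refine (MvPolynomial.totalDegree_finsetProd _ _).trans ?_
  refine (Finset.sum_le_sum fun i hi => mem_polySpace.1 (h i hi)).trans ?_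
  simp

lemma bubble_mem (hν : ν ∈ T.normals) : T.bubble ν ∈ polySpace d (T.normals.card - 1) := by
  classical
  have h := prod_mem_polySpace (T.normals.erase ν) T.lamPoly fun μ _ => T.lamPoly_mem μ
  rw [Finset.card_erase_of_mem hν] at h
  unfold bubble
  convert h

lemma lamPoly_nonneg (hν : ν ∈ T.normals) {x : Pt d} (hx : x ∈ T.carrier) :
    0 ≤ polyFun (T.lamPoly ν) x := by
  rw [polyFun_lamPoly]
  exact div_nonneg (T.mem_carrier.1 hx ν hν) T.size_nonneg

lemma lamPoly_le_one (hd : 2 ≤ d) (hν : ν ∈ T.normals) {x : Pt d} (hx : x ∈ T.carrier) :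
    polyFun (T.lamPoly ν) x ≤ 1 := by
  rw [polyFun_lamPoly, div_le_one (T.size_pos hd)]
  exact T.slack_le_size hd hν hx

lemma bubble_nonneg (ν : Pt d) {x : Pt d} (hx : x ∈ T.carrier) : 0 ≤ polyFun (T.bubble ν) x := by
  rw [bubble, polyFun_prod]
  exact Finset.prod_nonneg fun μ hμ => T.lamPoly_nonneg (Finset.mem_of_mem_erase hμ) hx

lemma bubble_le_one (hd : 2 ≤ d) (ν : Pt d) {x : Pt d} (hx : x ∈ T.carrier) :
    polyFun (T.bubble ν) x ≤ 1 := by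
  rw [bubble, polyFun_prod]
  exact Finset.prod_le_one (fun μ hμ => T.lamPoly_nonneg (Finset.mem_of_mem_erase hμ) hx)
    fun μ hμ => T.lamPoly_le_one hd (Finset.mem_of_mem_erase hμ) hx

lemma bubble_eq_zero {μ : Pt d} (hμ : μ ∈ T.normals) (hne : μ ≠ ν) {x : Pt d}
    (hx : x ∈ T.facet μ) : polyFun (T.bubble ν) x = 0 := by
  classical
  rw [bubble, polyFun_prod]
  refine Finset.prod_eq_zero (i := μ) (by simp [hμ, hne]) ?_
  rw [polyFun_lamPoly, (T.mem_facet.1 hx).2, zero_div]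

lemma pow_le_bubble {b : ℝ} (hb : 0 < b) (hb1 : b ≤ 1) {J : ℕ} (hJ : T.normals.card ≤ J)
    {x : Pt d} (h : ∀ μ ∈ T.normals, μ ≠ ν → b ≤ polyFun (T.lamPoly μ) x) :
    b ^ J ≤ polyFun (T.bubble ν) x := by
  classical
  rw [bubble, polyFun_prod]
  calc b ^ J ≤ b ^ (T.normals.erase ν).card :=
        pow_le_pow_of_le_one hb.le hb1 ((Finset.card_erase_le).trans hJ)
    _ = ∏ μ ∈ T.normals.erase ν, b := by simp
    _ ≤ ∏ μ ∈ T.normals.erase ν, polyFun (T.lamPoly μ) x :=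
        Finset.prod_le_prod (fun _ _ => hb.le) fun μ hμ =>
          h μ (Finset.mem_of_mem_erase hμ) (Finset.ne_of_mem_erase hμ)
    _ = _ := by congr

lemma pow_le_bubble_mul {b : ℝ} (hb : 0 < b) (hb1 : b ≤ 1) {J : ℕ} (hJ : T.normals.card ≤ J)
    (hν : ν ∈ T.normals) {x : Pt d} (h : ∀ μ ∈ T.normals, b ≤ polyFun (T.lamPoly μ) x) :
    b ^ (J + 1) ≤ polyFun (T.bubble ν) x * polyFun (T.lamPoly ν) x := by
  rw [pow_succ]
  have h1 := T.pow_le_bubble hb hb1 hJ fun μ hμ (_ : μ ≠ ν) => h μ hμ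
  exact mul_le_mul h1 (h ν hν) hb.le ((pow_nonneg hb.le J).trans h1)

/-- The correction that makes the test field orthogonal to polynomials of lower degree. -/
lemma exists_correction (hd : 2 ≤ d) (m J : ℕ) (hc : 0 < c) (hc1 : c ≤ 1) :
    ∃ C, 0 < C ∧ ∀ T : ConvexPolytope d, T.IsFat c → T.normals.card ≤ J → ∀ ν ∈ T.normals,
      ∀ W : Poly d, ∀ A : ℝ, 0 ≤ A → (∀ x ∈ T.carrier, polyFun W x ^ 2 ≤ A) →
      ∃ r ∈ polySpace d m,
        (∀ s ∈ polySpace d m, ∫ x in T.carrier, polyFun (T.bubble ν) x *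
          (polyFun (W + T.lamPoly ν * r) x * polyFun s x) = 0) ∧
        ∀ x ∈ T.carrier, polyFun r x ^ 2 ≤ C * A := by
  obtain ⟨C, hC, H⟩ := exists_sq_le_integral_inner_ball hd m hc
  -- A lower bound for the weight `bubble * lamPoly` on the half-radius ball: at most `J + 1`
  -- factors, each at least `c / 2` there.
  set a := (c / 2) ^ (J + 1) with ha
  have ha0 : 0 < a := by positivity
  set ω := unitBallVolume d + 1
  have hω : 0 < ω := by positivity
  refine ⟨(C * ω / a) ^ 2, by positivity, fun T hT hJ ν hν W A hA hW => ?_⟩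
  obtain ⟨⟨z, hz, hzs⟩, -⟩ := hT
  have hh := T.size_pos hd
  set U := Metric.ball z (c / 2 * T.size) with hU
  have hUT : U ⊆ T.carrier := T.ball_subset_carrier hc hzs
  have hlow : ∀ x ∈ U, a ≤ polyFun (T.bubble ν) x * polyFun (T.lamPoly ν) x := fun x hx =>
    T.pow_le_bubble_mul (by positivity) (by linarith) hJ hν fun μ hμ => by
      rw [polyFun_lamPoly, le_div_iff₀ hh]
      exact T.half_le_slack hμ (hzs μ hμ) hx
  have hpos : ∀ p : Poly d, a * ∫ x in U, polyFun p x ^ 2 ≤ ∫ x in T.carrier,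
      (polyFun (T.bubble ν) x * polyFun (T.lamPoly ν) x) * (polyFun p x * polyFun p x) :=
    fun p => by
      rw [← integral_const_mul]
      have hi : IntegrableOn (fun x => (polyFun (T.bubble ν) x * polyFun (T.lamPoly ν) x) *
        (polyFun p x * polyFun p x)) T.carrier := T.integrableOn_carrier (by fun_prop)
      refine (setIntegral_mono_on ?_ (hi.mono_set hUT) Metric.isOpen_ball.measurableSet
        fun x hx => ?_).trans (setIntegral_mono_set hi ?_ hUT.eventuallyLE)
      · exact integratesContinuous_restrict Metric.isBounded_ball _ (by fun_prop)
      · rw [← sq]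
        exact mul_le_mul_of_nonneg_right (hlow x hx) (sq_nonneg _)
      · filter_upwards [ae_restrict_mem T.measurableSet_carrier] with x hx
        exact mul_nonneg (mul_nonneg (T.bubble_nonneg ν hx) (T.lamPoly_nonneg hν hx))
          (mul_self_nonneg _)
  have hμ := T.integratesContinuous_carrier
  -- Orthogonality of `bubble * (W + lamPoly * r)` to `P_m` is a linear system for `r` whose form
  -- has weight `bubble * lamPoly`, nonnegative on `T` and at least `a` on `U`, hence definite.
  let b := (polyForm _ hμ (fun x => polyFun (T.bubble ν) x * polyFun (T.lamPoly ν) x)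
    (by fun_prop)).domRestrict₁₂ (polySpace d m) (polySpace d m)
  let F : polySpace d m →ₗ[ℝ] ℝ :=
    -(polyForm _ hμ (fun x => polyFun (T.bubble ν) x) (by fun_prop) W).domRestrict (polySpace d m)
  obtain ⟨r, hr⟩ := exists_repr_of_definite b (fun p hp => by
    have h1 := hpos p.1
    have h2 : ∫ x in T.carrier, (polyFun (T.bubble ν) x * polyFun (T.lamPoly ν) x) *
      (polyFun p.1 x * polyFun p.1 x) = 0 := hp
    rw [h2] at h1
    have h3 : 0 ≤ ∫ x in U, polyFun p.1 x ^ 2 := integral_nonneg fun x => sq_nonneg _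
    refine Subtype.ext (eq_zero_of_integral_sq_eq_zero (s := U)
      (integratesContinuous_restrict Metric.isBounded_ball _ (by fun_prop)) ?_ ?_)
    · rw [Metric.isOpen_ball.interior_eq]
      exact ⟨z, Metric.mem_ball_self (by positivity)⟩
    · nlinarith) F
  replace hr : ∀ s ∈ polySpace d m, ∫ x in T.carrier,
      (polyFun (T.bubble ν) x * polyFun (T.lamPoly ν) x) * (polyFun r.1 x * polyFun s x) =
      -∫ x in T.carrier, polyFun (T.bubble ν) x * (polyFun W x * polyFun s x) :=
    fun s hs => hr ⟨s, hs⟩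
  refine ⟨r.1, r.2, fun s hs => ?_, ?_⟩
  · have h1 := hr s hs
    rw [eq_neg_iff_add_eq_zero, ← integral_add (T.integrableOn_carrier (by fun_prop))
      (T.integrableOn_carrier (by fun_prop))] at h1
    rw [← h1]
    congr 1; ext x
    simp only [polyFun_add, polyFun_mul]; ring
  · set R := ∫ x in U, polyFun r.1 x ^ 2 with hR
    have hR0 : 0 ≤ R := integral_nonneg fun x => sq_nonneg _
    have hsup : ∀ x ∈ T.carrier, polyFun r.1 x ^ 2 ≤ C * R / T.size ^ d := fun x hx => by
      rw [le_div_iff₀ (by positivity)]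
      exact H T z hz r.1 r.2 x hx
    have h1 : a * R ≤ -∫ x in T.carrier, polyFun (T.bubble ν) x * (polyFun W x * polyFun r.1 x) :=
      (hpos r.1).trans_eq (hr r.1 r.2)
    rw [← integral_neg] at h1
    -- With this Young weight the term in `R` on the right is exactly `a * R / 2` and is absorbed.
    set t := a / (C * ω) with ht
    have ht0 : 0 < t := by positivity
    have h2 : a * R ≤ ((t * (C * R / T.size ^ d) + A / t) / 2) * (ω * T.size ^ d) := by
      refine h1.trans (setIntegral_le_mul_of_le T.measurableSet_carrier T.volume_ne_top
        (T.integrableOn_carrier (by fun_prop)) (by positivity) (fun x hx => ?_)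
        (T.volume_le.trans (by gcongr; simp [ω])))
      have hb0 := T.bubble_nonneg ν hx
      have hb1 := T.bubble_le_one hd ν hx
      have hx1 := hsup x hx
      have hx2 := hW x hx
      set w := polyFun W x
      set ρ := polyFun r.1 x
      have h3 : |w * ρ| ≤ (t * ρ ^ 2 + w ^ 2 / t) / 2 := by
        have h4 : t * ρ ^ 2 + w ^ 2 / t = ((t * |ρ|) ^ 2 + |w| ^ 2) / t := by
          rw [mul_pow, sq_abs, sq_abs]; field_simp
        rw [h4, abs_mul, div_div, le_div_iff₀ (by positivity)]
        nlinarith [sq_nonneg (t * |ρ| - |w|)]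
      calc -(polyFun (T.bubble ν) x * (w * ρ)) ≤ |polyFun (T.bubble ν) x * (w * ρ)| :=
            neg_le_abs _
        _ ≤ |w * ρ| := by
            rw [abs_mul, abs_of_nonneg hb0]
            exact mul_le_of_le_one_left (abs_nonneg _) hb1
        _ ≤ (t * ρ ^ 2 + w ^ 2 / t) / 2 := h3
        _ ≤ _ := by gcongr
    have h5 : R ≤ A * T.size ^ d * (C * ω ^ 2 / a ^ 2) := by
      have h6 : ((t * (C * R / T.size ^ d) + A / t) / 2) * (ω * T.size ^ d) =
          a * R / 2 + A * T.size ^ d * (C * ω ^ 2 / a) / 2 := by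
        rw [ht]; field_simp
      rw [h6] at h2
      have h7 : a * R ≤ A * T.size ^ d * (C * ω ^ 2 / a) := by linarith
      calc R = a * R / a := by field_simp
        _ ≤ A * T.size ^ d * (C * ω ^ 2 / a) / a := by gcongr
        _ = _ := by field_simp
    intro x hx
    calc polyFun r.1 x ^ 2 ≤ C * R / T.size ^ d := hsup x hx
      _ ≤ C * (A * T.size ^ d * (C * ω ^ 2 / a ^ 2)) / T.size ^ d := by gcongr
      _ = _ := by field_simp

/-- The test field attached to a facet: a polynomial field orthogonal to the fields of degree
`k - 1`, with vanishing normal component on the other facets, which detects the `L²` norm of `p`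
on the facet. -/
lemma exists_test_field (hd : 2 ≤ d) {k : ℕ} (hk : 1 ≤ k) (J : ℕ) (hc : 0 < c) (hc1 : c ≤ 1) :
    ∃ C, 0 < C ∧ ∀ T : ConvexPolytope d, T.IsFat c → T.normals.card ≤ J → ∀ ν ∈ T.normals,
      ∀ p ∈ polySpace d (k - 1), ∃ q : Fin d → Poly d,
        (∀ l, q l ∈ polySpace d (T.normals.card + k - 1)) ∧
        (∀ g : Fin d → Poly d, (∀ l, g l ∈ polySpace d (k - 1)) →
          ∫ x in T.carrier, vecFun g x ⬝ᵥ vecFun q x = 0) ∧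
        (∀ μ ∈ T.normals, μ ≠ ν → ∀ x ∈ T.facet μ, vecFun q x ⬝ᵥ μ.ofLp = 0) ∧
        (∫ x in T.facet ν, polyFun p x ^ 2 ∂μHE[d - 1] ≤
          C * ∫ x in T.facet ν, polyFun p x * (vecFun q x ⬝ᵥ ν.ofLp) ∂μHE[d - 1]) ∧
        ∫ x in T.carrier, vecFun q x ⬝ᵥ vecFun q x ≤
          C * T.size * ∫ x in T.facet ν, polyFun p x ^ 2 ∂μHE[d - 1] := by
  obtain ⟨C₁, hC₁, H₁⟩ := exists_sq_proj_le_integral hd (k - 1) hc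
  obtain ⟨C₂, hC₂, H₂⟩ := exists_correction hd (k - 1) J hc hc1
  -- On the half-radius ball in the facet the bubble is at least `a`; the distance to the facet's
  -- own hyperplane is not among its factors.
  set a := (c / 2) ^ J with ha
  have ha0 : 0 < a := by positivity
  set ω := unitBallVolume d + 1
  set ω' := unitBallVolume (d - 1) + 1
  have hω : 0 < ω := by positivity
  have hω' : 0 < ω' := by positivity
  refine ⟨ω' * C₁ / a + (2 * C₁ + 2 * (C₂ * C₁)) * ω, by positivity,
    fun T hT hJ ν hν p hp => ?_⟩
  have hh := T.size_pos hd
  have hνν := dotProduct_self_ofLp (T.norm_eq_one ν hν)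
  have hpow : T.size ^ d = T.size * T.size ^ (d - 1) := by
    rw [← pow_succ']; congr 1; omega
  obtain ⟨φ⟩ := exists_hyperplaneChart (by omega) (T.norm_eq_one ν hν) (T.offset ν)
  obtain ⟨x₀, hx₀, hx₀s⟩ := hT.2 ν hν
  set U := Metric.ball (φ.proj x₀) (c / 2 * T.size) with hUdef
  have hslackU : ∀ y ∈ U, ∀ μ ∈ T.normals, μ ≠ ν → c / 2 * T.size ≤ T.slack μ (φ.map y) :=
    fun y hy μ hμ hne => T.half_le_slack hμ (hx₀s μ hμ hne) (by
      rw [← T.map_proj φ hx₀, φ.map.dist_map]; exact hy)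
  have hUf : U ⊆ φ.map ⁻¹' T.facet ν := fun y hy => T.mem_facet.2 ⟨T.mem_carrier.2 fun μ hμ => by
    by_cases h : μ = ν
    · rw [h, T.slack_map φ]
    · exact (by positivity : 0 ≤ c / 2 * T.size).trans (hslackU y hy μ hμ h), T.slack_map φ y⟩
  set N := ∫ x in T.facet ν, polyFun p x ^ 2 ∂μHE[d - 1] with hN
  have hN0 : 0 ≤ N := integral_nonneg fun x => sq_nonneg _
  set N' := ∫ y in U, polyFun p (φ.map y) ^ 2 with hN'
  have hint : ∀ {f : Pt (d - 1) → ℝ}, Continuous f → IntegrableOn f (φ.map ⁻¹' T.facet ν) :=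
    fun hf => integratesContinuous_restrict (T.isBounded_preimage_facet φ) _ hf
  have hφc : Continuous φ.map := φ.map.continuous
  have hN'N : N' ≤ N := by
    rw [hN, T.setIntegral_facet φ]
    exact setIntegral_mono_set (hint (by fun_prop))
      (Filter.Eventually.of_forall fun y => sq_nonneg _) hUf.eventuallyLE
  have hNN' : N ≤ ω' * C₁ * N' := by
    have h1 := setIntegral_le_mul_of_le (T.measurableSet_facet ν)
      (T.measure_facet_ne_top (by omega) hν)
      (T.integrableOn_facet (f := fun x => polyFun p x ^ 2) (by omega) hν (by fun_prop))
      (M := C₁ * N' / T.size ^ (d - 1))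
      (by have : 0 ≤ N' := integral_nonneg fun x => sq_nonneg _
          positivity) (fun x hx => by
        rw [le_div_iff₀ (by positivity)]
        have := H₁ T ν hν φ x₀ hx₀ p hp x hx.1
        rwa [T.map_proj φ hx] at this)
      ((T.measure_facet_le hd hν).trans
        (by gcongr; simp [ω'] : _ ≤ ω' * T.size ^ (d - 1)))
    refine h1.trans_eq ?_
    field_simp
  -- `W` extends `p` from the facet through the affine retraction onto its hyperplane. It agrees
  -- with `p` on the facet, keeps the degree, and is bounded on the cell because the retraction does
  -- not increase distances.
  obtain ⟨W, hW, hWx⟩ := exists_polyFun_comp hp (φ.map.toAffineMap.comp φ.proj)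
  replace hWx : ∀ x, polyFun W x = polyFun p (φ.map (φ.proj x)) := hWx
  set A := C₁ * N / T.size ^ (d - 1) with hA
  have hWA : ∀ x ∈ T.carrier, polyFun W x ^ 2 ≤ A := fun x hx => by
    rw [hA, le_div_iff₀ (by positivity), hWx]
    exact (H₁ T ν hν φ x₀ hx₀ p hp x hx).trans (by gcongr)
  obtain ⟨r, hr, hrorth, hrbound⟩ := H₂ T hT hJ ν hν W A (by positivity) hWA
  set Q := T.bubble ν * (W + T.lamPoly ν * r) with hQ
  -- The bubble has degree at most `n_T - 1` and `W + lamPoly * r` degree at most `k`, which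
  -- accounts for the requirement on `j_T`.
  have hQmem : Q ∈ polySpace d (T.normals.card + k - 1) := by
    have hcard : 1 ≤ T.normals.card := Finset.card_pos.2 ⟨ν, hν⟩
    have h1 : W + T.lamPoly ν * r ∈ polySpace d k :=
      Submodule.add_mem _ (polySpace_mono (by omega) hW)
        (polySpace_mono (by omega) (mul_mem_polySpace (T.lamPoly_mem ν) hr))
    exact polySpace_mono (by omega) (mul_mem_polySpace (T.bubble_mem hν) h1)
  have hq : ∀ x, vecFun (fun l => MvPolynomial.C (ν l) * Q) x = polyFun Q x • ν.ofLp := fun x => by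
    ext l; simp [vecFun, mul_comm]
  refine ⟨fun l => MvPolynomial.C (ν l) * Q, fun l => ?_, fun g hg => ?_, fun μ hμ hne x hx => ?_,
    ?_, ?_⟩
  · simpa using mul_mem_polySpace (C_mem_polySpace (ν l) 0) hQmem
  · rw [← hrorth _ (normalPoly_mem hg ν)]
    congr 1; ext x
    rw [hq, dotProduct_smul, polyFun_normalPoly, hQ, polyFun_mul, smul_eq_mul, mul_assoc]
  · rw [hq, hQ, polyFun_mul, T.bubble_eq_zero hμ hne hx]; simp
  · have h1 : ∫ x in T.facet ν, polyFun p x *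
        (vecFun (fun l => MvPolynomial.C (ν l) * Q) x ⬝ᵥ ν.ofLp) ∂μHE[d - 1] =
        ∫ x in T.facet ν, polyFun (T.bubble ν) x * polyFun p x ^ 2 ∂μHE[d - 1] :=
      setIntegral_congr_fun (T.measurableSet_facet ν) fun x hx => by
        rw [hq, smul_dotProduct, hνν, hQ, polyFun_mul, polyFun_add, hWx, T.map_proj φ hx,
          polyFun_mul, polyFun_lamPoly, (T.mem_facet.1 hx).2, smul_eq_mul]
        ring
    -- The weight is nonnegative on the facet and at least `a` on the ball `U`, whose integral `N'`
    -- already controls the full norm `N`.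
    have h2 : a * N' ≤ ∫ x in T.facet ν, polyFun (T.bubble ν) x * polyFun p x ^ 2 ∂μHE[d - 1] := by
      rw [T.setIntegral_facet φ, hN', ← integral_const_mul]
      have hi : IntegrableOn (fun y => polyFun (T.bubble ν) (φ.map y) * polyFun p (φ.map y) ^ 2)
        (φ.map ⁻¹' T.facet ν) := hint (by fun_prop)
      refine (setIntegral_mono_on ?_ (hi.mono_set hUf) Metric.isOpen_ball.measurableSet
        fun y hy => ?_).trans (setIntegral_mono_set hi ?_ hUf.eventuallyLE)
      · exact integratesContinuous_restrict Metric.isBounded_ball _ (by fun_prop)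
      · refine mul_le_mul_of_nonneg_right ?_ (sq_nonneg _)
        refine T.pow_le_bubble (by positivity) (by linarith) hJ fun μ hμ hne => ?_
        rw [polyFun_lamPoly, le_div_iff₀ hh]
        exact hslackU y hy μ hμ hne
      · filter_upwards [ae_restrict_mem ((T.measurableSet_facet ν).preimage hφc.measurable)]
          with y hy
        exact mul_nonneg (T.bubble_nonneg ν hy.1) (sq_nonneg _)
    rw [h1]
    set I := ∫ x in T.facet ν, polyFun (T.bubble ν) x * polyFun p x ^ 2 ∂μHE[d - 1]
    have hI : 0 ≤ I := (mul_nonneg ha0.le (integral_nonneg fun x => sq_nonneg _)).trans h2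
    calc N ≤ ω' * C₁ * N' := hNN'
      _ = ω' * C₁ / a * (a * N') := by field_simp
      _ ≤ ω' * C₁ / a * I := by gcongr
      _ ≤ _ := by
        refine mul_le_mul_of_nonneg_right ?_ hI
        linarith [show 0 < (2 * C₁ + 2 * (C₂ * C₁)) * ω by positivity]
  · have h1 := setIntegral_le_mul_of_le T.measurableSet_carrier T.volume_ne_top
      (T.integrableOn_carrier
        (f := fun x => vecFun (fun l => MvPolynomial.C (ν l) * Q) x ⬝ᵥ
          vecFun (fun l => MvPolynomial.C (ν l) * Q) x) (by fun_prop))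
      (M := 2 * A + 2 * (C₂ * A)) (by positivity) (fun x hx => by
        rw [hq, dotProduct_smul, smul_dotProduct, hνν, smul_eq_mul, smul_eq_mul, mul_one, hQ,
          polyFun_mul, polyFun_add, polyFun_mul]
        have hb0 := T.bubble_nonneg ν hx
        have hb1 := T.bubble_le_one hd ν hx
        have hl0 := T.lamPoly_nonneg hν hx
        have hl1 := T.lamPoly_le_one hd hν hx
        have hw := hWA x hx
        have hρ := hrbound x hx
        set β := polyFun (T.bubble ν) x
        set l := polyFun (T.lamPoly ν) x
        set w := polyFun W x
        set ρ := polyFun r x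
        calc β * (w + l * ρ) * (β * (w + l * ρ)) = β ^ 2 * (w + l * ρ) ^ 2 := by ring
          _ ≤ 1 * (w + l * ρ) ^ 2 := by gcongr; exact pow_le_one₀ hb0 hb1
          _ ≤ 2 * w ^ 2 + 2 * (l ^ 2 * ρ ^ 2) := by nlinarith [sq_nonneg (w - l * ρ)]
          _ ≤ 2 * w ^ 2 + 2 * (1 * ρ ^ 2) := by gcongr; exact pow_le_one₀ hl0 hl1
          _ ≤ _ := by rw [one_mul]; gcongr)
      (T.volume_le.trans (by gcongr; simp [ω] : _ ≤ ω * T.size ^ d))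
    refine h1.trans ?_
    calc (2 * A + 2 * (C₂ * A)) * (ω * T.size ^ d)
        = (2 * C₁ + 2 * (C₂ * C₁)) * ω * T.size * N := by
          rw [hA, hpow]; field_simp
      _ ≤ _ := by
        gcongr
        linarith [show 0 < ω' * C₁ / a by positivity]

end ConvexPolytope

/-! ### Local norm equivalence -/

lemma abs_integral_mul_le {X : Type*} [MeasurableSpace X] {μ : Measure X} {f g : X → ℝ}
    (hf : Integrable (fun x => f x ^ 2) μ) (hg : Integrable (fun x => g x ^ 2) μ) {t : ℝ}
    (ht : 0 < t) :
    |∫ x, f x * g x ∂μ| ≤ (t * (∫ x, f x ^ 2 ∂μ) + t⁻¹ * ∫ x, g x ^ 2 ∂μ) / 2 := by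
  have h : ∫ x, (t * f x ^ 2 + t⁻¹ * g x ^ 2) / 2 ∂μ =
      (t * (∫ x, f x ^ 2 ∂μ) + t⁻¹ * ∫ x, g x ^ 2 ∂μ) / 2 := by
    rw [integral_div, integral_add (hf.const_mul t) (hg.const_mul _), integral_const_mul,
      integral_const_mul]
  rw [← h, ← Real.norm_eq_abs]
  refine norm_integral_le_of_norm_le (((hf.const_mul t).add (hg.const_mul _)).div_const 2)
    (Filter.Eventually.of_forall fun x => ?_)
  have h4 : t * f x ^ 2 + t⁻¹ * g x ^ 2 = ((t * |f x|) ^ 2 + |g x| ^ 2) / t := by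
    rw [mul_pow, sq_abs, sq_abs]; field_simp
  rw [h4, Real.norm_eq_abs, abs_mul, div_div, le_div_iff₀ (by positivity)]
  nlinarith [sq_nonneg (t * |f x| - |g x|)]

lemma integral_dotProduct_le (T : ConvexPolytope d) (G H : Fin d → Poly d) {t : ℝ} (ht : 0 < t) :
    ∫ x in T.carrier, vecFun G x ⬝ᵥ vecFun H x ≤
      (t * (∫ x in T.carrier, vecFun G x ⬝ᵥ vecFun G x) +
        t⁻¹ * ∫ x in T.carrier, vecFun H x ⬝ᵥ vecFun H x) / 2 := by
  have hi : ∀ {f : Pt d → ℝ}, Continuous f → IntegrableOn f T.carrier := T.integrableOn_carrier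
  rw [← integral_const_mul, ← integral_const_mul, ← integral_add (hi (by fun_prop))
    (hi (by fun_prop)), ← integral_div]
  refine setIntegral_mono_on (hi (by fun_prop)) (hi (by fun_prop)) T.measurableSet_carrier
    fun x _ => ?_
  simp only [dotProduct, Finset.mul_sum, ← Finset.sum_add_distrib, Finset.sum_div]
  refine Finset.sum_le_sum fun l _ => ?_
  rw [le_div_iff₀ two_pos]
  have h : t * (vecFun G x l * vecFun G x l) + t⁻¹ * (vecFun H x l * vecFun H x l) -
      vecFun G x l * vecFun H x l * 2 = t⁻¹ * (t * vecFun G x l - vecFun H x l) ^ 2 := by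
    field_simp; ring
  have h2 : 0 ≤ t⁻¹ * (t * vecFun G x l - vecFun H x l) ^ 2 := by positivity
  linarith

/-- Here `g`, `G` and `p` stand for the classical gradient, the weak gradient and the projected
jump. Testing with the fields of `exists_test_field` bounds the jumps by `G` alone; testing with `G`
and with `g` then compares the two gradients up to jumps. -/
lemma exists_local_bounds (hd : 2 ≤ d) {k : ℕ} (hk : 1 ≤ k) (J : ℕ) {c : ℝ} (hc : 0 < c) :
    ∃ C, 0 < C ∧ ∀ T : ConvexPolytope d, T.IsFat c → ∀ j, T.normals.card + k - 1 ≤ j → j ≤ J →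
      ∀ (g G : Fin d → Poly d) (p : Pt d → Poly d), (∀ l, g l ∈ polySpace d (k - 1)) →
      (∀ l, G l ∈ polySpace d j) → (∀ ν ∈ T.normals, p ν ∈ polySpace d (k - 1)) →
      (∀ q : Fin d → Poly d, (∀ l, q l ∈ polySpace d j) →
        ∫ x in T.carrier, vecFun G x ⬝ᵥ vecFun q x =
          (∫ x in T.carrier, vecFun g x ⬝ᵥ vecFun q x) + ∑ ν ∈ T.normals,
            ∫ x in T.facet ν, polyFun (p ν) x * (vecFun q x ⬝ᵥ ν.ofLp) ∂μHE[d - 1]) →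
      (∫ x in T.carrier, vecFun G x ⬝ᵥ vecFun G x) ≤
        C * ((∫ x in T.carrier, vecFun g x ⬝ᵥ vecFun g x) + T.size⁻¹ *
          ∑ ν ∈ T.normals, ∫ x in T.facet ν, polyFun (p ν) x ^ 2 ∂μHE[d - 1]) ∧
      (∫ x in T.carrier, vecFun g x ⬝ᵥ vecFun g x) + T.size⁻¹ *
          (∑ ν ∈ T.normals, ∫ x in T.facet ν, polyFun (p ν) x ^ 2 ∂μHE[d - 1]) ≤
        C * ∫ x in T.carrier, vecFun G x ⬝ᵥ vecFun G x := by
  obtain ⟨C₁, hC₁, H₁⟩ := ConvexPolytope.exists_normal_trace_bound hd J hc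
  obtain ⟨C₂, hC₂, H₂⟩ := ConvexPolytope.exists_test_field hd hk J (lt_min hc one_pos)
    (min_le_right c 1)
  -- The Young weight makes the boundary terms of all facets, at most `J` in number, cost together
  -- no more than a quarter of the squared norm of the test field.
  set t := 2 * C₁ * (J + 1) with ht
  have ht0 : 0 < t := by positivity
  refine ⟨2 + t + (t + 1) * (J * C₂ ^ 3), by positivity,
    fun T hT j hj hjJ g G p hg hG hp hrel => ?_⟩
  have hh := T.size_pos hd
  have hJ : T.normals.card ≤ J := by omega
  have hgj : ∀ l, g l ∈ polySpace d J := fun l => polySpace_mono (by omega) (hg l)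
  have hgj' : ∀ l, g l ∈ polySpace d j := fun l => polySpace_mono (by omega) (hg l)
  set A := ∫ x in T.carrier, vecFun G x ⬝ᵥ vecFun G x with hA
  set B := ∫ x in T.carrier, vecFun g x ⬝ᵥ vecFun g x with hB
  set S := ∑ ν ∈ T.normals, ∫ x in T.facet ν, polyFun (p ν) x ^ 2 ∂μHE[d - 1] with hS
  have hnn : ∀ H : Fin d → Poly d, 0 ≤ ∫ x in T.carrier, vecFun H x ⬝ᵥ vecFun H x := fun H =>
    integral_nonneg fun x => Finset.sum_nonneg fun l _ => mul_self_nonneg _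
  have hA0 : 0 ≤ A := hnn G
  have hB0 : 0 ≤ B := hnn g
  have hS0 : 0 ≤ S := Finset.sum_nonneg fun ν _ => integral_nonneg fun x => sq_nonneg _
  have hif : ∀ {ν}, ν ∈ T.normals → ∀ {f : Pt d → ℝ}, Continuous f →
      IntegrableOn f (T.facet ν) μHE[d - 1] := fun hν => T.integrableOn_facet (by omega) hν
  -- the boundary term
  have hbd : ∀ H : Fin d → Poly d, (∀ l, H l ∈ polySpace d J) →
      |∑ ν ∈ T.normals, ∫ x in T.facet ν, polyFun (p ν) x * (vecFun H x ⬝ᵥ ν.ofLp) ∂μHE[d - 1]| ≤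
        t / 2 * (T.size⁻¹ * S) + (∫ x in T.carrier, vecFun H x ⬝ᵥ vecFun H x) / 4 := by
    intro H hH
    set D := ∫ x in T.carrier, vecFun H x ⬝ᵥ vecFun H x
    have hD : 0 ≤ D := hnn H
    have h1 : ∀ ν ∈ T.normals,
        |∫ x in T.facet ν, polyFun (p ν) x * (vecFun H x ⬝ᵥ ν.ofLp) ∂μHE[d - 1]| ≤
        t / 2 * (T.size⁻¹ * ∫ x in T.facet ν, polyFun (p ν) x ^ 2 ∂μHE[d - 1]) +
          D / (4 * (J + 1)) := fun ν hν => by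
      refine (abs_integral_mul_le (hif hν (by fun_prop)) (hif hν (by fun_prop))
        (show 0 < t / T.size by positivity)).trans ?_
      have h2 := H₁ T hT ν hν H hH
      set N := ∫ x in T.facet ν, polyFun (p ν) x ^ 2 ∂μHE[d - 1]
      set K := ∫ x in T.facet ν, (vecFun H x ⬝ᵥ ν.ofLp) ^ 2 ∂μHE[d - 1]
      calc (t / T.size * N + (t / T.size)⁻¹ * K) / 2
          = t / 2 * (T.size⁻¹ * N) + t⁻¹ / 2 * (T.size * K) := by field_simp
        _ ≤ t / 2 * (T.size⁻¹ * N) + t⁻¹ / 2 * (C₁ * D) := by gcongr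
        _ = _ := by rw [ht]; field_simp; ring
    refine (Finset.abs_sum_le_sum_abs _ _).trans ((Finset.sum_le_sum h1).trans ?_)
    rw [Finset.sum_add_distrib, ← Finset.mul_sum, ← Finset.mul_sum, Finset.sum_const, nsmul_eq_mul]
    gcongr
    calc (T.normals.card : ℝ) * (D / (4 * (J + 1))) ≤ (J + 1) * (D / (4 * (J + 1))) := by
          gcongr
          have : (T.normals.card : ℝ) ≤ J := by exact_mod_cast hJ
          linarith
      _ = D / 4 := by field_simp
  -- the jumps are bounded by the weak gradient
  have hjump : T.size⁻¹ * S ≤ J * C₂ ^ 3 * A := by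
    have h1 : ∀ ν ∈ T.normals, ∫ x in T.facet ν, polyFun (p ν) x ^ 2 ∂μHE[d - 1] ≤
        C₂ ^ 3 * T.size * A := fun ν hν => by
      obtain ⟨q, hq, hq0, hqμ, hqν, hqn⟩ :=
        H₂ T (hT.mono (min_le_left _ _)) hJ ν hν (p ν) (hp ν hν)
      have h2 := hrel q fun l => polySpace_mono hj (hq l)
      rw [hq0 g hg, zero_add, Finset.sum_eq_single_of_mem ν hν (fun μ hμ hne => by
        rw [setIntegral_congr_fun (g := fun _ => 0) (T.measurableSet_facet μ) (fun x hx => by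
          simp only [hqμ μ hμ hne x hx, mul_zero])]
        simp)] at h2
      rw [← h2] at hqν
      -- As `‖q‖²` is at most `C₂ * T.size * N`, the weight `C₂ ^ 2 * T.size` leaves `N / 2` on the
      -- right, to be absorbed.
      have h3 := integral_dotProduct_le T G q (show 0 < C₂ ^ 2 * T.size by positivity)
      set N := ∫ x in T.facet ν, polyFun (p ν) x ^ 2 ∂μHE[d - 1]
      set K := ∫ x in T.carrier, vecFun q x ⬝ᵥ vecFun q x
      have h4 : N ≤ C₂ * ((C₂ ^ 2 * T.size * A + (C₂ ^ 2 * T.size)⁻¹ * (C₂ * T.size * N)) / 2) := by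
        refine hqν.trans ?_
        gcongr
        refine h3.trans ?_
        gcongr
      have h5 : C₂ * ((C₂ ^ 2 * T.size * A + (C₂ ^ 2 * T.size)⁻¹ * (C₂ * T.size * N)) / 2) =
          C₂ ^ 3 * T.size * A / 2 + N / 2 := by field_simp
      rw [h5] at h4
      linarith
    calc T.size⁻¹ * S ≤ T.size⁻¹ * (T.normals.card * (C₂ ^ 3 * T.size * A)) := by
          gcongr
          exact (Finset.sum_le_sum h1).trans_eq (by simp)
      _ ≤ T.size⁻¹ * (J * (C₂ ^ 3 * T.size * A)) := by gcongr
      _ = _ := by field_simp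
  have hsS : 0 ≤ T.size⁻¹ * S := by positivity
  have hJC : 0 ≤ (J : ℝ) * C₂ ^ 3 := by positivity
  -- With `s = T.size⁻¹ * S`, testing with `G` gives `A ≤ (B + A / 4) + (t / 2 * s + A / 4)`;
  -- testing with `g` gives the same with `A` and `B` exchanged.
  have e1 := hrel G hG
  have e2 := hrel g hgj'
  have b1 := (abs_le.1 (hbd G fun l => polySpace_mono hjJ (hG l))).2
  have b2 := (abs_le.1 (hbd g hgj)).1
  have i1 := integral_dotProduct_le T g G two_pos
  have i2 := integral_dotProduct_le T G g two_pos
  rw [← hA] at e1 b1 i1 i2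
  rw [← hB] at e2 b2 i1 i2
  constructor
  · have : A ≤ 2 * B + t * (T.size⁻¹ * S) := by linarith
    have h3 : 0 ≤ (t + 1) * (J * C₂ ^ 3) := by positivity
    nlinarith [mul_nonneg h3 hB0, mul_nonneg h3 hsS, mul_nonneg ht0.le hB0]
  · have : B ≤ 2 * A + t * (T.size⁻¹ * S) := by linarith
    have h6 : t * (T.size⁻¹ * S) ≤ t * (J * C₂ ^ 3 * A) := by gcongr
    nlinarith [mul_nonneg ht0.le hA0]

/-! ### The energy form -/

section Elliptic

variable {Ω : Set (Pt d)} {a : Pt d → Matrix (Fin d) (Fin d) ℝ} {lam₁ lam₂ : ℝ}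

/-- Polarization: the quadratic form at the sum and difference of two coordinate vectors determines
the off-diagonal entry. The bound makes the energy integrand integrable. -/
lemma IsEllipticTensor.abs_apply_le (ha : IsEllipticTensor Ω a lam₁ lam₂) (h₁ : 0 < lam₁)
    {x : Pt d} (hx : x ∈ Ω) (l m : Fin d) : |a x l m| ≤ lam₂ := by
  set u : Fin d → ℝ := Pi.single l 1
  set w : Fin d → ℝ := Pi.single m 1
  have hu : u ⬝ᵥ u = 1 := by simp [u]
  have hw : w ⬝ᵥ w = 1 := by simp [w]
  have hsymm : a x m l = a x l m := (ha.symm x hx).apply l m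
  have hlm : u ⬝ᵥ (a x *ᵥ w) = a x l m := by simp [u, w]
  have hml : w ⬝ᵥ (a x *ᵥ u) = a x l m := by simp [u, w, hsymm]
  have hn : ∀ ξ : Fin d → ℝ, 0 ≤ ξ ⬝ᵥ ξ := fun ξ =>
    Finset.sum_nonneg fun l _ => mul_self_nonneg _
  have hp := ha.upper x hx (u + w)
  have hm := ha.upper x hx (u - w)
  have hp' := (mul_nonneg h₁.le (hn (u + w))).trans (ha.lower x hx (u + w))
  have hm' := (mul_nonneg h₁.le (hn (u - w))).trans (ha.lower x hx (u - w))
  have hnp := hn (u + w)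
  have hnm := hn (u - w)
  simp only [mulVec_add, mulVec_sub, dotProduct_add, add_dotProduct, dotProduct_sub,
    sub_dotProduct, hu, hw, hlm, hml, dotProduct_comm w u] at hp hm hp' hm' hnp hnm
  rw [abs_le]
  constructor <;> nlinarith

namespace PolytopalMesh

variable (M : PolytopalMesh d Ω)

lemma interior_cell_subset (i : Fin M.numCells) : interior (M.cell i).carrier ⊆ Ω := by
  conv_rhs => rw [M.domain_eq]
  exact interior_mono (Set.subset_iUnion_of_subset i subset_rfl)

lemma interior_ae_eq_carrier (T : ConvexPolytope d) :
    (interior T.carrier : Set (Pt d)) =ᵐ[volume] T.carrier :=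
  interior_ae_eq_of_null_frontier (T.convex_carrier.addHaar_frontier volume)

lemma restrict_carrier (T : ConvexPolytope d) :
    (volume : Measure (Pt d)).restrict T.carrier = volume.restrict (interior T.carrier) :=
  (Measure.restrict_congr_set (interior_ae_eq_carrier T)).symm

/-- The tensor is controlled only on the open set `Ω`, and boundary points of a cell may lie outside
it; the boundary of a convex set is null. -/
lemma ae_mem_domain (i : Fin M.numCells) :
    ∀ᵐ x ∂((volume : Measure (Pt d)).restrict (M.cell i).carrier), x ∈ Ω := by
  rw [restrict_carrier]
  filter_upwards [ae_restrict_mem isOpen_interior.measurableSet] with x hx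
  exact M.interior_cell_subset i hx

lemma integrableOn_energy (ha : IsEllipticTensor Ω a lam₁ lam₂) (h₁ : 0 < lam₁)
    (i : Fin M.numCells) (G H : Fin d → Poly d) :
    IntegrableOn (fun x => (a x *ᵥ vecFun G x) ⬝ᵥ vecFun H x) (M.cell i).carrier := by
  have h : (fun x => (a x *ᵥ vecFun G x) ⬝ᵥ vecFun H x) =
      fun x => ∑ l, ∑ m, a x l m * (vecFun G x m * vecFun H x l) := by
    ext x
    simp only [dotProduct, mulVec, Finset.sum_mul, mul_assoc]
  rw [h]
  refine integrable_finsetSum _ fun l _ => integrable_finsetSum _ fun m _ => ?_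
  refine Integrable.bdd_mul (c := lam₂)
    ((M.cell i).integrableOn_carrier (by unfold vecFun; fun_prop)) ?_ ?_
  · rw [restrict_carrier]
    exact ((ha.measurable l m).mono_set (M.interior_cell_subset i)).aestronglyMeasurable
  · filter_upwards [M.ae_mem_domain i] with x hx
    exact ha.abs_apply_le h₁ hx l m

/-- The squared `L²` norm of the weak gradient on a cell. -/
def gradSq (k : ℕ) (j : Fin M.numCells → ℕ) (v : M.WeakFunction) (i : Fin M.numCells) : ℝ :=
  ∫ x in (M.cell i).carrier, vecFun (M.weakGrad k j v i) x ⬝ᵥ vecFun (M.weakGrad k j v i) x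

/-- The contribution of a cell to the squared discrete `H¹` norm. -/
def discreteSq (k : ℕ) (v : M.WeakFunction) (i : Fin M.numCells) : ℝ :=
  (∫ x in (M.cell i).carrier, vecFun (grad (v.1 i)) x ⬝ᵥ vecFun (grad (v.1 i)) x) +
      (M.cell i).size⁻¹ *
        ∑ ν ∈ (M.cell i).normals,
          ∫ x in (M.cell i).facet ν, (M.edgeJump k v i ν x) ^ 2 ∂μHE[d - 1]

lemma energyForm_self_bounds (ha : IsEllipticTensor Ω a lam₁ lam₂) (h₁ : 0 < lam₁)
    (k : ℕ) (j : Fin M.numCells → ℕ) (v : M.WeakFunction) :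
    lam₁ * ∑ i, M.gradSq k j v i ≤ M.energyForm k j a v v ∧
      M.energyForm k j a v v ≤ lam₂ * ∑ i, M.gradSq k j v i := by
  have hi : ∀ (i : Fin M.numCells) (c : ℝ), IntegrableOn (fun x =>
      c * (vecFun (M.weakGrad k j v i) x ⬝ᵥ vecFun (M.weakGrad k j v i) x)) (M.cell i).carrier :=
    fun i c => (M.cell i).integrableOn_carrier (by fun_prop)
  simp only [energyForm, Finset.mul_sum, gradSq, ← integral_const_mul]
  constructor <;> refine Finset.sum_le_sum fun i _ => ?_
  · refine integral_mono_ae (hi i _) (M.integrableOn_energy ha h₁ i _ _) ?_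
    filter_upwards [M.ae_mem_domain i] with x hx
    rw [dotProduct_comm (a x *ᵥ _)]
    exact ha.lower x hx _
  · refine integral_mono_ae (M.integrableOn_energy ha h₁ i _ _) (hi i _) ?_
    filter_upwards [M.ae_mem_domain i] with x hx
    rw [dotProduct_comm (a x *ᵥ _)]
    exact ha.upper x hx _

end PolytopalMesh

-- The projected jump agrees on each facet with a polynomial of degree at most `k - 1`, and so does
-- the gradient of `v₀` on the cell, so the local estimate applies to them.
open PolytopalMesh in
lemma exists_gradSq_bounds (hd : 2 ≤ d) {k : ℕ} (hk : 1 ≤ k) (J : ℕ) {c : ℝ} (hc : 0 < c) :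
    ∃ C, 0 < C ∧ ∀ (Ω : Set (Pt d)) (M : PolytopalMesh d Ω), (∀ i, (M.cell i).IsFat c) →
      ∀ j : Fin M.numCells → ℕ, M.DegreeAdmissible k j → (∀ i, j i ≤ J) → ∀ v ∈ M.Vh k, ∀ i,
        M.gradSq k j v i ≤ C * M.discreteSq k v i ∧ M.discreteSq k v i ≤ C * M.gradSq k j v i := by
  obtain ⟨C, hC, H⟩ := exists_local_bounds hd hk J hc
  refine ⟨C, hC, fun Ω M hM j hj hjJ v hv i => ?_⟩
  have hex : ∀ ν : Pt d, ∃ p : Poly d, ν ∈ (M.cell i).normals → p ∈ polySpace d (k - 1) ∧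
      Set.EqOn (M.edgeJump k v i ν) (polyFun p) ((M.cell i).facet ν) := fun ν => by
    by_cases hν : ν ∈ (M.cell i).normals
    · obtain ⟨p, hp⟩ := ConvexPolytope.eqOn_poly_of_mem_polyOn (M.edgeJump_spec hd hv hν).1
      exact ⟨p, fun _ => hp⟩
    · exact ⟨0, fun h => absurd h hν⟩
  choose p hp using hex
  obtain ⟨hG, hrel⟩ := M.weakGrad_spec hd hv j i
  have h := H (M.cell i) (hM i) (j i) (hj i) (hjJ i) (grad (v.1 i)) (M.weakGrad k j v i) p
    (fun l => grad_mem_polySpace (hv.1 i) l) hG (fun ν hν => (hp ν hν).1) (fun q hq => by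
      rw [hrel q hq]
      congr 1
      refine Finset.sum_congr rfl fun ν hν => ?_
      exact setIntegral_congr_fun ((M.cell i).measurableSet_facet ν) fun x hx => by
        simp only [(hp ν hν).2 hx])
  have hS : ∑ ν ∈ (M.cell i).normals, ∫ x in (M.cell i).facet ν,
      polyFun (p ν) x ^ 2 ∂μHE[d - 1] = ∑ ν ∈ (M.cell i).normals,
        ∫ x in (M.cell i).facet ν, (M.edgeJump k v i ν x) ^ 2 ∂μHE[d - 1] :=
    Finset.sum_congr rfl fun ν hν =>
      setIntegral_congr_fun ((M.cell i).measurableSet_facet ν) fun x hx => by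
        simp only [(hp ν hν).2 hx]
  rw [hS] at h
  exact h

/-- The norm equivalence on fat meshes. -/
lemma exists_norm_equivalence (hd : 2 ≤ d) {k : ℕ} (hk : 1 ≤ k) (J : ℕ) {c : ℝ} (hc : 0 < c)
    (h₁ : 0 < lam₁) (h₂ : 0 < lam₂) :
    ∃ C₁ C₂ : ℝ, 0 < C₁ ∧ 0 < C₂ ∧ ∀ (Ω : Set (Pt d)) (M : PolytopalMesh d Ω),
      (∀ i, (M.cell i).IsFat c) → ∀ j : Fin M.numCells → ℕ, M.DegreeAdmissible k j →
      (∀ i, j i ≤ J) → ∀ (a : Pt d → Matrix (Fin d) (Fin d) ℝ), IsEllipticTensor Ω a lam₁ lam₂ →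
      ∀ v ∈ M.Vh k, C₁ * M.discreteH1 k v ≤ M.tripleBar k j a v ∧
        M.tripleBar k j a v ≤ C₂ * M.discreteH1 k v := by
  obtain ⟨C, hC, H⟩ := exists_gradSq_bounds hd hk J hc
  refine ⟨Real.sqrt (lam₁ / C), Real.sqrt (lam₂ * C), Real.sqrt_pos.2 (by positivity),
    Real.sqrt_pos.2 (by positivity), fun Ω M hM j hj hjJ a ha v hv => ?_⟩
  have hE := M.energyForm_self_bounds ha h₁ k j v
  have hD : M.discreteH1 k v = Real.sqrt (∑ i, M.discreteSq k v i) := rfl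
  have hl : ∑ i, M.discreteSq k v i ≤ C * ∑ i, M.gradSq k j v i := by
    rw [Finset.mul_sum]
    exact Finset.sum_le_sum fun i _ => (H Ω M hM j hj hjJ v hv i).2
  have hu : ∑ i, M.gradSq k j v i ≤ C * ∑ i, M.discreteSq k v i := by
    rw [Finset.mul_sum]
    exact Finset.sum_le_sum fun i _ => (H Ω M hM j hj hjJ v hv i).1
  rw [hD, PolytopalMesh.tripleBar, ← Real.sqrt_mul (by positivity),
    ← Real.sqrt_mul (by positivity)]
  refine ⟨Real.sqrt_le_sqrt ?_, Real.sqrt_le_sqrt ?_⟩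
  · calc lam₁ / C * ∑ i, M.discreteSq k v i ≤ lam₁ / C * (C * ∑ i, M.gradSq k j v i) := by gcongr
      _ = lam₁ * ∑ i, M.gradSq k j v i := by field_simp
      _ ≤ _ := hE.1
  · calc _ ≤ lam₂ * ∑ i, M.gradSq k j v i := hE.2
      _ ≤ lam₂ * (C * ∑ i, M.discreteSq k v i) := by gcongr
      _ = _ := by ring

end Elliptic

/-! ### Every finite mesh is fat -/

lemma exists_pos_forall_le {ι : Type*} [Finite ι] (f : ι → ℝ) (hf : ∀ i, 0 < f i) :
    ∃ c, 0 < c ∧ ∀ i, c ≤ f i := by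
  rcases isEmpty_or_nonempty ι with h | h
  · exact ⟨1, one_pos, fun i => h.elim i⟩
  · obtain ⟨i, hi⟩ := Finite.exists_min f
    exact ⟨f i, hf i, hi⟩

namespace ConvexPolytope

variable (T : ConvexPolytope d) {ν : Pt d}

lemma diam_facet_pos (hd : 2 ≤ d) (hν : ν ∈ T.normals) : 0 < Metric.diam (T.facet ν) := by
  obtain ⟨φ⟩ := exists_hyperplaneChart (by omega) (T.norm_eq_one ν hν) (T.offset ν)
  obtain ⟨x, hx⟩ := T.interior_preimage_facet_nonempty hd hν φ
  have : Nontrivial (Pt (d - 1)) := by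
    have : Nonempty (Fin (d - 1)) := ⟨⟨0, by omega⟩⟩
    infer_instance
  obtain ⟨a, ha, b, hb, hab⟩ :=
    (infinite_of_mem_nhds x (isOpen_interior.mem_nhds hx)).nontrivial
  rw [← dist_pos, ← φ.map.dist_map] at hab
  exact hab.trans_le (Metric.dist_le_diam_of_mem (T.isBounded_facet ν)
    (interior_subset ha : _ ∈ _) (interior_subset hb : _ ∈ _))

lemma measure_facet_pos (hd : 2 ≤ d) (hν : ν ∈ T.normals) :
    0 < μHE[d - 1].real (T.facet ν) := by
  obtain ⟨φ⟩ := exists_hyperplaneChart (by omega) (T.norm_eq_one ν hν) (T.offset ν)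
  rw [T.measureReal_facet φ]
  exact ENNReal.toReal_pos (Measure.measure_pos_of_nonempty_interior _
    (T.interior_preimage_facet_nonempty hd hν φ)).ne'
    (T.isBounded_preimage_facet φ).measure_lt_top.ne

/-- A single polytope has finitely many facets, and its volume, areas, diameters and angles between
distinct normals are positive, so it satisfies the shape-regularity bounds for some constants. -/
lemma exists_isFat_self (hd : 2 ≤ d) : ∃ c, 0 < c ∧ T.IsFat c := by
  have hh := T.size_pos hd
  have hV : 0 < volume.real T.carrier :=
    ENNReal.toReal_pos (Measure.measure_pos_of_nonempty_interior _ T.interior_nonempty).ne'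
      T.volume_ne_top
  obtain ⟨ρe, hρe, h₁⟩ := exists_pos_forall_le
    (fun ν : T.normals => μHE[d - 1].real (T.facet ν) / Metric.diam (T.facet ν) ^ (d - 1))
    (fun ν => div_pos (T.measure_facet_pos hd ν.2) (pow_pos (T.diam_facet_pos hd ν.2) _))
  obtain ⟨κ, hκ, h₂⟩ := exists_pos_forall_le
    (fun ν : T.normals => Metric.diam (T.facet ν) / T.size)
    (fun ν => div_pos (T.diam_facet_pos hd ν.2) hh)
  obtain ⟨θ, hθ, h₃⟩ := exists_pos_forall_le
    (fun p : {p : T.normals × T.normals // p.1 ≠ p.2} =>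
      InnerProductGeometry.angle (p.1.1 : Pt d) (p.1.2 : Pt d)) (fun p => by
        refine lt_of_le_of_ne (InnerProductGeometry.angle_nonneg _ _) fun h => p.2 ?_
        have h1 := T.norm_eq_one _ p.1.1.2
        have h2 := T.norm_eq_one _ p.1.2.2
        have h3 := (InnerProductGeometry.inner_eq_mul_norm_iff_angle_eq_zero
          (norm_ne_zero_iff.1 (by rw [h1]; norm_num))
          (norm_ne_zero_iff.1 (by rw [h2]; norm_num))).2 h.symm
        rw [h1, h2, mul_one] at h3
        exact Subtype.ext ((inner_eq_one_iff_of_norm_eq_one h1 h2).1 h3))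
  obtain ⟨c, hc, H⟩ := exists_isFat hd T.normals.card
    (show 0 < volume.real T.carrier / T.size ^ d by positivity) hρe hκ hθ
  refine ⟨c, hc, H T le_rfl (by field_simp; rfl) (fun ν hν => ?_) (fun ν hν => ?_)
    fun ν hν ν' hν' hne => h₃ ⟨(⟨ν, hν⟩, ⟨ν', hν'⟩), fun h => hne (congrArg Subtype.val h)⟩⟩
  · exact (le_div_iff₀ (pow_pos (T.diam_facet_pos hd hν) _)).1 (h₁ ⟨ν, hν⟩)
  · exact (le_div_iff₀ hh).1 (h₂ ⟨ν, hν⟩)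

end ConvexPolytope

lemma PolytopalMesh.exists_isFat {Ω : Set (Pt d)} (M : PolytopalMesh d Ω) (hd : 2 ≤ d) :
    ∃ c, 0 < c ∧ ∀ i, (M.cell i).IsFat c := by
  choose f hf hfat using fun i => (M.cell i).exists_isFat_self hd
  obtain ⟨c, hc, h⟩ := exists_pos_forall_le f hf
  exact ⟨c, hc, fun i => (hfat i).mono (h i)⟩

lemma PolytopalMesh.ShapeRegular.isFat (hd : 2 ≤ d) (J : ℕ) {ρv ρe κ θ : ℝ} (hρv : 0 < ρv)
    (hρe : 0 < ρe) (hκ : 0 < κ) (hθ : 0 < θ) :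
    ∃ c, 0 < c ∧ ∀ (Ω : Set (Pt d)) (M : PolytopalMesh d Ω), M.ShapeRegular ρv ρe κ θ →
      (∀ i, (M.cell i).normals.card ≤ J) → ∀ i, (M.cell i).IsFat c := by
  obtain ⟨c, hc, H⟩ := ConvexPolytope.exists_isFat hd J hρv hρe hκ hθ
  exact ⟨c, hc, fun Ω M hM hJ i => H _ (hJ i) (hM.cell_volume i) (hM.facet_area i)
    (hM.facet_diam i) (hM.facet_angle i)⟩

/-! ### Connectivity of the mesh to the boundary -/

/-- The product of finitely many nonzero linear forms is a nonzero polynomial, hence nonzero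
somewhere. -/
lemma exists_inner_ne_zero {ι : Type*} (s : Finset ι) (u : ι → Pt d) (hu : ∀ i ∈ s, u i ≠ 0) :
    ∃ w : Pt d, ∀ i ∈ s, inner ℝ (u i) w ≠ 0 := by
  let L : ι → Poly d := fun i => ∑ l, MvPolynomial.C (u i l) * MvPolynomial.X l
  have hL : ∀ i x, polyFun (L i) x = inner ℝ (u i) x := fun i x => by
    simp [L, PiLp.inner_apply, mul_comm]
  have hL0 : ∏ i ∈ s, L i ≠ 0 := Finset.prod_ne_zero_iff.2 fun i hi h => hu i hi (by
    rw [← inner_self_eq_zero (𝕜 := ℝ), ← hL, h, polyFun_zero])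
  by_contra! hcon
  refine hL0 (eq_zero_of_polyFun_eq_zero isOpen_univ ⟨0, trivial⟩ fun x _ => ?_)
  obtain ⟨i, hi, h⟩ := hcon x
  rw [polyFun_prod]
  exact Finset.prod_eq_zero hi (by rw [hL, h])

namespace ConvexPolytope

variable (T : ConvexPolytope d) {ν μ : Pt d}

lemma mem_interior_of_slack_pos {x : Pt d} (h : ∀ ν ∈ T.normals, 0 < T.slack ν x) :
    x ∈ interior T.carrier := by
  rw [mem_interior_iff_mem_nhds]
  have h1 : ∀ᶠ y in nhds x, ∀ ν ∈ T.normals, 0 < T.slack ν y :=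
    (Filter.eventually_all_finset _).2 fun ν hν =>
      (T.continuous_slack ν).continuousAt.eventually (lt_mem_nhds (h ν hν))
  filter_upwards [h1] with y hy
  exact T.mem_carrier.2 fun ν hν => (hy ν hν).le

lemma eventually_slack_pos {y : Pt d} (h : ∀ μ ∈ T.normals, μ ≠ ν → 0 < T.slack μ y) :
    ∀ᶠ x in nhds y, ∀ μ ∈ T.normals, μ ≠ ν → 0 < T.slack μ x := by
  refine (Filter.eventually_all_finset _).2 fun μ hμ => ?_
  by_cases hne : μ = ν
  · exact Filter.Eventually.of_forall fun x hx => absurd hne hx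
  · filter_upwards [(T.continuous_slack μ).continuousAt.eventually
      (lt_mem_nhds (h μ hμ hne))] with x hx _ using hx

/-- Seen from a point off both hyperplanes, two facet hyperplanes meet in a flat that spans, with
the point, a proper subspace. -/
lemma smul_sub_smul_ne_zero (hν : ν ∈ T.normals) (hμ : μ ∈ T.normals) (hne : ν ≠ μ) {x : Pt d}
    (hx : T.slack ν x ≠ 0) : T.slack μ x • ν - T.slack ν x • μ ≠ 0 := by
  intro h
  rw [sub_eq_zero] at h
  have hn := congrArg norm h
  rw [norm_smul, norm_smul, T.norm_eq_one ν hν, T.norm_eq_one μ hμ, mul_one, mul_one,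
    Real.norm_eq_abs, Real.norm_eq_abs, abs_eq_abs] at hn
  rcases hn with hn | hn
  · rw [hn] at h
    exact hne (smul_right_injective _ hx h)
  · rw [hn, neg_smul, ← smul_neg] at h
    have h1 : -ν = μ := smul_right_injective _ hx (by simpa using h)
    -- For opposite normals the sum of the two slacks is constant; it would be zero at `x` but is
    -- positive at an interior point.
    obtain ⟨z, hz⟩ := T.interior_nonempty
    have h2 := T.slack_pos_of_mem_interior hν hz
    have h3 := T.slack_pos_of_mem_interior hμ hz
    rw [← h1] at hn h3
    simp only [slack, inner_neg_left] at hn h2 h3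
    linarith

end ConvexPolytope

namespace PolytopalMesh

variable {Ω : Set (Pt d)} (M : PolytopalMesh d Ω)

/-- A set of cells that is closed under passing through all facets is empty. -/
lemma eq_empty_of_closed_under_neighbors (hd : 2 ≤ d) (S : Set (Fin M.numCells))
    (hS : ∀ i ∈ S, ∀ ν ∈ (M.cell i).normals, ∃ i' ∈ S, i' ≠ i ∧
      ∃ ν' ∈ (M.cell i').normals, (M.cell i').facet ν' = (M.cell i).facet ν) : S = ∅ := by
  by_contra hne
  obtain ⟨i₀, hi₀⟩ := Set.nonempty_iff_ne_empty.2 hne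
  -- a point of a cell that lies on none of the hyperplanes
  obtain ⟨x₀, hx₀, hx₀s⟩ : ∃ x₀ ∈ interior (M.cell i₀).carrier,
      ∀ i, ∀ ν ∈ (M.cell i).normals, (M.cell i).slack ν x₀ ≠ 0 := by
    by_contra! hcon
    have h0 : ∏ i, ∏ ν ∈ (M.cell i).normals, (M.cell i).lamPoly ν ≠ 0 := by
      refine Finset.prod_ne_zero_iff.2 fun i _ => Finset.prod_ne_zero_iff.2 fun ν hν h => ?_
      obtain ⟨z, hz⟩ := (M.cell i).interior_nonempty
      have h1 := (M.cell i).polyFun_lamPoly ν z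
      rw [h, polyFun_zero] at h1
      have h2 := div_pos ((M.cell i).slack_pos_of_mem_interior hν hz) ((M.cell i).size_pos hd)
      rw [← h1] at h2
      exact lt_irrefl _ h2
    refine h0 (eq_zero_of_polyFun_eq_zero isOpen_interior (M.cell i₀).interior_nonempty
      fun x hx => ?_)
    obtain ⟨i, ν, hν, h⟩ := hcon x hx
    rw [polyFun_prod]
    refine Finset.prod_eq_zero (Finset.mem_univ i) ?_
    rw [polyFun_prod]
    refine Finset.prod_eq_zero hν ?_
    rw [ConvexPolytope.polyFun_lamPoly, h, zero_div]
  -- a direction in which no ray from this point meets two hyperplanes of a cell at once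
  classical
  obtain ⟨w, hw⟩ := exists_inner_ne_zero
    (Finset.univ.filter fun o : Option (Σ i, (M.cell i).normals × (M.cell i).normals) =>
      ∀ p ∈ o, p.2.1 ≠ p.2.2)
    (fun o => o.elim (EuclideanSpace.single (⟨0, by omega⟩ : Fin d) (1 : ℝ)) fun p =>
      (M.cell p.1).slack p.2.2 x₀ • (p.2.1 : Pt d) - (M.cell p.1).slack p.2.1 x₀ • (p.2.2 : Pt d))
    (fun o ho => by
      rcases o with _ | ⟨i, ν, μ⟩
      · simp
      · have hνμ : ν ≠ μ := (Finset.mem_filter.1 ho).2 _ rfl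
        exact (M.cell i).smul_sub_smul_ne_zero ν.2 μ.2 (fun h => hνμ (Subtype.ext h))
          (hx₀s i ν ν.2))
  -- The index `none` carries a coordinate vector and is there only to force `w ≠ 0`.
  have hw0 : w ≠ 0 := by
    rintro rfl
    exact hw none (by simp) (inner_zero_right _)
  have hwn : 0 < ‖w‖ := norm_pos_iff.2 hw0
  have hgen : ∀ i, ∀ ν ∈ (M.cell i).normals, ∀ μ ∈ (M.cell i).normals, ν ≠ μ → ∀ t : ℝ,
      (M.cell i).slack ν (x₀ + t • w) = 0 → (M.cell i).slack μ (x₀ + t • w) ≠ 0 := by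
    intro i ν hν μ hμ hνμ t h1 h2
    have h3 : inner ℝ ((M.cell i).slack μ x₀ • ν - (M.cell i).slack ν x₀ • μ) w ≠ (0 : ℝ) :=
      hw (some ⟨i, ⟨ν, hν⟩, ⟨μ, hμ⟩⟩) (Finset.mem_filter.2 ⟨Finset.mem_univ _, fun p hp h => by
        obtain rfl := Option.mem_some_iff.1 hp
        exact hνμ (congrArg Subtype.val h)⟩)
    have hexp : ∀ ν : Pt d, (M.cell i).slack ν (x₀ + t • w) =
        (M.cell i).slack ν x₀ - t * inner ℝ ν w := fun ν => by
      simp only [ConvexPolytope.slack, inner_add_right, real_inner_smul_right]; ring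
    -- If both slacks vanish at parameter `t`, their values at `x₀` are `t * inner ℝ ν w` and `t *
    -- inner ℝ μ w`, and the combination that `w` was chosen to avoid is zero.
    rw [hexp, sub_eq_zero] at h1 h2
    rw [inner_sub_left, real_inner_smul_left, real_inner_smul_left, h1, h2] at h3
    exact h3 (by ring)
  -- the last exit point of the ray
  set U : Set (Pt d) := ⋃ i ∈ S, (M.cell i).carrier with hU
  have hSf : S.Finite := Set.toFinite S
  have hUc : IsCompact U := hSf.isCompact_biUnion fun i _ => (M.cell i).isCompact_carrier
  have hray : Continuous fun t : ℝ => x₀ + t • w := by fun_prop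
  set K : Set ℝ := {t | x₀ + t • w ∈ U} with hK
  have hKc : IsClosed K := hUc.isClosed.preimage hray
  have hKne : K.Nonempty := ⟨0, by
    simpa [hK, hU] using ⟨i₀, hi₀, interior_subset hx₀⟩⟩
  have hKb : BddAbove K := by
    obtain ⟨R, hR⟩ := hUc.isBounded.subset_closedBall x₀
    refine ⟨R / ‖w‖, fun t ht => ?_⟩
    have h1 : dist (x₀ + t • w) x₀ ≤ R := hR ht
    rw [dist_eq_norm, add_sub_cancel_left, norm_smul] at h1
    rw [le_div_iff₀ hwn]
    exact (mul_le_mul_of_nonneg_right (le_abs_self t) hwn.le).trans h1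
  set t := sSup K with ht
  have htK : t ∈ K := hKc.csSup_mem hKne hKb
  set y := x₀ + t • w with hy
  -- If `U` is a neighbourhood of `y`, the ray stays in `U` slightly beyond `t`, against the choice
  -- of `t` as the supremum.
  suffices hnhds : U ∈ nhds y by
    have h1 : ∀ᶠ s in nhds t, x₀ + s • w ∈ U := hray.continuousAt.eventually hnhds
    have h2 : ∀ᶠ s in nhdsWithin t (Set.Ioi t), x₀ + s • w ∈ U ∧ t < s :=
      (h1.filter_mono nhdsWithin_le_nhds).and self_mem_nhdsWithin
    obtain ⟨s, hs, hts⟩ := h2.exists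
    exact absurd (le_csSup hKb hs) (not_le.2 hts)
  obtain ⟨i, hi, hyi⟩ := Set.mem_iUnion₂.1 (show y ∈ U from htK)
  have hsub : ∀ i ∈ S, (M.cell i).carrier ⊆ U := fun i hi =>
    Set.subset_biUnion_of_mem (u := fun i => (M.cell i).carrier) hi
  -- at an exit point only one constraint is active
  have hothers : ∀ i, y ∈ (M.cell i).carrier → ∀ ν ∈ (M.cell i).normals,
      (M.cell i).slack ν y = 0 → ∀ μ ∈ (M.cell i).normals, μ ≠ ν → 0 < (M.cell i).slack μ y :=
    fun i hyi ν hν h0 μ hμ hne => lt_of_le_of_ne ((M.cell i).mem_carrier.1 hyi μ hμ)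
      (hgen i ν hν μ hμ hne.symm t h0).symm
  by_cases hact : ∃ ν ∈ (M.cell i).normals, (M.cell i).slack ν y = 0
  swap
  · push Not at hact
    refine Filter.mem_of_superset (mem_interior_iff_mem_nhds.1
      ((M.cell i).mem_interior_of_slack_pos fun ν hν => ?_)) (hsub i hi)
    exact lt_of_le_of_ne ((M.cell i).mem_carrier.1 hyi ν hν) (hact ν hν).symm
  obtain ⟨ν, hν, hν0⟩ := hact
  obtain ⟨i', hi', hii', ν', hν', hfac⟩ := hS i hi ν hν
  have hyf : y ∈ (M.cell i').facet ν' := by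
    rw [hfac]; exact (M.cell i).mem_facet.2 ⟨hyi, hν0⟩
  have hν0' := ((M.cell i').mem_facet.1 hyf).2
  have hev := (M.cell i).eventually_slack_pos (hothers i hyi ν hν hν0)
  have hev' := (M.cell i').eventually_slack_pos (hothers i' hyf.1 ν' hν' hν0')
  have hexp : ∀ x, (M.cell i).slack ν x = -inner ℝ ν (x - y) := fun x => by
    have : (M.cell i).slack ν x = (M.cell i).slack ν y - inner ℝ ν (x - y) := by
      simp only [ConvexPolytope.slack, inner_sub_right]; ring
    rw [this, hν0, zero_sub]
  have hexp' : ∀ x, (M.cell i').slack ν' x = -inner ℝ ν' (x - y) := fun x => by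
    have : (M.cell i').slack ν' x = (M.cell i').slack ν' y - inner ℝ ν' (x - y) := by
      simp only [ConvexPolytope.slack, inner_sub_right]; ring
    rw [this, hν0', zero_sub]
  have hνν : inner ℝ ν ν = (1 : ℝ) := by
    rw [real_inner_self_eq_norm_sq, (M.cell i).norm_eq_one ν hν]; norm_num
  have hνν' : inner ℝ ν' ν' = (1 : ℝ) := by
    rw [real_inner_self_eq_norm_sq, (M.cell i').norm_eq_one ν' hν']; norm_num
  -- the two cells lie on opposite sides of the common facet
  have hopp : ν' = -ν := by
    by_contra hne'
    have hlt : -1 < inner ℝ ν ν' := by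
      have h1 : 0 < ‖ν + ν'‖ ^ 2 :=
        pow_pos (norm_pos_iff.2 fun h => hne' (eq_neg_of_add_eq_zero_right h)) 2
      rw [← real_inner_self_eq_norm_sq, inner_add_left, inner_add_right, inner_add_right, hνν,
        hνν', real_inner_comm ν ν'] at h1
      linarith
    -- If the normals are not opposite, a small step along `-(ν + ν')` makes both active slacks
    -- positive and leaves the others positive, so the two cell interiors would meet.
    have htend : Filter.Tendsto (fun s : ℝ => y + s • -(ν + ν'))
        (nhdsWithin 0 (Set.Ioi 0)) (nhds y) := by
      have : Continuous fun s : ℝ => y + s • -(ν + ν') := by fun_prop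
      exact ((this.tendsto 0).mono_left nhdsWithin_le_nhds).trans (by simp)
    obtain ⟨s, ⟨h1, h2⟩, hs⟩ :=
      (((htend.eventually hev).and (htend.eventually hev')).and self_mem_nhdsWithin).exists
    replace hs : 0 < s := hs
    refine Set.disjoint_left.1 (M.disjoint_interior hii'.symm)
      ((M.cell i).mem_interior_of_slack_pos (x := y + s • -(ν + ν')) fun μ hμ => ?_)
      ((M.cell i').mem_interior_of_slack_pos fun μ hμ => ?_)
    · by_cases h : μ = ν
      · rw [h, hexp, add_sub_cancel_left, real_inner_smul_right, inner_neg_right, inner_add_right,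
          hνν]
        nlinarith
      · exact h1 μ hμ h
    · by_cases h : μ = ν'
      · rw [h, hexp', add_sub_cancel_left, real_inner_smul_right, inner_neg_right,
          inner_add_right, hνν', real_inner_comm]
        nlinarith
      · exact h2 μ hμ h
  -- Near `y` only the common hyperplane matters: a point on one side of it lies in the cell `i`, a
  -- point on the other side in `i'`.
  filter_upwards [hev, hev'] with x h1 h2
  rcases le_total 0 ((M.cell i).slack ν x) with h | h
  · refine hsub i hi ((M.cell i).mem_carrier.2 fun μ hμ => ?_)
    by_cases hμν : μ = ν
    · rwa [hμν]
    · exact (h1 μ hμ hμν).le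
  · refine hsub i' hi' ((M.cell i').mem_carrier.2 fun μ hμ => ?_)
    by_cases hμν : μ = ν'
    · rw [hμν, hexp', hopp, inner_neg_left, neg_neg]
      rw [hexp] at h
      linarith
    · exact (h2 μ hμ hμν).le

end PolytopalMesh

/-! ### Definiteness of the discrete norm -/

/-- Characteristic zero: a coefficient with positive exponent in some variable reappears in that
partial derivative multiplied by the exponent. -/
lemma eq_C_of_grad_eq_zero {p : Poly d} (h : grad p = 0) : ∃ c, p = MvPolynomial.C c := by
  refine ⟨MvPolynomial.coeff 0 p, ?_⟩
  ext s
  rw [MvPolynomial.coeff_C]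
  split_ifs with hs
  · rw [← hs]
  · obtain ⟨l, hl⟩ : ∃ l, s l ≠ 0 := by
      by_contra! hcon
      exact hs (by ext l; simp [hcon l])
    have h1 : MvPolynomial.pderiv l p = 0 := congrFun h l
    have h2 := congrArg (MvPolynomial.coeff (s - Finsupp.single l 1)) h1
    have h3 : (s - Finsupp.single l 1) + Finsupp.single l 1 = s :=
      tsub_add_cancel_of_le (by simpa using Nat.one_le_iff_ne_zero.2 hl)
    rw [MvPolynomial.coeff_pderiv, h3, MvPolynomial.coeff_zero] at h2
    refine (mul_eq_zero.1 h2).resolve_right ?_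
    positivity

namespace PolytopalMesh

variable {Ω : Set (Pt d)} (M : PolytopalMesh d Ω) {k : ℕ}

lemma discreteSq_nonneg (v : M.WeakFunction) (i : Fin M.numCells) : 0 ≤ M.discreteSq k v i :=
  add_nonneg (integral_nonneg fun _ => Finset.sum_nonneg fun _ _ => mul_self_nonneg _)
    (mul_nonneg (inv_nonneg.2 (M.cell i).size_nonneg)
      (Finset.sum_nonneg fun _ _ => integral_nonneg fun _ => sq_nonneg _))

/-- Zero gradients make `v₀` constant on each cell, and zero jumps make `v_b` equal to that constant
on its facets. Single-valuedness on edges passes a nonzero constant to the neighbour, while the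
boundary condition excludes one at a boundary facet. -/
lemma eq_zero_of_discreteH1_eq_zero (hd : 2 ≤ d) {v : M.WeakFunction} (hv : v ∈ M.Vh0 k)
    (h : M.discreteH1 k v = 0) : v = 0 := by
  have h0 : ∑ i, M.discreteSq k v i = 0 :=
    (Real.sqrt_eq_zero (Finset.sum_nonneg fun i _ => M.discreteSq_nonneg v i)).1 h
  rw [Finset.sum_eq_zero_iff_of_nonneg fun i _ => M.discreteSq_nonneg v i] at h0
  have hc : ∀ i, ∃ c, v.1 i = MvPolynomial.C c := fun i => by
    refine eq_C_of_grad_eq_zero ((M.cell i).eq_zero_of_integral_dotProduct_self_eq_zero ?_)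
    exact ((add_eq_zero_iff_of_nonneg
      (integral_nonneg fun x => Finset.sum_nonneg fun l _ => mul_self_nonneg _)
      (mul_nonneg (inv_nonneg.2 (M.cell i).size_nonneg)
      (Finset.sum_nonneg fun ν _ => integral_nonneg fun x => sq_nonneg _))).1
        (h0 i (Finset.mem_univ i))).1
  choose c hc using hc
  have hb : ∀ i, ∀ ν ∈ (M.cell i).normals,
      v.2 ((M.cell i).facet ν) = ((M.cell i).facet ν).indicator fun _ => c i := by
    intro i ν hν
    set e := (M.cell i).facet ν with he
    have h1 := ((add_eq_zero_iff_of_nonneg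
      (integral_nonneg fun x => Finset.sum_nonneg fun l _ => mul_self_nonneg _)
      (mul_nonneg (inv_nonneg.2 (M.cell i).size_nonneg)
      (Finset.sum_nonneg fun ν _ => integral_nonneg fun x => sq_nonneg _))).1
        (h0 i (Finset.mem_univ i))).2
    have h2 := (mul_eq_zero.1 h1).resolve_left
      (inv_ne_zero ((M.cell i).size_pos hd).ne')
    rw [Finset.sum_eq_zero_iff_of_nonneg fun ν _ => integral_nonneg fun x => sq_nonneg _] at h2
    have h3 : M.edgeJump k v i ν = 0 := (M.cell i).eq_zero_of_mem_polyOn hd hν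
      (M.edgeJump_spec hd hv.1 hν).1 (h2 ν hν)
    have hCe : polyFun (MvPolynomial.C (c i) : Poly d) = fun _ => c i := by ext x; simp
    have h4 : v.2 e - e.indicator (fun _ => c i) ∈ polyOn e (k - 1) := by
      refine Submodule.sub_mem _ (hv.1.2.1 _ ⟨i, ν, hν, rfl⟩) ?_
      rw [← hCe]
      exact indicator_mem_polyOn (C_mem_polySpace _ _)
    -- With `v₀` constant the jump already lies in `P_{k-1}(e)`, so the projection leaves it
    -- unchanged.
    have h5 : M.edgeJump k v i ν = v.2 e - e.indicator (fun _ => c i) := by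
      refine IsEdgeProj.eq_edgeProj (M.cell i) hd hν ⟨h4, fun p hp => ?_⟩
      refine setIntegral_congr_fun ((M.cell i).measurableSet_facet ν) fun x hx => ?_
      simp only [Pi.sub_apply, hc, polyFun_C, he, Set.indicator_of_mem hx]
    rw [h3] at h5
    exact sub_eq_zero.1 h5.symm
  have hcne : ∀ {i ν}, ν ∈ (M.cell i).normals → ∀ {a b : ℝ},
      ((M.cell i).facet ν).indicator (fun _ => a) = ((M.cell i).facet ν).indicator (fun _ => b) →
      a = b := fun {i ν} hν {a b} hab => by
    obtain ⟨x, hx⟩ := (M.cell i).facet_nonempty hd hν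
    simpa [hx] using congrFun hab x
  have hS : {i | c i ≠ 0} = ∅ := by
    refine M.eq_empty_of_closed_under_neighbors hd _ fun i hi ν hν => ?_
    rcases M.conforming i ν hν with hfr | ⟨i', hne, ν', hν', hfac⟩
    · have h1 := hv.2 _ ⟨i, ν, hν, rfl⟩ hfr
      rw [hb i ν hν] at h1
      exact absurd (hcne (b := 0) hν (h1.trans (by ext x; simp))) hi
    · refine ⟨i', ?_, hne, ν', hν', hfac⟩
      have h1 := hb i' ν' hν'
      rw [hfac, hb i ν hν] at h1
      have := hcne hν h1
      rw [Set.mem_ofPred_eq, ← this]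
      exact hi
  have hc0 : ∀ i, c i = 0 := fun i => by
    by_contra hi
    have : i ∈ {i | c i ≠ 0} := hi
    rw [hS] at this
    exact this
  refine Prod.ext (funext fun i => ?_) (funext fun e => ?_)
  · rw [hc, hc0, map_zero]; rfl
  · by_cases he : e ∈ M.edges
    · obtain ⟨i, ν, hν, rfl⟩ := he
      rw [hb i ν hν, hc0]
      ext x; simp
    · exact hv.1.2.2 e he

end PolytopalMesh

/-! ### Unique solvability of the scheme -/

namespace PolytopalMesh

variable {Ω : Set (Pt d)} (M : PolytopalMesh d Ω) {k : ℕ} {j : Fin M.numCells → ℕ}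
  {a : Pt d → Matrix (Fin d) (Fin d) ℝ} {lam₁ lam₂ : ℝ}

lemma finite_edges : M.edges.Finite := by
  have : M.edges = ⋃ i, (M.cell i).facet '' (M.cell i).normals := by
    ext e
    simp only [edges, Set.mem_ofPred_eq, Set.mem_iUnion, Set.mem_image, Finset.mem_coe]
    simp only [eq_comm]
  rw [this]
  exact Set.finite_iUnion fun i => (M.cell i).normals.finite_toSet.image _

instance : FiniteDimensional ℝ (M.Vh k) := by
  have : Finite M.edges := M.finite_edges
  let f : M.Vh k →ₗ[ℝ] (Fin M.numCells → polySpace d k) × ((e : M.edges) → polyOn e.1 (k - 1)) :=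
    { toFun := fun v => (fun i => ⟨v.1.1 i, v.2.1 i⟩, fun e => ⟨v.1.2 e.1, v.2.2.1 e.1 e.2⟩)
      map_add' := fun v w => rfl
      map_smul' := fun c v => rfl }
  refine Module.Finite.of_injective f fun v w hvw => Subtype.ext (Prod.ext (funext fun i => ?_)
    (funext fun e => ?_))
  · exact congrArg Subtype.val (congrFun (congrArg Prod.fst hvw) i)
  · by_cases he : e ∈ M.edges
    · exact congrArg Subtype.val (congrFun (congrArg Prod.snd hvw) ⟨e, he⟩)
    · rw [v.2.2.2 e he, w.2.2.2 e he]

/-- The energy form as a bilinear form on `V_h`. -/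
def energyBilin (hd : 2 ≤ d) (ha : IsEllipticTensor Ω a lam₁ lam₂) (h₁ : 0 < lam₁)
    (k : ℕ) (j : Fin M.numCells → ℕ) : M.Vh k →ₗ[ℝ] M.Vh k →ₗ[ℝ] ℝ :=
  LinearMap.mk₂ ℝ (fun v w => M.energyForm k j a v.1 w.1)
    (fun v₁ v₂ w => by
      simp only [energyForm, ← Finset.sum_add_distrib]
      refine Finset.sum_congr rfl fun i _ => ?_
      rw [← integral_add (M.integrableOn_energy ha h₁ i _ _) (M.integrableOn_energy ha h₁ i _ _),
        Submodule.coe_add, M.weakGrad_add hd v₁.2 v₂.2]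
      simp only [vecFun_add, mulVec_add, add_dotProduct])
    (fun c v w => by
      simp only [energyForm, smul_eq_mul, Finset.mul_sum, ← integral_const_mul]
      refine Finset.sum_congr rfl fun i _ => ?_
      rw [Submodule.coe_smul, M.weakGrad_smul hd c v.2]
      simp only [vecFun_smul, mulVec_smul, smul_dotProduct, smul_eq_mul])
    (fun v w₁ w₂ => by
      simp only [energyForm, ← Finset.sum_add_distrib]
      refine Finset.sum_congr rfl fun i _ => ?_
      rw [← integral_add (M.integrableOn_energy ha h₁ i _ _) (M.integrableOn_energy ha h₁ i _ _),
        Submodule.coe_add, M.weakGrad_add hd w₁.2 w₂.2]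
      simp only [vecFun_add, dotProduct_add])
    (fun c v w => by
      simp only [energyForm, smul_eq_mul, Finset.mul_sum, ← integral_const_mul]
      refine Finset.sum_congr rfl fun i _ => ?_
      rw [Submodule.coe_smul, M.weakGrad_smul hd c w.2]
      simp only [vecFun_smul, dotProduct_smul, smul_eq_mul])

/-- `V_h^0` as a subspace of `V_h`. -/
def Vh0Sub (k : ℕ) : Submodule ℝ (M.Vh k) where
  carrier := {v | v.1 ∈ M.Vh0 k}
  add_mem' := fun {v w} hv hw => ⟨(v + w).2, fun e he hfr => by
    change v.1.2 e + w.1.2 e = 0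
    rw [hv.2 e he hfr, hw.2 e he hfr, add_zero]⟩
  zero_mem' := ⟨(0 : M.Vh k).2, fun _ _ _ => rfl⟩
  smul_mem' := fun c v hv => ⟨(c • v).2, fun e he hfr => by
    change c • v.1.2 e = 0
    rw [hv.2 e he hfr, smul_zero]⟩

lemma integrableOn_mul_polyFun {f : Pt d → ℝ} (hf : MemLp f 2 (volume.restrict Ω))
    (i : Fin M.numCells) (p : Poly d) :
    IntegrableOn (fun x => f x * polyFun p x) (M.cell i).carrier := by
  have h1 : MemLp f 2 (volume.restrict (M.cell i).carrier) := by
    rw [restrict_carrier]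
    exact hf.mono_measure (Measure.restrict_mono (M.interior_cell_subset i) le_rfl)
  have : IsFiniteMeasure ((volume : Measure (Pt d)).restrict (M.cell i).carrier) :=
    isFiniteMeasure_restrict.2 (M.cell i).volume_ne_top
  have h2 : IntegrableOn f (M.cell i).carrier := h1.integrable one_le_two
  exact h2.mul_continuousOn (continuous_polyFun p).continuousOn (M.cell i).isCompact_carrier

/-- The load functional `v ↦ (f, v_0)`. -/
def load {f : Pt d → ℝ} (hf : MemLp f 2 (volume.restrict Ω)) : M.Vh k →ₗ[ℝ] ℝ where
  toFun v := ∑ i, ∫ x in (M.cell i).carrier, f x * polyFun (v.1.1 i) x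
  map_add' v w := by
    rw [← Finset.sum_add_distrib]
    refine Finset.sum_congr rfl fun i _ => ?_
    rw [← integral_add (M.integrableOn_mul_polyFun hf i _) (M.integrableOn_mul_polyFun hf i _)]
    simp [mul_add]
  map_smul' c v := by
    simp only [RingHom.id_apply, smul_eq_mul, Finset.mul_sum, ← integral_const_mul]
    refine Finset.sum_congr rfl fun i _ => ?_
    simp [mul_left_comm]

lemma _root_.WG.ConvexPolytope.testIntegrable_of_memLp (hd : 1 ≤ d) (T : ConvexPolytope d)
    {ν : Pt d} (hν : ν ∈ T.normals) {s : Set (Pt d)} (hs : T.facet ν ⊆ s) {g : Pt d → ℝ}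
    (hg : MemLp g 2 ((μHE[d - 1] : Measure (Pt d)).restrict s)) :
    TestIntegrable (T.facet ν) g := fun p => by
  have h1 := hg.mono_measure (Measure.restrict_mono hs le_rfl)
  have : IsFiniteMeasure ((μHE[d - 1] : Measure (Pt d)).restrict (T.facet ν)) :=
    isFiniteMeasure_restrict.2 (T.measure_facet_ne_top hd hν)
  have h2 : IntegrableOn g (T.facet ν) μHE[d - 1] := h1.integrable one_le_two
  exact h2.mul_continuousOn (continuous_polyFun p).continuousOn
    (T.isCompact_carrier.of_isClosed_subset (T.isClosed_facet ν) (T.facet_subset ν))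

/-- The weak function with `u_0 = 0`, `u_b = Q_b g` on the boundary and `u_b = 0` on the interior
edges. -/
lemma exists_boundary_lift (hd : 2 ≤ d) {g : Pt d → ℝ}
    (hg : MemLp g 2 ((μHE[d - 1] : Measure (Pt d)).restrict (frontier Ω))) :
    ∃ u : M.Vh k, ∀ e ∈ M.edges, e ⊆ frontier Ω → u.1.2 e = edgeProj (k - 1) e g := by
  classical
  refine ⟨⟨(0, fun e => if e ∈ M.edges ∧ e ⊆ frontier Ω then edgeProj (k - 1) e g else 0),
    fun i => Submodule.zero_mem _, fun e he => ?_, fun e he => if_neg fun h => he h.1⟩,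
    fun e he hfr => if_pos ⟨he, hfr⟩⟩
  by_cases hfr : e ⊆ frontier Ω
  · obtain ⟨i, ν, hν, rfl⟩ := he
    simp only [hfr, and_true]
    rw [if_pos ⟨i, ν, hν, rfl⟩]
    exact ((M.cell i).edgeProj_spec hd hν
      ((M.cell i).testIntegrable_of_memLp (by omega) hν hfr hg)).1
  · simp only [hfr, and_false, if_false]
    exact Submodule.zero_mem _

lemma eq_zero_of_energyForm_self_eq_zero (hd : 2 ≤ d) {C : ℝ} (hC : 0 < C)
    (hcoer : ∀ v ∈ M.Vh k, C * M.discreteH1 k v ≤ M.tripleBar k j a v) {v : M.WeakFunction}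
    (hv : v ∈ M.Vh0 k) (h : M.energyForm k j a v v = 0) : v = 0 := by
  have h1 := hcoer v hv.1
  rw [tripleBar, h, Real.sqrt_zero] at h1
  refine M.eq_zero_of_discreteH1_eq_zero hd hv (le_antisymm ?_ (Real.sqrt_nonneg _))
  exact nonpos_of_mul_nonpos_right h1 hC

/-- After subtracting the boundary lift the unknown lies in `V_h^0`, where coercivity makes the
energy form definite. Definiteness gives existence by representation of the modified load, and
uniqueness by testing with the difference of two solutions. -/
lemma existsUnique_isWGSolution (hd : 2 ≤ d) (ha : IsEllipticTensor Ω a lam₁ lam₂)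
    (h₁ : 0 < lam₁) {C : ℝ} (hC : 0 < C)
    (hcoer : ∀ v ∈ M.Vh k, C * M.discreteH1 k v ≤ M.tripleBar k j a v) {f g : Pt d → ℝ}
    (hf : MemLp f 2 (volume.restrict Ω))
    (hg : MemLp g 2 ((μHE[d - 1] : Measure (Pt d)).restrict (frontier Ω))) :
    ∃! u : M.WeakFunction, M.IsWGSolution k j a f g u := by
  have hpos : ∀ v : M.Vh k, v ∈ M.Vh0Sub k → M.energyBilin hd ha h₁ k j v v = 0 → v = 0 :=
    fun v hv h => Subtype.ext (M.eq_zero_of_energyForm_self_eq_zero hd hC hcoer hv h)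
  obtain ⟨ug, hug⟩ := M.exists_boundary_lift (k := k) hd hg
  obtain ⟨u₀, hu₀⟩ := exists_repr_of_definite
    ((M.energyBilin hd ha h₁ k j).domRestrict₁₂ (M.Vh0Sub k) (M.Vh0Sub k))
    (fun v hv => Subtype.ext (hpos v.1 v.2 hv))
    ((M.load hf - M.energyBilin hd ha h₁ k j ug).domRestrict (M.Vh0Sub k))
  refine ⟨(ug + u₀.1).1, ⟨(ug + u₀.1).2, fun e he hfr => ?_, fun v hv => ?_⟩, fun u hu => ?_⟩
  · change ug.1.2 e + u₀.1.1.2 e = _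
    rw [hug e he hfr, u₀.2.2 e he hfr, add_zero]
  · have h := hu₀ ⟨⟨v, hv.1⟩, hv⟩
    change M.energyBilin hd ha h₁ k j u₀.1 ⟨v, hv.1⟩ =
      M.load hf ⟨v, hv.1⟩ - M.energyBilin hd ha h₁ k j ug ⟨v, hv.1⟩ at h
    change M.energyBilin hd ha h₁ k j (ug + u₀.1) ⟨v, hv.1⟩ = M.load hf ⟨v, hv.1⟩
    rw [map_add, LinearMap.add_apply, h]; ring
  · have hw : (⟨u, hu.mem⟩ - (ug + u₀.1) : M.Vh k) ∈ M.Vh0Sub k :=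
      ⟨Subtype.prop _, fun e he hfr => by
        change u.2 e - (ug.1.2 e + u₀.1.1.2 e) = 0
        rw [hu.boundary e he hfr, hug e he hfr, u₀.2.2 e he hfr, add_zero, sub_self]⟩
    refine congrArg Subtype.val (sub_eq_zero.1 (hpos _ hw ?_))
    set w : M.Vh k := ⟨u, hu.mem⟩ - (ug + u₀.1)
    have h1 : M.energyBilin hd ha h₁ k j ⟨u, hu.mem⟩ w = M.load hf w := hu.equation w.1 hw
    have h2 : M.energyBilin hd ha h₁ k j u₀.1 w =
      M.load hf w - M.energyBilin hd ha h₁ k j ug w := hu₀ ⟨w, hw⟩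
    have h3 : ∀ w' : M.Vh k, M.energyBilin hd ha h₁ k j (⟨u, hu.mem⟩ - (ug + u₀.1)) w' =
        M.energyBilin hd ha h₁ k j ⟨u, hu.mem⟩ w' - (M.energyBilin hd ha h₁ k j ug w' +
          M.energyBilin hd ha h₁ k j u₀.1 w') := fun w' => by
      rw [map_sub, map_add, LinearMap.sub_apply, LinearMap.add_apply]
    exact (h3 w).trans (by rw [h1, h2]; ring)

end PolytopalMesh

end WG

end

/-! ### The main theorem -/

theorem mainTheorem3 (d k : ℕ) (hd : 2 ≤ d) (hk : 1 ≤ k) :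
    -- norm equivalence on every convex polytopal partition
    (∀ (Ω : Set (WG.Pt d)) (M : WG.PolytopalMesh d Ω) (j : Fin M.numCells → ℕ),
      M.DegreeAdmissible k j →
      ∀ (lam₁ lam₂ : ℝ), 0 < lam₁ → 0 < lam₂ →
      ∀ (a : WG.Pt d → Matrix (Fin d) (Fin d) ℝ), WG.IsEllipticTensor Ω a lam₁ lam₂ →
        ∃ C₁ C₂ : ℝ, 0 < C₁ ∧ 0 < C₂ ∧ ∀ v ∈ M.Vh k,
          C₁ * M.discreteH1 k v ≤ M.tripleBar k j a v ∧
            M.tripleBar k j a v ≤ C₂ * M.discreteH1 k v) ∧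
    -- the constants are uniform over shape-regular partitions
    (∀ (J : ℕ) (ρv ρe κ θ lam₁ lam₂ : ℝ), 0 < ρv → 0 < ρe → 0 < κ → 0 < θ →
      0 < lam₁ → 0 < lam₂ →
      ∃ C₁ C₂ : ℝ, 0 < C₁ ∧ 0 < C₂ ∧
        ∀ (Ω : Set (WG.Pt d)) (M : WG.PolytopalMesh d Ω), M.ShapeRegular ρv ρe κ θ →
        ∀ (j : Fin M.numCells → ℕ), M.DegreeAdmissible k j → (∀ i, j i ≤ J) →
        ∀ (a : WG.Pt d → Matrix (Fin d) (Fin d) ℝ), WG.IsEllipticTensor Ω a lam₁ lam₂ →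
        ∀ v ∈ M.Vh k,
          C₁ * M.discreteH1 k v ≤ M.tripleBar k j a v ∧
            M.tripleBar k j a v ≤ C₂ * M.discreteH1 k v) ∧
    -- unique solvability of the scheme
    (∀ (Ω : Set (WG.Pt d)) (M : WG.PolytopalMesh d Ω) (j : Fin M.numCells → ℕ),
      M.DegreeAdmissible k j →
      ∀ (lam₁ lam₂ : ℝ), 0 < lam₁ → 0 < lam₂ →
      ∀ (a : WG.Pt d → Matrix (Fin d) (Fin d) ℝ), WG.IsEllipticTensor Ω a lam₁ lam₂ →
      ∀ (f g : WG.Pt d → ℝ),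
        MeasureTheory.MemLp f 2 (MeasureTheory.volume.restrict Ω) →
        MeasureTheory.MemLp g 2
          ((MeasureTheory.Measure.euclideanHausdorffMeasure (d - 1)).restrict (frontier Ω)) →
        ∃! u : M.WeakFunction, M.IsWGSolution k j a f g u) := by
  have hnorm : ∀ (Ω : Set (WG.Pt d)) (M : WG.PolytopalMesh d Ω) (j : Fin M.numCells → ℕ),
      M.DegreeAdmissible k j → ∀ (lam₁ lam₂ : ℝ), 0 < lam₁ → 0 < lam₂ →
      ∀ (a : WG.Pt d → Matrix (Fin d) (Fin d) ℝ), WG.IsEllipticTensor Ω a lam₁ lam₂ →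
        ∃ C₁ C₂ : ℝ, 0 < C₁ ∧ 0 < C₂ ∧ ∀ v ∈ M.Vh k,
          C₁ * M.discreteH1 k v ≤ M.tripleBar k j a v ∧
            M.tripleBar k j a v ≤ C₂ * M.discreteH1 k v := by
    intro Ω M j hj lam₁ lam₂ h₁ h₂ a ha
    obtain ⟨c, hc, hfat⟩ := M.exists_isFat hd
    obtain ⟨C₁, C₂, hC₁, hC₂, H⟩ :=
      -- For a fixed mesh the largest `j i` bounds all degrees.
      WG.exists_norm_equivalence hd hk (Finset.univ.sup j) hc h₁ h₂
    exact ⟨C₁, C₂, hC₁, hC₂,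
      H Ω M hfat j hj (fun i => Finset.le_sup (Finset.mem_univ i)) a ha⟩
  refine ⟨hnorm, ?_, ?_⟩
  · intro J ρv ρe κ θ lam₁ lam₂ hρv hρe hκ hθ h₁ h₂
    obtain ⟨c, hc, hfat⟩ := WG.PolytopalMesh.ShapeRegular.isFat hd J hρv hρe hκ hθ
    obtain ⟨C₁, C₂, hC₁, hC₂, H⟩ := WG.exists_norm_equivalence hd hk J hc h₁ h₂
    refine ⟨C₁, C₂, hC₁, hC₂, fun Ω M hM j hj hjJ a ha => ?_⟩
    -- The number of facets needs no separate bound: `n_T ≤ n_T + k - 1 ≤ j_T ≤ J` because `k ≥ 1`.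
    refine H Ω M (hfat Ω M hM fun i => ?_) j hj hjJ a ha
    have h1 := hj i
    have h2 := hjJ i
    omega
  · intro Ω M j hj lam₁ lam₂ h₁ h₂ a ha f g hf hg
    obtain ⟨C₁, C₂, hC₁, -, H⟩ := hnorm Ω M j hj lam₁ lam₂ h₁ h₂ a ha
    exact M.existsUnique_isWGSolution hd ha h₁ hC₁ (fun v hv => (H v hv).1) hf hg
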